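/- Let $\mathsf h=\ell^2(\mathbb N)$ with canonical orthonormal basis $(e_n)_{n\ge 0}$, let $r>0$, $\lambda,\mu>0$ and $\zeta^+,\zeta^-\in\mathbb R$, and put $\omega_n=n(n+r-1)$. Let $N$ be the number operator, $Ne_n=ne_n$, and let $B,B^+$ be the operators with domain $\mathrm{Dom}(N)=\{u:\sum_n n^2|u_n|^2<\infty\}$ given by $Be_n=\omega_n^{1/2}e_{n-1}$ for $n\ge 1$, $Be_0=0$, $B^+e_n=\omega_{n+1}^{1/2}e_{n+1}$. Let $L_1=\mu B$, $L_2=\lambda B^+$, $$G=-\tfrac{\lambda^2}{2}BB^+-\tfrac{\mu^2}{2}B^+B-i(\zeta^+BB^++\zeta^-B^+B)\quad\text{on }\mathrm{Dom}(N^2),$$ and let $(P_t)_{t\ge 0}$ be the contraction semigroup generated by $G$, that is, $$P_te_n=\exp\Big(-t\big((\tfrac{\lambda^2}{2}+i\zeta^+)\omega_{n+1}+(\tfrac{\mu^2}{2}+i\zeta^-)\omega_n\big)\Big)e_n .$$ The minimal quantum dynamical semigroup of this model is the quantum dynamical semigroup $\mathcal T=(\mathcal T_t)_{t\ge 0}$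 on $\mathcal B(\mathsf h)$ (a semigroup of completely positive normal contractions, $\sigma$-weakly continuous in $t$) that satisfies $$\langle v,\mathcal T_t(x)u\rangle=\langle P_tv,xP_tu\rangle+\sum_{\ell=1}^2\int_0^t\langle L_\ell P_{t-s}v,\mathcal T_s(x)L_\ell P_{t-s}u\rangle\,ds\qquad(u,v\in\mathrm{Dom}(G),\ x\in\mathcal B(\mathsf h),\ t\ge 0)$$ and satisfies $\mathcal T_t(x)\le\mathcal T'_t(x)$ for all $t\ge0$ and $x\ge 0$ whenever $(\mathcal T'_t)_{t\ge 0}$ is a family of positive linear maps satisfying the same equation. Suppose $\lambda\le\mu$. Then the minimal quantum dynamical semigroup $\mathcal T$ exists, is unique, and is Markov ($\mathcal T_t(\mathbb 1)=\mathbb 1$ for all $t$). It is irreducible: the only subharmonic projections, that is, orthogonal projections $p$ with $\mathcal T_t(p)\ge p$ for all $t\ge 0$, are $0$ and $\mathbb 1$. If moreover $\lambda<\mu$ and $\nu=\lambda/\mu$, then $$\rho=(1-\nu^2)\sum_{n\ge 0}\nu^{2n}|e_n\rangle\langle e_n|$$ is the unique $\mathcal T$-invariant normal state: it is a density matrix with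 $\mathrm{tr}(\rho\,\mathcal T_t(x))=\mathrm{tr}(\rho x)$ for all $t\ge 0$ and $x\in\mathcal B(\mathsf h)$, and it is the only density matrix with this property. -/

import Mathlib

open scoped NNReal lp

noncomputable section

namespace QuadraticOscillator

/-- The Hilbert space `ℓ²(ℕ)`. -/
abbrev Hilb : Type := lp (fun _ : ℕ => ℂ) 2

/-- The algebra `B(h)` of all bounded operators on `ℓ²(ℕ)`, with the Loewner order. -/
abbrev Obs : Type := Hilb →L[ℂ] Hilb

/-- The canonical orthonormal basis `(e_n)`. -/
def e (n : ℕ) : Hilb := lp.single 2 n (1 : ℂ)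

/-- The real parameters of the model: `r > 0` (which labels the Fock representation),
`lam, mu > 0`, and the two Hamiltonian coefficients. -/
structure Params where
  r : ℝ
  lam : ℝ
  mu : ℝ
  zetaPlus : ℝ
  zetaMinus : ℝ
  r_pos : 0 < r
  lam_pos : 0 < lam
  mu_pos : 0 < mu

/-! ### Domains and operators -/

lemma memlp_iff (f : ℕ → ℂ) : Memℓp f 2 ↔ Summable fun n => ‖f n‖ ^ 2 := by
  rw [memℓp_gen_iff (by norm_num)]
  simp

/-- The domain of `N ^ k`, where `N` is the number operator: all `u` such that the sequence
`n ^ k * u_n` is square summable. -/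
def domN (k : ℕ) : Submodule ℂ Hilb where
  carrier := {u | Memℓp (fun n : ℕ => (n : ℂ) ^ k * u n) 2}
  zero_mem' := by
    have h : (fun n : ℕ => (n : ℂ) ^ k * (0 : Hilb) n) = fun _ => 0 := by
      funext n; simp
    simp only [Set.mem_ofPred_eq]
    rw [h]
    exact zero_mem_ℓp'
  add_mem' := by
    intro u v hu hv
    have h : (fun n : ℕ => (n : ℂ) ^ k * (u + v) n)
        = (fun n : ℕ => (n : ℂ) ^ k * u n) + (fun n : ℕ => (n : ℂ) ^ k * v n) := by
      funext n; simp [mul_add]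
    simp only [Set.mem_ofPred_eq]
    rw [h]
    exact Memℓp.add hu hv
  smul_mem' := by
    intro c u hu
    have h : (fun n : ℕ => (n : ℂ) ^ k * (c • u) n)
        = c • (fun n : ℕ => (n : ℂ) ^ k * u n) := by
      funext n; simp; ring
    simp only [Set.mem_ofPred_eq]
    rw [h]
    exact Memℓp.const_smul hu c

lemma mem_domN_iff (k : ℕ) (u : Hilb) :
    u ∈ domN k ↔ Memℓp (fun n : ℕ => (n : ℂ) ^ k * u n) 2 := Iff.rfl

/-- `(1 + n ^ k) |u_n|` is square summable for `u` in the domain of `N ^ k`. -/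
lemma memlp_bound {k : ℕ} {u : Hilb} (hu : u ∈ domN k) (C : ℝ) :
    Memℓp (fun n : ℕ => C * (‖(n : ℂ) ^ k * u n‖ + ‖u n‖)) 2 := by
  have h1 : Memℓp (fun n : ℕ => ‖(n : ℂ) ^ k * u n‖) 2 := memℓp_norm_iff.2 hu
  have h2 : Memℓp (fun n : ℕ => ‖u n‖) 2 := memℓp_norm_iff.2 (lp.memℓp u)
  exact (h1.add h2).const_mul C

lemma domN_anti {j k : ℕ} (hjk : j ≤ k) : domN k ≤ domN j := by
  intro u hu
  refine Memℓp.mono (memlp_bound hu 1) fun n => ?_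
  rcases Nat.eq_zero_or_pos n with rfl | hn
  · rcases Nat.eq_zero_or_pos j with rfl | hj
    · simp
      positivity
    · simp [hj.ne']
      positivity
  · have h1 : (n : ℝ) ^ j ≤ (n : ℝ) ^ k :=
      pow_le_pow_right₀ (by exact_mod_cast hn) hjk
    have h2 : ‖(n : ℂ) ^ j * u n‖ ≤ ‖(n : ℂ) ^ k * u n‖ := by
      simp only [norm_mul, norm_pow, Complex.norm_natCast]
      gcongr
    have h3 := norm_nonneg (u n)
    linarith

/-- `ω_n = n (n + r - 1)`. -/
def omega (r : ℝ) (n : ℕ) : ℝ := n * (n + r - 1)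

lemma sqrt_omega_succ_le (r : ℝ) (n : ℕ) :
    √(omega r (n + 1)) ≤ (1 + |r|) * (n + 1) := by
  apply Real.sqrt_le_iff.2
  refine ⟨by positivity, ?_⟩
  have h1 : r ≤ |r| := le_abs_self r
  have h2 : 0 ≤ |r| := abs_nonneg r
  have h3 : (0 : ℝ) ≤ n := Nat.cast_nonneg n
  simp only [omega, Nat.cast_add, Nat.cast_one]
  have h4 : ((n : ℝ) + 1 + r - 1) ≤ (1 + |r|) ^ 2 * (n + 1) := by
    nlinarith [mul_nonneg h2 h3, sq_nonneg |r|, mul_nonneg (sq_nonneg |r|) h3]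
  calc ((n : ℝ) + 1) * ((n : ℝ) + 1 + r - 1) ≤ (n + 1) * ((1 + |r|) ^ 2 * (n + 1)) := by
        gcongr
    _ = ((1 + |r|) * (n + 1)) ^ 2 := by ring

/-- The sequence of coordinates of `B u`: as `B e_{n+1} = ω_{n+1}^{1/2} e_n` and `B e_0 = 0`,
the `n`-th coordinate is `ω_{n+1}^{1/2} u_{n+1}`. -/
def annihSeq (r : ℝ) (u : ℕ → ℂ) (n : ℕ) : ℂ := (√(omega r (n + 1)) : ℂ) * u (n + 1)

/-- The sequence of coordinates of `B⁺ u`: as `B⁺ e_n = ω_{n+1}^{1/2} e_{n+1}`,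
the `0`-th coordinate is `0` and the `(n+1)`-st is `ω_{n+1}^{1/2} u_n`. -/
def creaSeq (r : ℝ) (u : ℕ → ℂ) : ℕ → ℂ
  | 0 => 0
  | n + 1 => (√(omega r (n + 1)) : ℂ) * u n

lemma annihSeq_memlp (r : ℝ) {k : ℕ} {u : Hilb} (hu : u ∈ domN (k + 1)) :
    Memℓp (fun n : ℕ => (n : ℂ) ^ k * annihSeq r u n) 2 := by
  have h := memlp_bound hu (1 + |r|)
  rw [memℓp_gen_iff (by norm_num)] at h
  have h' := (summable_nat_add_iff 1).2 h
  refine Memℓp.mono (g := fun n : ℕ => (1 + |r|) *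
    (‖((n + 1 : ℕ) : ℂ) ^ (k + 1) * u (n + 1)‖ + ‖u (n + 1)‖)) ?_ ?_
  · rw [memℓp_gen_iff (by norm_num)]
    exact h'
  · intro n
    have h1 := sqrt_omega_succ_le r n
    have h2 : ((n : ℝ)) ^ k ≤ ((n : ℝ) + 1) ^ k := by gcongr; linarith
    have h3 : ‖((n + 1 : ℕ) : ℂ)‖ = (n : ℝ) + 1 := by
      rw [Complex.norm_natCast]; push_cast; ring
    simp only [annihSeq, norm_mul, norm_pow, Complex.norm_natCast, Complex.norm_real,
      Real.norm_of_nonneg (Real.sqrt_nonneg _), h3]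
    calc (n : ℝ) ^ k * (√(omega r (n + 1)) * ‖u (n + 1)‖)
        ≤ ((n : ℝ) + 1) ^ k * (((1 + |r|) * (n + 1)) * ‖u (n + 1)‖) := by gcongr
      _ = (1 + |r|) * (((n : ℝ) + 1) ^ (k + 1) * ‖u (n + 1)‖) := by ring
      _ ≤ _ := by
        gcongr
        push_cast
        have := norm_nonneg (u (n + 1))
        linarith

lemma creaSeq_memlp (r : ℝ) {k : ℕ} {u : Hilb} (hu : u ∈ domN (k + 1)) :
    Memℓp (fun n : ℕ => (n : ℂ) ^ k * creaSeq r u n) 2 := by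
  rw [memlp_iff, ← summable_nat_add_iff 1, ← memlp_iff]
  refine Memℓp.mono (memlp_bound hu ((1 + |r|) * 2 ^ (k + 1))) ?_
  intro n
  have h1 := sqrt_omega_succ_le r n
  have h3 : ‖((n + 1 : ℕ) : ℂ)‖ = (n : ℝ) + 1 := by
    rw [Complex.norm_natCast]; push_cast; ring
  have h4 : ((n : ℝ) + 1) ^ (k + 1) ≤ 2 ^ (k + 1) * ((n : ℝ) ^ (k + 1) + 1) := by
    rcases Nat.eq_zero_or_pos n with rfl | hn
    · simp
      exact one_le_pow₀ (by norm_num)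
    · have : (1 : ℝ) ≤ n := by exact_mod_cast hn
      calc ((n : ℝ) + 1) ^ (k + 1) ≤ (2 * n) ^ (k + 1) := by gcongr; linarith
        _ = 2 ^ (k + 1) * (n : ℝ) ^ (k + 1) := by ring
        _ ≤ _ := by gcongr; linarith
  simp only [creaSeq, norm_mul, norm_pow, Complex.norm_natCast, Complex.norm_real,
    Real.norm_of_nonneg (Real.sqrt_nonneg _), h3]
  calc ((n : ℝ) + 1) ^ k * (√(omega r (n + 1)) * ‖u n‖)
      ≤ ((n : ℝ) + 1) ^ k * (((1 + |r|) * (n + 1)) * ‖u n‖) := by gcongr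
    _ = (1 + |r|) * ((n : ℝ) + 1) ^ (k + 1) * ‖u n‖ := by ring
    _ ≤ (1 + |r|) * (2 ^ (k + 1) * ((n : ℝ) ^ (k + 1) + 1)) * ‖u n‖ := by gcongr
    _ = _ := by ring

/-- The annihilation operator `B`, with domain `Dom(N)`. -/
def annih (r : ℝ) : Hilb →ₗ.[ℂ] Hilb where
  domain := domN 1
  toFun :=
    { toFun := fun u => ⟨annihSeq r (u : Hilb),
        by simpa using! annihSeq_memlp r (k := 0) u.2⟩
      map_add' := by
        intro u v
        apply lp.ext
        funext n
        exact mul_add _ _ _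
      map_smul' := by
        intro c u
        apply lp.ext
        funext n
        simp [annihSeq]
        ring }

/-- The creation operator `B⁺`, with domain `Dom(N)`. -/
def crea (r : ℝ) : Hilb →ₗ.[ℂ] Hilb where
  domain := domN 1
  toFun :=
    { toFun := fun u => ⟨creaSeq r (u : Hilb),
        by simpa using! creaSeq_memlp r (k := 0) u.2⟩
      map_add' := by
        intro u v
        apply lp.ext
        funext n
        cases n
        · exact (add_zero (0 : ℂ)).symm
        · exact mul_add _ _ _
      map_smul' := by
        intro c u
        apply lp.ext
        funext n
        cases n
        · simp [creaSeq]
        · simp [creaSeq]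
          ring }

lemma annih_mem (r : ℝ) (u : Hilb) (hu : u ∈ domN 2) :
    annih r ⟨u, domN_anti (by norm_num) hu⟩ ∈ domN 1 :=
  annihSeq_memlp r (k := 1) hu

lemma crea_mem (r : ℝ) (u : Hilb) (hu : u ∈ domN 2) :
    crea r ⟨u, domN_anti (by norm_num) hu⟩ ∈ domN 1 :=
  creaSeq_memlp r (k := 1) hu

/-- The operator `B B⁺` on `Dom(N²)`. -/
def annihCrea (r : ℝ) : domN 2 →ₗ[ℂ] Hilb :=
  (annih r).toFun ∘ₗ
    (((crea r).toFun ∘ₗ Submodule.inclusion (domN_anti (by norm_num))).codRestrict (domN 1)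
      fun u => crea_mem r u u.2)

/-- The operator `B⁺ B` on `Dom(N²)`. -/
def creaAnnih (r : ℝ) : domN 2 →ₗ[ℂ] Hilb :=
  (crea r).toFun ∘ₗ
    (((annih r).toFun ∘ₗ Submodule.inclusion (domN_anti (by norm_num))).codRestrict (domN 1)
      fun u => annih_mem r u u.2)

namespace Params

variable (Q : Params)

/-- `G = -(λ²/2) B B⁺ - (μ²/2) B⁺ B - i (ζ⁺ B B⁺ + ζ⁻ B⁺ B)` on `Dom(N²)`. -/
def G : Hilb →ₗ.[ℂ] Hilb where
  domain := domN 2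
  toFun := (-((Q.lam : ℂ) ^ 2 / 2)) • annihCrea Q.r
    - ((Q.mu : ℂ) ^ 2 / 2) • creaAnnih Q.r
    - Complex.I • ((Q.zetaPlus : ℂ) • annihCrea Q.r
        + (Q.zetaMinus : ℂ) • creaAnnih Q.r)

/-- The noise operators `L₁ = μ B` and `L₂ = λ B⁺` on `Dom(N)`. -/
def L : Fin 2 → (Hilb →ₗ.[ℂ] Hilb)
  | 0 => (Q.mu : ℂ) • annih Q.r
  | 1 => (Q.lam : ℂ) • crea Q.r

lemma L_domain (i : Fin 2) : (Q.L i).domain = domN 1 := by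
  fin_cases i <;> rfl

/-- `-g_n` is the eigenvalue of `G` for the eigenvector `e_n`:
`g_n = (λ²/2 + i ζ⁺) ω_{n+1} + (μ²/2 + i ζ⁻) ω_n`. -/
def g (n : ℕ) : ℂ :=
  ((Q.lam : ℂ) ^ 2 / 2 + Complex.I * Q.zetaPlus) * (omega Q.r (n + 1) : ℂ)
    + ((Q.mu : ℂ) ^ 2 / 2 + Complex.I * Q.zetaMinus) * (omega Q.r n : ℂ)

lemma omega_nonneg (n : ℕ) : 0 ≤ omega Q.r n := by
  have := Q.r_pos
  rcases n with _ | n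
  · simp [omega]
  · simp only [omega, Nat.cast_add, Nat.cast_one]
    have : (0 : ℝ) ≤ n := Nat.cast_nonneg n
    apply mul_nonneg <;> linarith

lemma G_apply (u : Q.G.domain) (n : ℕ) : Q.G u n = -Q.g n * (u : Hilb) n := by
  have h1 : (annihCrea Q.r) u n = (omega Q.r (n + 1) : ℂ) * (u : Hilb) n := by
    change (√(omega Q.r (n + 1)) : ℂ) * ((√(omega Q.r (n + 1)) : ℂ) * (u : Hilb) n) = _
    rw [← mul_assoc, ← Complex.ofReal_mul, Real.mul_self_sqrt (Q.omega_nonneg _)]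
  have h2 : (creaAnnih Q.r) u n = (omega Q.r n : ℂ) * (u : Hilb) n := by
    rcases n with _ | n
    · change (0 : ℂ) = _
      simp [omega]
    · change (√(omega Q.r (n + 1)) : ℂ) * ((√(omega Q.r (n + 1)) : ℂ) * (u : Hilb) (n + 1)) = _
      rw [← mul_assoc, ← Complex.ofReal_mul, Real.mul_self_sqrt (Q.omega_nonneg _)]
  have h : Q.G u n = (-((Q.lam : ℂ) ^ 2 / 2)) * (annihCrea Q.r) u n
      - ((Q.mu : ℂ) ^ 2 / 2) * (creaAnnih Q.r) u n
      - Complex.I * ((Q.zetaPlus : ℂ) * (annihCrea Q.r) u n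
        + (Q.zetaMinus : ℂ) * (creaAnnih Q.r) u n) := rfl
  rw [h, h1, h2, g]
  ring

lemma g_re_nonneg (n : ℕ) : 0 ≤ (Q.g n).re := by
  have h1 := Q.omega_nonneg (n + 1)
  have h2 := Q.omega_nonneg n
  have h : (Q.g n).re = Q.lam ^ 2 / 2 * omega Q.r (n + 1) + Q.mu ^ 2 / 2 * omega Q.r n := by
    simp [g, ← Complex.ofReal_pow]
  rw [h]
  positivity

lemma norm_exp_g_le (t : ℝ≥0) (n : ℕ) : ‖Complex.exp (-(t : ℂ) * Q.g n)‖ ≤ 1 := by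
  rw [Complex.norm_exp, Real.exp_le_one_iff]
  have h1 := Q.g_re_nonneg n
  have h2 : (-((t : ℝ) : ℂ) * Q.g n).re = -(t * (Q.g n).re) := by
    simp
  have h3 := mul_nonneg t.2 h1
  exact h2.trans_le (neg_nonpos.2 h3)

lemma norm_exp_g_mul_le (t : ℝ≥0) (n : ℕ) (z : ℂ) :
    ‖Complex.exp (-(t : ℂ) * Q.g n) * z‖ ≤ ‖z‖ := by
  rw [norm_mul]
  exact mul_le_of_le_one_left (norm_nonneg _) (Q.norm_exp_g_le t n)

/-- The contraction semigroup `P_t` generated by `G`: `P_t e_n = exp(-t g_n) e_n`. -/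
def P (t : ℝ≥0) : Obs :=
  LinearMap.mkContinuous
    { toFun := fun u => (⟨fun n => Complex.exp (-(t : ℂ) * Q.g n) * u n,
        Memℓp.mono' (lp.memℓp u) fun n => Q.norm_exp_g_mul_le t n (u n)⟩ : Hilb)
      map_add' := by
        intro u v
        apply lp.ext
        funext n
        exact mul_add _ _ _
      map_smul' := by
        intro c u
        apply lp.ext
        funext n
        exact mul_left_comm _ _ _ } 1
    (by
      intro u
      rw [one_mul]
      exact lp.norm_mono (by norm_num) fun n => Q.norm_exp_g_mul_le t n (u n))

lemma P_mem (t : ℝ≥0) {k : ℕ} {u : Hilb} (hu : u ∈ domN k) : Q.P t u ∈ domN k := by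
  refine Memℓp.mono' hu fun n => ?_
  change ‖(n : ℂ) ^ k * (Complex.exp (-(t : ℂ) * Q.g n) * u n)‖ ≤ ‖(n : ℂ) ^ k * u n‖
  rw [norm_mul, norm_mul ((n : ℂ) ^ k) (u n)]
  exact mul_le_mul_of_nonneg_left (Q.norm_exp_g_mul_le t n (u n))
    (norm_nonneg ((n : ℂ) ^ k))

/-- The vector `L_i P_t u`, for `u` in the domain of `G`. -/
def LP (i : Fin 2) (t : ℝ≥0) (u : Q.G.domain) : Hilb :=
  Q.L i ⟨Q.P t u, (Q.L_domain i).symm ▸ domN_anti one_le_two (Q.P_mem t u.2)⟩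

end Params

/-! ### Quantum dynamical semigroups -/

/-- A quantum dynamical semigroup on `B(h)` (in the Heisenberg picture): a semigroup of completely
positive normal contractions, continuous for the σ-weak topology. As the maps are contractions,
σ-weak continuity in time is the continuity of all matrix elements. -/
structure IsQDS (T : ℝ≥0 → (Obs →ₗ[ℂ] Obs)) : Prop where
  map_zero : T 0 = LinearMap.id
  map_comp : ∀ s t, T (s + t) = T s ∘ₗ T t
  completely_positive : ∀ (t : ℝ≥0) (n : ℕ) (a b : Fin n → Obs),
    0 ≤ ∑ i, ∑ j, star (b i) * T t (star (a i) * a j) * b j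
  contractive : ∀ t, T t 1 ≤ 1
  normal : ∀ (t : ℝ≥0) (S : Set Obs) (x : Obs), S.Nonempty → (∀ y ∈ S, 0 ≤ y) →
    DirectedOn (· ≤ ·) S → IsLUB S x → IsLUB (T t '' S) (T t x)
  continuous : ∀ (x : Obs) (u v : Hilb), Continuous fun t => inner ℂ v (T t x u)

/-- A quantum Markov semigroup: a quantum dynamical semigroup that preserves the identity. -/
structure IsQMS (T : ℝ≥0 → (Obs →ₗ[ℂ] Obs)) : Prop extends IsQDS T where
  map_one : ∀ t, T t 1 = 1

/-- The Lindblad equation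
`⟨v, T_t(x) u⟩ = ⟨v, P_t^* x P_t u⟩ + ∑_i ∫_0^t ⟨L_i P_{t-s} v, T_s(x) L_i P_{t-s} u⟩ ds`
for all `u, v` in the domain of `G`. -/
def SolvesLindblad (Q : Params) (T : ℝ≥0 → (Obs →ₗ[ℂ] Obs)) : Prop :=
  ∀ (x : Obs) (t : ℝ≥0) (u v : Q.G.domain),
    (∀ i : Fin 2, IntervalIntegrable
      (fun s : ℝ => inner ℂ (Q.LP i (t - s.toNNReal) v)
        (T s.toNNReal x (Q.LP i (t - s.toNNReal) u))) MeasureTheory.volume 0 t) ∧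
    inner ℂ (v : Hilb) (T t x (u : Hilb)) =
      inner ℂ (Q.P t v) (x (Q.P t u)) +
        ∑ i : Fin 2, ∫ s in (0 : ℝ)..t,
          inner ℂ (Q.LP i (t - s.toNNReal) v) (T s.toNNReal x (Q.LP i (t - s.toNNReal) u))

/-- The minimal quantum dynamical semigroup associated with `G, L₁, L₂`: the quantum dynamical
semigroup that solves the Lindblad equation and lies below every family of positive maps that
solves it. -/
structure IsMinimalQDS (Q : Params) (T : ℝ≥0 → (Obs →ₗ[ℂ] Obs)) : Prop where
  isQDS : IsQDS T
  solves : SolvesLindblad Q T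
  minimal : ∀ T' : ℝ≥0 → (Obs →ₗ[ℂ] Obs), (∀ t x, 0 ≤ x → 0 ≤ T' t x) → SolvesLindblad Q T' →
    ∀ t x, 0 ≤ x → T t x ≤ T' t x

/-- A subharmonic projection: an orthogonal projection `p` with `T_t(p) ≥ p` for all `t`. -/
def IsSubharmonic (T : ℝ≥0 → (Obs →ₗ[ℂ] Obs)) (p : Obs) : Prop :=
  IsStarProjection p ∧ ∀ t, p ≤ T t p

/-- Irreducibility: the only subharmonic projections are `0` and `1`. -/
def IsIrreducible (T : ℝ≥0 → (Obs →ₗ[ℂ] Obs)) : Prop :=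
  ∀ p : Obs, IsSubharmonic T p ↔ p = 0 ∨ p = 1

/-! ### Normal states -/

/-- The trace, computed in the canonical basis; it is used for trace class operators only. -/
def tr (a : Obs) : ℂ := ∑' n, inner ℂ (e n) (a (e n))

/-- A density matrix (that is, a normal state): a positive operator of trace `1`. -/
def IsDensity (ρ : Obs) : Prop :=
  0 ≤ ρ ∧ HasSum (fun n => inner ℂ (e n) (ρ (e n))) 1

/-- An invariant normal state: `tr (ρ T_t(x)) = tr (ρ x)` for all `t` and all bounded `x`. -/
def IsInvariantState (T : ℝ≥0 → (Obs →ₗ[ℂ] Obs)) (ρ : Obs) : Prop :=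
  IsDensity ρ ∧ ∀ t x, tr (ρ * T t x) = tr (ρ * x)

/-- The geometric state `(1 - ν²) ∑_n ν^{2n} |e_n⟩⟨e_n|` (a norm convergent series for
`|ν| < 1`). -/
def geometricState (ν : ℝ) : Obs :=
  (1 - (ν : ℂ) ^ 2) • ∑' n : ℕ, (ν : ℂ) ^ (2 * n) • InnerProductSpace.rankOne ℂ (e n) (e n)

end QuadraticOscillator

end

noncomputable section

open Filter Topology
open scoped ComplexOrder ComplexConjugate

namespace QuadraticOscillator

/-! ### Matrix elements and weak limits of bounded operators on `ℓ²(ℕ)` -/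

/-! Everything is read off the matrix elements in the basis `e n`. There `G` is diagonal and `L₁`,
`L₂` shift the index by one, so the Lindblad equation becomes a scalar Duhamel equation for each
entry: the `(n, m)` entry decays at rate `kap n m` and is fed only by the entries `(n - 1, m - 1)`
and `(n + 1, m + 1)`. Iterating it produces a Dyson series indexed by the number of jumps. Every
term is completely positive (`BlockPos_jumps`), the terms started from the identity add up to at
most the identity (`formPos_rem`), and those started from `a` are dominated by `‖a‖` times these
(`FormDom_jumps`). Hence the series defines bounded operators `evolution t a`. The sum solves the
equation and lies below every positive solution (`evolution_le_of_isMild`); two minimal solutions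
lie below each other, whence uniqueness.

On the diagonal the series of the identity counts the jumps of a birth and death process with birth
rate `λ² ω_{n+1}` and death rate `μ² ω_n`. For `λ ≤ μ` the function `∑_{j<n} 1/(j+r)` has bounded
drift and tends to infinity, so the process does not explode and the semigroup preserves the
identity (`hasSum_jumpProb`, `evolution_one`). Conservativity also gives the semigroup law:
minimality yields `T_{s+t} ≤ T_s T_t`, and ordered positive maps that agree at `1` are equal.

If `p ≠ 0` is subharmonic, then `⟨u, T_t(1 - p) u⟩ = 0` for `u` in the range of `p`. The zero-jump
term shows that this range is stable under `P_t`; the decay rates are strictly increasing, so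
rescaling `P_t u` isolates one basis vector in the range. The one-jump term then brings in its
neighbours, hence all basis vectors, and `p = 1`.

Detailed balance for the weights `ν^{2n}` makes the truncated weighted sums of the generator
telescope to a boundary term that vanishes when `λ < μ`, so the geometric state is invariant. It is
the only one: the support of the positive part of the difference of two invariant states is
subharmonic, hence `0` or `1`, and equality of traces forces the difference to vanish
(`IsInvariantState.unique`). -/

lemma inner_e_left (n : ℕ) (u : Hilb) : inner ℂ (e n) u = u n := by
  rw [e, lp.inner_single_left]; simp

lemma inner_e_right (n : ℕ) (u : Hilb) : inner ℂ u (e n) = conj (u n) := by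
  rw [← inner_e_left, inner_conj_symm]

lemma e_apply (n m : ℕ) : (e n : Hilb) m = if m = n then 1 else 0 := by
  rw [e, lp.single_apply]
  simp only [Pi.single_apply]

lemma norm_e (n : ℕ) : ‖e n‖ = 1 := by
  rw [e, lp.norm_single (by norm_num)]; simp

/-- The matrix elements of an operator in the canonical basis. -/
def mat (a : Obs) (n m : ℕ) : ℂ := inner ℂ (e n) (a (e m))

lemma mat_eq (a : Obs) (n m : ℕ) : mat a n m = (a (e m)) n := inner_e_left _ _

/-- The truncation of a vector to its first `N` coordinates. -/
def trunc (N : ℕ) (u : Hilb) : Hilb := ∑ n ∈ Finset.range N, u n • e n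

lemma smul_e (c : ℂ) (n : ℕ) : c • e n = lp.single 2 n c := by
  rw [e, ← lp.single_smul]; simp

lemma trunc_apply (N : ℕ) (u : Hilb) (n : ℕ) : trunc N u n = if n < N then u n else 0 := by
  rw [trunc, lp.coeFn_sum, Finset.sum_apply]
  simp [e_apply]

lemma tendsto_trunc (u : Hilb) : Tendsto (fun N => trunc N u) atTop (𝓝 u) := by
  have h := (lp.hasSum_single (p := 2) (by norm_num) u).tendsto_sum_nat
  simpa [trunc, smul_e] using h

lemma norm_sq_eq_tsum (u : Hilb) : HasSum (fun n => ‖u n‖ ^ 2) (‖u‖ ^ 2) := by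
  have h := lp.hasSum_norm (p := 2) (by norm_num) u
  simpa using h

lemma norm_trunc_sq (N : ℕ) (u : Hilb) :
    ‖trunc N u‖ ^ 2 = ∑ n ∈ Finset.range N, ‖u n‖ ^ 2 := by
  refine (norm_sq_eq_tsum (trunc N u)).unique ?_
  have h : ∀ n ∉ Finset.range N, ‖trunc N u n‖ ^ 2 = 0 := by
    intro n hn
    rw [trunc_apply, if_neg (by simpa using hn)]; simp
  convert hasSum_sum_of_ne_finset_zero h using 1
  swap
  · infer_instance
  refine Finset.sum_congr rfl fun n hn => ?_
  rw [trunc_apply, if_pos (by simpa using hn)]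

lemma norm_trunc_le (N : ℕ) (u : Hilb) : ‖trunc N u‖ ≤ ‖u‖ := by
  refine lp.norm_mono (by norm_num) fun n => ?_
  rw [trunc_apply]
  split_ifs <;> simp

/-- The sesquilinear form on truncated sequences given by an infinite matrix. -/
def form (N : ℕ) (A : ℕ → ℕ → ℂ) (v u : ℕ → ℂ) : ℂ :=
  ∑ n ∈ Finset.range N, ∑ m ∈ Finset.range N, conj (v n) * A n m * u m

lemma form_congr {N : ℕ} {A A' : ℕ → ℕ → ℂ} {v v' u u' : ℕ → ℂ}
    (hA : ∀ n m, n < N → m < N → A n m = A' n m) (hv : ∀ n, n < N → v n = v' n)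
    (hu : ∀ n, n < N → u n = u' n) : form N A v u = form N A' v' u' := by
  unfold form
  refine Finset.sum_congr rfl fun n hn => Finset.sum_congr rfl fun m hm => ?_
  rw [Finset.mem_range] at hn hm
  rw [hA n m hn hm, hv n hn, hu m hm]

lemma inner_trunc (N : ℕ) (a : Obs) (v u : Hilb) :
    inner ℂ (trunc N v) (a (trunc N u)) = form N (mat a) v u := by
  simp only [trunc, map_sum, map_smul, sum_inner, inner_sum, inner_smul_left, inner_smul_right,
    form, mat, Finset.mul_sum]
  rw [Finset.sum_comm]
  refine Finset.sum_congr rfl fun n _ => Finset.sum_congr rfl fun m _ => ?_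
  ring

lemma tendsto_form (a : Obs) (v u : Hilb) :
    Tendsto (fun N => form N (mat a) v u) atTop (𝓝 (inner ℂ v (a u))) := by
  simp_rw [← inner_trunc]
  exact (tendsto_trunc v).inner ((a.continuous.tendsto u).comp (tendsto_trunc u))

lemma op_ext {a b : Obs} (h : ∀ n m, mat a n m = mat b n m) : a = b := by
  ext1 u
  refine ext_inner_left ℂ fun v => tendsto_nhds_unique (tendsto_form a v u) ?_
  have : mat a = mat b := by funext n m; exact h n m
  rw [this]
  exact tendsto_form b v u

lemma mat_add (a b : Obs) (n m : ℕ) : mat (a + b) n m = mat a n m + mat b n m := by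
  simp [mat]

lemma mat_sub (a b : Obs) (n m : ℕ) : mat (a - b) n m = mat a n m - mat b n m := by
  simp [mat]

lemma mat_smul (c : ℂ) (a : Obs) (n m : ℕ) : mat (c • a) n m = c * mat a n m := by
  simp [mat]

lemma mat_one (n m : ℕ) : mat 1 n m = if n = m then 1 else 0 := by
  rw [mat_eq]; simp [e_apply]

lemma mat_zero (n m : ℕ) : mat 0 n m = 0 := by simp [mat]

lemma norm_mat_le (a : Obs) (n m : ℕ) : ‖mat a n m‖ ≤ ‖a‖ := by
  refine (norm_inner_le_norm _ _).trans ?_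
  rw [norm_e, one_mul]
  simpa [norm_e] using a.le_opNorm (e m)

/-- In the order of `ℂ`, nonnegativity includes being real, and over `ℂ` a real quadratic form
already forces symmetry. -/
lemma nonneg_iff (a : Obs) : 0 ≤ a ↔ ∀ u, 0 ≤ inner ℂ u (a u) := by
  rw [ContinuousLinearMap.nonneg_iff_isPositive]
  refine ⟨fun h u => h.inner_nonneg_right u, fun h => ?_⟩
  rw [ContinuousLinearMap.isPositive_iff_complex]
  intro u
  have h1 : 0 ≤ inner ℂ (a u) u := by
    rw [← inner_conj_symm]
    exact star_nonneg_iff.2 (h u)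
  rw [Complex.nonneg_iff] at h1
  exact ⟨Complex.ext (by simp) (by simpa using h1.2), h1.1⟩

lemma le_iff (a b : Obs) : a ≤ b ↔ ∀ u, inner ℂ u (a u) ≤ inner ℂ u (b u) := by
  rw [← sub_nonneg, nonneg_iff]
  refine forall_congr' fun u => ?_
  rw [sub_apply, inner_sub_right, sub_nonneg]

lemma nonneg_of_form {a : Obs} (h : ∀ N (w : ℕ → ℂ), 0 ≤ form N (mat a) w w) : 0 ≤ a :=
  (nonneg_iff a).2 fun u => ge_of_tendsto' (tendsto_form a u u) fun N => h N u

/-- A sequence truncated to its first `N` entries, as a vector. -/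
def ofSeq (N : ℕ) (w : ℕ → ℂ) : Hilb := ∑ n ∈ Finset.range N, w n • e n

lemma ofSeq_apply (N : ℕ) (w : ℕ → ℂ) (n : ℕ) : ofSeq N w n = if n < N then w n else 0 := by
  rw [ofSeq, lp.coeFn_sum, Finset.sum_apply]
  simp [e_apply]

lemma trunc_ofSeq (N : ℕ) (w : ℕ → ℂ) : trunc N (ofSeq N w) = ofSeq N w := by
  apply lp.ext
  funext n
  rw [trunc_apply, ofSeq_apply]
  split_ifs <;> rfl

lemma inner_ofSeq (N : ℕ) (a : Obs) (v u : ℕ → ℂ) :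
    inner ℂ (ofSeq N v) (a (ofSeq N u)) = form N (mat a) v u := by
  rw [← trunc_ofSeq, ← trunc_ofSeq N u, inner_trunc]
  refine form_congr (fun _ _ _ _ => rfl) ?_ ?_ <;>
  · intro n hn
    rw [ofSeq_apply, if_pos hn]

lemma norm_ofSeq_sq (N : ℕ) (w : ℕ → ℂ) :
    ‖ofSeq N w‖ ^ 2 = ∑ n ∈ Finset.range N, ‖w n‖ ^ 2 := by
  rw [← trunc_ofSeq, norm_trunc_sq]
  refine Finset.sum_congr rfl fun n hn => ?_
  rw [ofSeq_apply, if_pos (by simpa using hn)]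

/-- The arithmetic mean of the squared norms replaces their geometric mean because it is linear in
the quadratic form, so that the bound survives time integrals and sums over jumps. -/
lemma norm_form_le (a : Obs) (N : ℕ) (v u : ℕ → ℂ) :
    ‖form N (mat a) v u‖ ≤ ‖a‖ * ((∑ n ∈ Finset.range N, ‖v n‖ ^ 2)
      + ∑ n ∈ Finset.range N, ‖u n‖ ^ 2) / 2 := by
  rw [← inner_ofSeq, ← norm_ofSeq_sq, ← norm_ofSeq_sq]
  have h1 := norm_inner_le_norm (𝕜 := ℂ) (ofSeq N v) (a (ofSeq N u))
  have h2 := a.le_opNorm (ofSeq N u)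
  have h3 : ‖ofSeq N v‖ * ‖a (ofSeq N u)‖ ≤ ‖ofSeq N v‖ * (‖a‖ * ‖ofSeq N u‖) := by gcongr
  nlinarith [mul_nonneg (norm_nonneg a) (sq_nonneg (‖ofSeq N v‖ - ‖ofSeq N u‖))]

lemma form_nonneg {a : Obs} (ha : 0 ≤ a) (N : ℕ) (w : ℕ → ℂ) : 0 ≤ form N (mat a) w w := by
  rw [← inner_ofSeq]; exact (nonneg_iff a).1 ha _

/-- A bounded family of operators converges weakly along every ultrafilter. -/
lemma exists_weak_limit {ι : Type*} (U : Ultrafilter ι) (a : ι → Obs) {C : ℝ}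
    (ha : ∀ i, ‖a i‖ ≤ C) : ∃ z : Obs, ‖z‖ ≤ C ∧
      ∀ u v, Tendsto (fun i => inner ℂ v (a i u)) U (𝓝 (inner ℂ v (z u))) := by
  have hC : 0 ≤ C := by
    obtain ⟨i⟩ : Nonempty ι := U.neBot.nonempty
    exact (norm_nonneg _).trans (ha i)
  have hb : ∀ v u i, ‖inner ℂ (a i v) u‖ ≤ C * ‖v‖ * ‖u‖ := fun v u i =>
    (norm_inner_le_norm _ _).trans (by gcongr; exact (a i).le_of_opNorm_le (ha i) v)
  have hex : ∀ v u, ∃ c : ℂ, ‖c‖ ≤ C * ‖v‖ * ‖u‖ ∧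
      Tendsto (fun i => inner ℂ (a i v) u) U (𝓝 c) := by
    intro v u
    -- For each pair the values stay in a compact disc, where an ultrafilter converges without
    -- extraction of subsequences; sesquilinearity and the bound pass to the limit.
    have hK : IsCompact (Metric.closedBall (0 : ℂ) (C * ‖v‖ * ‖u‖)) := isCompact_closedBall _ _
    obtain ⟨c, hc, hlim⟩ := hK.ultrafilter_le_nhds (U.map fun i => inner ℂ (a i v) u) (by
      rw [le_principal_iff]
      exact Filter.Eventually.of_forall (f := (U : Filter ι)) fun i => by simpa using hb v u i)
    exact ⟨c, by simpa using hc, hlim⟩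
  choose B hB hlim using hex
  have uniq : ∀ {v u c}, Tendsto (fun i => inner ℂ (a i v) u) U (𝓝 c) → B v u = c :=
    fun h => tendsto_nhds_unique (hlim _ _) h
  let Bl : Hilb →ₗ⋆[ℂ] Hilb →ₗ[ℂ] ℂ := LinearMap.mk₂'ₛₗ _ _ B
    (fun v v' u => uniq (by simpa [inner_add_left] using (hlim v u).add (hlim v' u)))
    (fun c v u => uniq (by simpa [inner_smul_left, mul_comm] using (hlim v u).const_mul (conj c)))
    (fun v u u' => uniq (by simpa [inner_add_right] using (hlim v u).add (hlim v u')))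
    (fun c v u => uniq (by simpa [inner_smul_right] using (hlim v u).const_mul c))
  let Bc : Hilb →L⋆[ℂ] Hilb →L[ℂ] ℂ := Bl.mkContinuous₂ C hB
  refine ⟨InnerProductSpace.continuousLinearMapOfBilin Bc, ?_, ?_⟩
  · refine ContinuousLinearMap.opNorm_le_of_re_inner_le hC fun x y hx hy => ?_
    rw [InnerProductSpace.continuousLinearMapOfBilin_apply]
    refine (Complex.re_le_norm _).trans ?_
    simpa [hx, hy] using! hB x y
  · intro u v
    have h := (Complex.continuous_conj.tendsto _).comp (hlim u v)
    have h2 : inner ℂ v (InnerProductSpace.continuousLinearMapOfBilin Bc u) = conj (B u v) := by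
      rw [← inner_conj_symm, InnerProductSpace.continuousLinearMapOfBilin_apply]; rfl
    rw [h2]
    refine h.congr fun i => ?_
    simp [inner_conj_symm]

/-- For bounded families, convergence of the matrix elements implies weak convergence. -/
lemma tendsto_inner_of_mat {ι : Type*} {l : Filter ι} {a : ι → Obs} {b : Obs} {C : ℝ}
    (ha : ∀ i, ‖a i‖ ≤ C) (h : ∀ n m, Tendsto (fun i => mat (a i) n m) l (𝓝 (mat b n m)))
    (u v : Hilb) : Tendsto (fun i => inner ℂ v (a i u)) l (𝓝 (inner ℂ v (b u))) := by
  rw [tendsto_iff_ultrafilter]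
  intro U hU
  obtain ⟨z, -, hz⟩ := exists_weak_limit U a ha
  have : z = b := op_ext fun n m =>
    tendsto_nhds_unique (hz (e m) (e n)) ((h n m).mono_left hU)
  rw [← this]
  exact hz u v

/-- An infinite matrix with bounded finite sections defines a bounded operator. -/
lemma exists_op_of_form_bound {A : ℕ → ℕ → ℂ} {C : ℝ}
    (hA : ∀ N v u, ‖form N A v u‖ ≤ C * ((∑ n ∈ Finset.range N, ‖v n‖ ^ 2)
      + ∑ n ∈ Finset.range N, ‖u n‖ ^ 2) / 2) :
    ∃ a : Obs, ‖a‖ ≤ C ∧ ∀ n m, mat a n m = A n m := by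
  have hC : 0 ≤ C := by
    -- For this choice the bound reads `‖A 0 0‖ ≤ C`.
    have h := hA 1 (fun _ => 1) (fun _ => 1)
    simp only [form, Finset.sum_range_one, norm_one] at h
    linarith [(norm_nonneg _).trans h]
  let a : ℕ → Obs := fun N => ∑ n ∈ Finset.range N, ∑ m ∈ Finset.range N,
    A n m • InnerProductSpace.rankOne ℂ (e n) (e m)
  have hform : ∀ N v u, inner ℂ v (a N u) = form N A v u := by
    intro N v u
    simp only [a, sum_apply, smul_apply,
      InnerProductSpace.rankOne_apply, inner_sum, inner_smul_right, inner_e_left, inner_e_right,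
      form]
    refine Finset.sum_congr rfl fun n _ => Finset.sum_congr rfl fun m _ => ?_
    ring
  have ha : ∀ N, ‖a N‖ ≤ C := by
    intro N
    refine ContinuousLinearMap.opNorm_le_of_re_inner_le hC fun x y hx hy => ?_
    refine (Complex.re_le_norm _).trans ?_
    change ‖inner ℂ (a N x) y‖ ≤ C
    rw [norm_inner_symm, hform]
    refine (hA N y x).trans ?_
    have h1 := pow_le_pow_left₀ (norm_nonneg _) (norm_trunc_le N x) 2
    have h2 := pow_le_pow_left₀ (norm_nonneg _) (norm_trunc_le N y) 2
    rw [norm_trunc_sq, hx] at h1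
    rw [norm_trunc_sq, hy] at h2
    nlinarith
  obtain ⟨z, hz, hlim⟩ := exists_weak_limit (hyperfilter ℕ) a ha
  refine ⟨z, hz, fun n m => tendsto_nhds_unique (hlim (e m) (e n)) ?_⟩
  refine tendsto_const_nhds.congr' ?_
  have h : ∀ᶠ N in atTop, A n m = inner ℂ (e n) (a N (e m)) := by
    filter_upwards [eventually_gt_atTop n, eventually_gt_atTop m] with N hn hm
    rw [hform, form, Finset.sum_eq_single n, Finset.sum_eq_single m]
    · simp [e_apply]
    · intro k _ hk; simp [e_apply, hk]
    · simp [hm.not_ge]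
    · intro k _ hk; simp [e_apply, hk]
    · simp [hn.not_ge]
  exact Nat.hyperfilter_le_atTop h

/-- An upper bounded directed set of positive operators converges weakly to its supremum. -/
lemma exists_ultrafilter_of_isLUB {S : Set Obs} {x : Obs} (hne : S.Nonempty)
    (hpos : ∀ y ∈ S, 0 ≤ y) (hdir : DirectedOn (· ≤ ·) S) (hx : IsLUB S x) :
    ∃ U : Ultrafilter S, ∀ u v,
      Tendsto (fun y : S => inner ℂ v ((y : Obs) u)) U (𝓝 (inner ℂ v (x u))) := by
  have : Nonempty S := hne.to_subtype
  have : IsDirected S (· ≤ ·) := ⟨fun a b => by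
    obtain ⟨c, hc, hac, hbc⟩ := hdir a a.2 b b.2
    exact ⟨⟨c, hc⟩, hac, hbc⟩⟩
  have : NeBot (atTop : Filter S) := atTop_neBot
  let U : Ultrafilter S := Ultrafilter.of atTop
  have hU : (U : Filter S) ≤ atTop := Ultrafilter.of_le _
  have hnorm : ∀ y : S, ‖(y : Obs)‖ ≤ ‖x‖ := fun y =>
    CStarAlgebra.norm_le_norm_of_nonneg_of_le (hpos y y.2) (hx.1 y.2)
  obtain ⟨z, -, hz⟩ := exists_weak_limit U (fun y : S => (y : Obs)) hnorm
  -- The ultrafilter is finer than `atTop` on the directed set, so its weak limit is itself a least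
  -- upper bound and must be `x`.
  have hzx : IsLUB S z := by
    constructor
    · intro y hy
      rw [le_iff]
      intro u
      refine ge_of_tendsto (hz u u) (hU ?_)
      filter_upwards [eventually_ge_atTop (⟨y, hy⟩ : S)] with y' hy'
      exact (le_iff _ _).1 hy' u
    · intro b hb
      rw [le_iff]
      intro u
      exact le_of_tendsto' (hz u u) fun y => (le_iff _ _).1 (hb y.2) u
  exact ⟨U, hx.unique hzx ▸ hz⟩

lemma map_ext_nonneg {f g : Obs →ₗ[ℂ] Obs} (h : ∀ x, 0 ≤ x → f x = g x) : f = g := by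
  refine LinearMap.ext_on (s := {a : Obs | 0 ≤ a}) CStarAlgebra.span_nonneg fun x hx => h x hx

/-! ### The Picard iteration on matrix elements -/

namespace Params

variable (Q : Params)

/-- The decay rate of the `(n, m)` matrix element. -/
def kap (n m : ℕ) : ℂ := conj (Q.g n) + Q.g m

/-- The gain part of the generator, on matrix elements. -/
def gain (A : ℕ → ℕ → ℂ) (n m : ℕ) : ℂ :=
  (Q.mu : ℂ) ^ 2 * (√(omega Q.r n) : ℂ) * (√(omega Q.r m) : ℂ) * A (n - 1) (m - 1)
    + (Q.lam : ℂ) ^ 2 * (√(omega Q.r (n + 1)) : ℂ) * (√(omega Q.r (m + 1)) : ℂ) * A (n + 1) (m + 1)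

/-- The Duhamel operator of the model on families of matrices. -/
def duh (F : ℝ → ℕ → ℕ → ℂ) (t : ℝ) (n m : ℕ) : ℂ :=
  ∫ s in (0 : ℝ)..t, Complex.exp (-((t : ℂ) - s) * Q.kap n m) * Q.gain (F s) n m

/-- The free evolution of a matrix. -/
def free (A : ℕ → ℕ → ℂ) (t : ℝ) (n m : ℕ) : ℂ := Complex.exp (-(t : ℂ) * Q.kap n m) * A n m

/-- The contribution of exactly `k` jumps to the evolution of a matrix. -/
def jumps (A : ℕ → ℕ → ℂ) : ℕ → ℝ → ℕ → ℕ → ℂ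
  | 0 => Q.free A
  | k + 1 => Q.duh (jumps A k)

/-- `P_τ` on sequences. -/
def semi (τ : ℝ) (v : ℕ → ℂ) (n : ℕ) : ℂ := Complex.exp (-(τ : ℂ) * Q.g n) * v n

/-- `L_i` on sequences. -/
def noise (i : Fin 2) (v : ℕ → ℂ) : ℕ → ℂ :=
  match i with
  | 0 => fun n => (Q.mu : ℂ) * annihSeq Q.r v n
  | 1 => fun n => (Q.lam : ℂ) * creaSeq Q.r v n

end Params

/-- Entrywise continuity of a family of matrices. -/
def EntryCont (F : ℝ → ℕ → ℕ → ℂ) : Prop := ∀ n m, Continuous fun s => F s n m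

namespace Params

variable (Q : Params)

/-- Truncated subtraction makes `gain` refer to `A (0 - 1) _`, which is `A 0 _`; this vanishing
coefficient makes that harmless. -/
lemma omega_zero : omega Q.r 0 = 0 := by simp [omega]

lemma gain_add (A B : ℕ → ℕ → ℂ) (n m : ℕ) :
    Q.gain (fun i j => A i j + B i j) n m = Q.gain A n m + Q.gain B n m := by
  simp only [gain]; ring

lemma gain_sub (A B : ℕ → ℕ → ℂ) (n m : ℕ) :
    Q.gain (fun i j => A i j - B i j) n m = Q.gain A n m - Q.gain B n m := by
  simp only [gain]; ring

lemma gain_smul (c : ℂ) (A : ℕ → ℕ → ℂ) (n m : ℕ) :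
    Q.gain (fun i j => c * A i j) n m = c * Q.gain A n m := by
  simp only [gain]; ring

lemma gain_continuous {F : ℝ → ℕ → ℕ → ℂ} (hF : EntryCont F) : EntryCont fun s => Q.gain (F s) := by
  intro n m
  have h1 := hF (n - 1) (m - 1)
  have h2 := hF (n + 1) (m + 1)
  unfold gain
  fun_prop

lemma duh_integrand_continuous {F : ℝ → ℕ → ℕ → ℂ} (hF : EntryCont F) (t : ℝ) (n m : ℕ) :
    Continuous fun s : ℝ => Complex.exp (-((t : ℂ) - s) * Q.kap n m) * Q.gain (F s) n m := by
  have h := Q.gain_continuous hF n m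
  fun_prop

/-- With `t` removed from the integrand the integral is a plain primitive, hence continuous or
differentiable in `t`. -/
lemma duh_eq (F : ℝ → ℕ → ℕ → ℂ) (t : ℝ) (n m : ℕ) :
    Q.duh F t n m = Complex.exp (-(t : ℂ) * Q.kap n m) *
      ∫ s in (0 : ℝ)..t, Complex.exp ((s : ℂ) * Q.kap n m) * Q.gain (F s) n m := by
  rw [duh, ← intervalIntegral.integral_const_mul]
  congr 1
  funext s
  rw [← mul_assoc, ← Complex.exp_add]
  congr 2
  ring

lemma duh_continuous {F : ℝ → ℕ → ℕ → ℂ} (hF : EntryCont F) : EntryCont (Q.duh F) := by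
  intro n m
  simp_rw [duh_eq]
  refine Continuous.mul (by fun_prop) ?_
  refine intervalIntegral.continuous_primitive (fun a b => Continuous.intervalIntegrable ?_ _ _) 0
  have h := Q.gain_continuous hF n m
  fun_prop

lemma free_continuous (A : ℕ → ℕ → ℂ) : EntryCont (Q.free A) := by
  intro n m
  unfold free
  fun_prop

lemma jumps_continuous (A : ℕ → ℕ → ℂ) (k : ℕ) : EntryCont (Q.jumps A k) := by
  induction k with
  | zero => exact Q.free_continuous A
  | succ k ih => exact Q.duh_continuous ih

lemma duh_add {F H : ℝ → ℕ → ℕ → ℂ} (hF : EntryCont F) (hH : EntryCont H) (t : ℝ) (n m : ℕ) :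
    Q.duh (fun s i j => F s i j + H s i j) t n m = Q.duh F t n m + Q.duh H t n m := by
  simp only [duh]
  rw [← intervalIntegral.integral_add
    ((Q.duh_integrand_continuous hF t n m).intervalIntegrable _ _)
    ((Q.duh_integrand_continuous hH t n m).intervalIntegrable _ _)]
  congr 1; funext s; rw [gain_add, mul_add]

lemma duh_sub {F H : ℝ → ℕ → ℕ → ℂ} (hF : EntryCont F) (hH : EntryCont H) (t : ℝ) (n m : ℕ) :
    Q.duh (fun s i j => F s i j - H s i j) t n m = Q.duh F t n m - Q.duh H t n m := by
  simp only [duh]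
  rw [← intervalIntegral.integral_sub
    ((Q.duh_integrand_continuous hF t n m).intervalIntegrable _ _)
    ((Q.duh_integrand_continuous hH t n m).intervalIntegrable _ _)]
  congr 1; funext s; rw [gain_sub, mul_sub]

lemma duh_smul (c : ℂ) (F : ℝ → ℕ → ℕ → ℂ) (t : ℝ) (n m : ℕ) :
    Q.duh (fun s i j => c * F s i j) t n m = c * Q.duh F t n m := by
  simp only [duh]
  rw [← intervalIntegral.integral_const_mul]
  congr 1; funext s; rw [gain_smul]; ring

lemma jumps_add (A B : ℕ → ℕ → ℂ) (k : ℕ) (t : ℝ) (n m : ℕ) :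
    Q.jumps (fun i j => A i j + B i j) k t n m = Q.jumps A k t n m + Q.jumps B k t n m := by
  induction k generalizing t n m with
  | zero => simp only [jumps, free]; ring
  | succ k ih =>
    simp only [jumps]
    rw [← duh_add Q (Q.jumps_continuous A k) (Q.jumps_continuous B k)]
    congr 1; funext s i j; exact ih s i j

lemma jumps_smul (c : ℂ) (A : ℕ → ℕ → ℂ) (k : ℕ) (t : ℝ) (n m : ℕ) :
    Q.jumps (fun i j => c * A i j) k t n m = c * Q.jumps A k t n m := by
  induction k generalizing t n m with
  | zero => simp only [jumps, free]; ring
  | succ k ih =>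
    simp only [jumps]
    rw [← duh_smul Q]
    congr 1; funext s i j; exact ih s i j

lemma form_free (N : ℕ) (A : ℕ → ℕ → ℂ) (τ : ℝ) (v u : ℕ → ℂ) :
    form N (Q.free A τ) v u = form N A (Q.semi τ v) (Q.semi τ u) := by
  unfold form
  refine Finset.sum_congr rfl fun n _ => Finset.sum_congr rfl fun m _ => ?_
  simp only [free, semi, kap, map_mul, ← Complex.exp_conj, map_neg, Complex.conj_ofReal]
  rw [mul_add, Complex.exp_add]
  ring

/-- The gain is `∑ L_i^* A L_i` read on finite sections: `B` lowers the index, so a section of size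
`N + 1` shrinks to `N`, while `B⁺` raises it and enlarges the section to `N + 2`. -/
lemma form_gain (N : ℕ) (A : ℕ → ℕ → ℂ) (v u : ℕ → ℂ) :
    form (N + 1) (Q.gain A) v u = form N A (Q.noise 0 v) (Q.noise 0 u)
      + form (N + 2) A (Q.noise 1 v) (Q.noise 1 u) := by
  have h1 : form (N + 1) (Q.gain A) v u =
      (∑ n ∈ Finset.range (N + 1), ∑ m ∈ Finset.range (N + 1), conj (v n) * ((Q.mu : ℂ) ^ 2 *
        (√(omega Q.r n) : ℂ) * (√(omega Q.r m) : ℂ) * A (n - 1) (m - 1)) * u m)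
      + ∑ n ∈ Finset.range (N + 1), ∑ m ∈ Finset.range (N + 1), conj (v n) * ((Q.lam : ℂ) ^ 2 *
        (√(omega Q.r (n + 1)) : ℂ) * (√(omega Q.r (m + 1)) : ℂ) * A (n + 1) (m + 1)) * u m := by
    simp only [form, ← Finset.sum_add_distrib]
    refine Finset.sum_congr rfl fun n _ => Finset.sum_congr rfl fun m _ => ?_
    simp only [gain]
    ring
  rw [h1]
  congr 1
  · rw [Finset.sum_range_succ']
    simp only [Q.omega_zero, Real.sqrt_zero, Complex.ofReal_zero, mul_zero, zero_mul,
      Finset.sum_const_zero, add_zero, form]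
    refine Finset.sum_congr rfl fun n _ => ?_
    rw [Finset.sum_range_succ']
    simp only [Q.omega_zero, Real.sqrt_zero, Complex.ofReal_zero, mul_zero, zero_mul, add_zero]
    refine Finset.sum_congr rfl fun m _ => ?_
    simp only [noise, annihSeq, map_mul, Complex.conj_ofReal, Nat.add_sub_cancel]
    ring
  · rw [form, Finset.sum_range_succ' _ (N + 1)]
    have h0 : ∀ w : ℕ → ℂ, Q.noise 1 w 0 = 0 := fun w => by simp [noise, creaSeq]
    have h1 : ∀ (w : ℕ → ℂ) n, Q.noise 1 w (n + 1) = Q.lam * (√(omega Q.r (n + 1)) * w n) :=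
      fun _ _ => rfl
    simp only [h0, map_zero, zero_mul, Finset.sum_const_zero, add_zero]
    refine Finset.sum_congr rfl fun n _ => ?_
    rw [Finset.sum_range_succ' _ (N + 1)]
    simp only [h0, h1, mul_zero, add_zero]
    refine Finset.sum_congr rfl fun m _ => ?_
    simp only [map_mul, Complex.conj_ofReal]
    ring

end Params

lemma form_continuous {X : Type*} [TopologicalSpace X] (N : ℕ) {A : X → ℕ → ℕ → ℂ}
    {v u : X → ℕ → ℂ} (hA : ∀ n m, Continuous fun s => A s n m)
    (hv : ∀ n, Continuous fun s => v s n) (hu : ∀ n, Continuous fun s => u s n) :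
    Continuous fun s => form N (A s) (v s) (u s) := by
  unfold form
  refine continuous_finsetSum _ fun n _ => continuous_finsetSum _ fun m _ => ?_
  exact ((Complex.continuous_conj.comp (hv n)).mul (hA n m)).mul (hu m)

namespace Params

variable (Q : Params)

lemma semi_continuous (t : ℝ) (v : ℕ → ℂ) (n : ℕ) :
    Continuous fun s : ℝ => Q.semi (t - s) v n := by
  unfold semi
  fun_prop

lemma noise_continuous {v : ℝ → ℕ → ℂ} (hv : ∀ n, Continuous fun s => v s n) (i : Fin 2) (n : ℕ) :
    Continuous fun s => Q.noise i (v s) n := by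
  fin_cases i
  · simp only [noise, annihSeq]
    have := hv (n + 1)
    fun_prop
  · rcases n with _ | n
    · simp only [noise, creaSeq]
      fun_prop
    · simp only [noise, creaSeq]
      have := hv n
      fun_prop

/-- The integrand of the Lindblad equation, for finite vectors. -/
def lind (N : ℕ) (F : ℝ → ℕ → ℕ → ℂ) (t : ℝ) (v u : ℕ → ℂ) (s : ℝ) : ℂ :=
  form N (F s) (Q.noise 0 (Q.semi (t - s) v)) (Q.noise 0 (Q.semi (t - s) u))
    + form (N + 2) (F s) (Q.noise 1 (Q.semi (t - s) v)) (Q.noise 1 (Q.semi (t - s) u))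

lemma lind_continuous (N : ℕ) {F : ℝ → ℕ → ℕ → ℂ} (hF : EntryCont F) (t : ℝ) (v u : ℕ → ℂ) :
    Continuous (Q.lind N F t v u) := by
  refine Continuous.add ?_ ?_ <;>
  exact form_continuous _ hF (Q.noise_continuous (Q.semi_continuous t v) _)
      (Q.noise_continuous (Q.semi_continuous t u) _)

/-- This is the link between the entrywise Duhamel integral and the Lindblad equation; through it
positivity and domination of forms pass from `F` to `duh F`. -/
lemma form_duh (N : ℕ) {F : ℝ → ℕ → ℕ → ℂ} (hF : EntryCont F) (t : ℝ) (v u : ℕ → ℂ) :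
    form (N + 1) (Q.duh F t) v u = ∫ s in (0 : ℝ)..t, Q.lind N F t v u s := by
  have h : ∀ s : ℝ, Q.lind N F t v u s = ∑ n ∈ Finset.range (N + 1), ∑ m ∈ Finset.range (N + 1),
      conj (v n) * (Complex.exp (-((t : ℂ) - s) * Q.kap n m) * Q.gain (F s) n m) * u m := by
    intro s
    rw [lind, ← form_gain, ← form_free]
    simp only [form, free]
    push_cast
    rfl
  simp_rw [h]
  rw [intervalIntegral.integral_finsetSum]
  · unfold form
    refine Finset.sum_congr rfl fun n _ => ?_
    rw [intervalIntegral.integral_finsetSum]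
    · refine Finset.sum_congr rfl fun m _ => ?_
      rw [intervalIntegral.integral_mul_const, intervalIntegral.integral_const_mul, duh]
    · intro m _
      have := Q.duh_integrand_continuous hF t n m
      exact Continuous.intervalIntegrable (by fun_prop) _ _
  · intro n _
    refine Continuous.intervalIntegrable (continuous_finsetSum _ fun m _ => ?_) _ _
    have := Q.duh_integrand_continuous hF t n m
    fun_prop

end Params

/-! ### Positivity and domination under the Duhamel operator. -/

lemma integral_nonneg_complex {f : ℝ → ℂ} {t : ℝ} (ht : 0 ≤ t) (hf : ∀ s ∈ Set.Icc 0 t, 0 ≤ f s) :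
    0 ≤ ∫ s in (0 : ℝ)..t, f s := by
  have h : ∫ s in (0 : ℝ)..t, f s = ∫ s in (0 : ℝ)..t, (((f s).re : ℝ) : ℂ) := by
    refine intervalIntegral.integral_congr fun s hs => ?_
    rw [Set.uIcc_of_le ht] at hs
    have := Complex.nonneg_iff.1 (hf s hs)
    exact Complex.ext (by simp) (by simpa using this.2.symm)
  rw [h, intervalIntegral.integral_ofReal, Complex.zero_le_real]
  exact intervalIntegral.integral_nonneg ht fun s hs => (Complex.nonneg_iff.1 (hf s hs)).1

/-- Positivity of a family of block matrices, on the time interval `[0, T]`. -/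
def BlockPos {ι : Type*} [Fintype ι] (T : ℝ) (F : ι → ι → ℝ → ℕ → ℕ → ℂ) : Prop :=
  ∀ s ∈ Set.Icc 0 T, ∀ (N : ℕ) (w : ι → ℕ → ℂ), 0 ≤ ∑ i, ∑ j, form N (F i j s) (w i) (w j)

namespace Params

variable (Q : Params)

/-- By `form_duh` the block form at `w` is a time integral of the block forms of `F` at the vectors
`L P_{t-s} w i`, with the same `L P_{t-s}` in every slot `i`. This is the source of complete
positivity. -/
lemma BlockPos_duh {ι : Type*} [Fintype ι] {T : ℝ} {F : ι → ι → ℝ → ℕ → ℕ → ℂ}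
    (hc : ∀ i j, EntryCont (F i j)) (hF : BlockPos T F) : BlockPos T fun i j => Q.duh (F i j) := by
  intro t ht N w
  rcases N with _ | N
  · simp [form]
  simp_rw [fun i j => Q.form_duh N (hc i j) t (w i) (w j)]
  have h : ∑ i, ∑ j, ∫ s in (0 : ℝ)..t, Q.lind N (F i j) t (w i) (w j) s
      = ∫ s in (0 : ℝ)..t, ∑ i, ∑ j, Q.lind N (F i j) t (w i) (w j) s := by
    rw [intervalIntegral.integral_finsetSum]
    · refine Finset.sum_congr rfl fun i _ => ?_
      rw [intervalIntegral.integral_finsetSum]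
      intro j _
      exact (Q.lind_continuous N (hc i j) t _ _).intervalIntegrable _ _
    · intro i _
      exact (continuous_finsetSum _ fun j _ =>
        Q.lind_continuous N (hc i j) t _ _).intervalIntegrable _ _
  rw [h]
  refine integral_nonneg_complex ht.1 fun s hs => ?_
  simp only [lind, Finset.sum_add_distrib]
  have hs' : s ∈ Set.Icc 0 T := ⟨hs.1, hs.2.trans ht.2⟩
  exact add_nonneg (hF s hs' N fun i => Q.noise 0 (Q.semi (t - s) (w i)))
    (hF s hs' (N + 2) fun i => Q.noise 1 (Q.semi (t - s) (w i)))

lemma BlockPos_jumps {ι : Type*} [Fintype ι] (T : ℝ) {A : ι → ι → ℕ → ℕ → ℂ}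
    (hA : ∀ (N : ℕ) (w : ι → ℕ → ℂ), 0 ≤ ∑ i, ∑ j, form N (A i j) (w i) (w j)) (k : ℕ) :
    BlockPos T fun i j => Q.jumps (A i j) k := by
  induction k with
  | zero =>
    intro s _ N w
    simp only [jumps, form_free]
    exact hA N fun i => Q.semi s (w i)
  | succ k ih => exact Q.BlockPos_duh (fun i j => Q.jumps_continuous _ k) ih

end Params

/-- Positivity of a family of matrices, on the time interval `[0, T]`. -/
def FormPos (T : ℝ) (F : ℝ → ℕ → ℕ → ℂ) : Prop :=
  ∀ s ∈ Set.Icc 0 T, ∀ (N : ℕ) (w : ℕ → ℂ), 0 ≤ form N (F s) w w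

lemma formPos_iff (T : ℝ) (F : ℝ → ℕ → ℕ → ℂ) :
    FormPos T F ↔ BlockPos T fun _ _ : Unit => F := by
  refine forall₃_congr fun s _ N => ⟨fun h w => by simpa using h (w ()), fun h w => ?_⟩
  simpa using h fun _ => w

/-- Domination of a family of sesquilinear forms by a family of quadratic forms. -/
def FormDom (F H : ℝ → ℕ → ℕ → ℂ) : Prop :=
  ∀ s, 0 ≤ s → ∀ (N : ℕ) (v u : ℕ → ℂ),
    ‖form N (F s) v u‖ ≤ ((form N (H s) v v).re + (form N (H s) u u).re) / 2

namespace Params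

variable (Q : Params)

lemma FormPos_duh {T : ℝ} {F : ℝ → ℕ → ℕ → ℂ} (hc : EntryCont F) (hF : FormPos T F) :
    FormPos T (Q.duh F) :=
  (formPos_iff _ _).2 (Q.BlockPos_duh (fun _ _ => hc) ((formPos_iff _ _).1 hF))

lemma FormPos_jumps (T : ℝ) {A : ℕ → ℕ → ℂ} (hA : ∀ (N : ℕ) (w : ℕ → ℂ), 0 ≤ form N A w w) (k : ℕ) :
    FormPos T (Q.jumps A k) :=
  (formPos_iff _ _).2 (Q.BlockPos_jumps (ι := Unit) T (A := fun _ _ => A)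
    (fun N w => by simpa using hA N (w ())) k)

/-- Both sides are integrals of forms at the same vectors `L_i P_{t-s} v` and `L_i P_{t-s} u`, and
the right side is linear in `H`, so the pointwise bound integrates. -/
lemma FormDom_duh {F H : ℝ → ℕ → ℕ → ℂ} (hF : EntryCont F) (hH : EntryCont H)
    (h : FormDom F H) : FormDom (Q.duh F) (Q.duh H) := by
  intro t ht N v u
  rcases N with _ | N
  · simp [form]
  have hre : ∀ w : ℕ → ℂ, (form (N + 1) (Q.duh H t) w w).re
      = ∫ s in (0 : ℝ)..t, (Q.lind N H t w w s).re := by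
    intro w
    rw [Q.form_duh N hH]
    have hi : IntervalIntegrable (Q.lind N H t w w) MeasureTheory.volume 0 t :=
      (Q.lind_continuous N hH t w w).intervalIntegrable _ _
    exact (Complex.reCLM.intervalIntegral_comp_comm hi).symm
  have hint : ∀ w : ℕ → ℂ, Continuous fun s => (Q.lind N H t w w s).re := fun w =>
    Complex.continuous_re.comp (Q.lind_continuous N hH t w w)
  rw [hre, hre, Q.form_duh N hF, ← intervalIntegral.integral_add
    ((hint v).intervalIntegrable _ _) ((hint u).intervalIntegrable _ _),
    ← intervalIntegral.integral_div]
  refine intervalIntegral.norm_integral_le_of_norm_le ht ?_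
    (((hint v).add (hint u)).div_const 2 |>.intervalIntegrable _ _)
  refine Eventually.of_forall fun s hs => ?_
  have h1 := h s hs.1.le N (Q.noise 0 (Q.semi (t - s) v)) (Q.noise 0 (Q.semi (t - s) u))
  have h2 := h s hs.1.le (N + 2) (Q.noise 1 (Q.semi (t - s) v)) (Q.noise 1 (Q.semi (t - s) u))
  refine (norm_add_le _ _).trans ?_
  simp only [lind, Complex.add_re]
  linarith

/-- The matrix of the identity. -/
def _root_.QuadraticOscillator.idm (n m : ℕ) : ℂ := if n = m then 1 else 0

lemma _root_.QuadraticOscillator.form_idm (N : ℕ) (w : ℕ → ℂ) :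
    form N idm w w = ((∑ n ∈ Finset.range N, ‖w n‖ ^ 2 : ℝ) : ℂ) := by
  unfold form idm
  push_cast
  refine Finset.sum_congr rfl fun n hn => ?_
  rw [Finset.sum_eq_single_of_mem n hn]
  · rw [if_pos rfl, mul_one, mul_comm, Complex.mul_conj, Complex.normSq_eq_norm_sq]
    push_cast; rfl
  · intro m _ hm
    simp [hm.symm]

lemma FormDom_jumps (a : Obs) (k : ℕ) :
    FormDom (Q.jumps (mat a) k) (Q.jumps (fun n m => (‖a‖ : ℂ) * idm n m) k) := by
  induction k with
  | zero =>
    intro s _ N v u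
    simp only [jumps, form_free]
    have h := norm_form_le a N (Q.semi s v) (Q.semi s u)
    have h2 : ∀ w : ℕ → ℂ, (form N (fun n m => (‖a‖ : ℂ) * idm n m) w w).re
        = ‖a‖ * ∑ n ∈ Finset.range N, ‖w n‖ ^ 2 := by
      intro w
      have : form N (fun n m => (‖a‖ : ℂ) * idm n m) w w = (‖a‖ : ℂ) * form N idm w w := by
        simp only [form, Finset.mul_sum]
        refine Finset.sum_congr rfl fun n _ => Finset.sum_congr rfl fun m _ => ?_
        ring
      rw [this, form_idm, ← Complex.ofReal_mul, Complex.ofReal_re]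
    rw [h2, h2]
    linarith
  | succ k ih => exact Q.FormDom_duh (Q.jumps_continuous _ k) (Q.jumps_continuous _ k) ih

end Params

lemma form_smul (c : ℂ) (N : ℕ) (A : ℕ → ℕ → ℂ) (v u : ℕ → ℂ) :
    form N (fun n m => c * A n m) v u = c * form N A v u := by
  simp only [form, Finset.mul_sum]
  refine Finset.sum_congr rfl fun n _ => Finset.sum_congr rfl fun m _ => ?_
  ring

lemma form_sub (N : ℕ) (A B : ℕ → ℕ → ℂ) (v u : ℕ → ℂ) :
    form N (fun n m => A n m - B n m) v u = form N A v u - form N B v u := by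
  simp only [form, ← Finset.sum_sub_distrib]
  refine Finset.sum_congr rfl fun n _ => Finset.sum_congr rfl fun m _ => ?_
  ring

lemma form_sum {ι : Type*} (S : Finset ι) (N : ℕ) (A : ι → ℕ → ℕ → ℂ) (v u : ℕ → ℂ) :
    form N (fun n m => ∑ k ∈ S, A k n m) v u = ∑ k ∈ S, form N (A k) v u := by
  simp only [form, Finset.mul_sum, Finset.sum_mul]
  symm
  rw [Finset.sum_comm]
  refine Finset.sum_congr rfl fun n _ => ?_
  rw [Finset.sum_comm]

/-! ### The identity under the iteration, and the remainders of its jump series. -/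

namespace Params
variable (Q : Params)

/-- On the diagonal the Hamiltonian coefficients cancel, so the classical process there does not see
`ζ⁺` and `ζ⁻`. -/
lemma kap_add (n : ℕ) : Q.kap n n = ((Q.mu ^ 2 * omega Q.r n + Q.lam ^ 2 * omega Q.r (n + 1) : ℝ) : ℂ) := by
  have h : Q.kap n n = ((2 * (Q.g n).re : ℝ) : ℂ) := by
    rw [kap, add_comm, Complex.add_conj]
  have h' : (Q.g n).re = Q.lam ^ 2 / 2 * omega Q.r (n + 1) + Q.mu ^ 2 / 2 * omega Q.r n := by
    simp [g, ← Complex.ofReal_pow]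
  rw [h, h']
  congr 1
  ring

lemma gain_idm_diag (n : ℕ) : Q.gain idm n n = Q.kap n n := by
  have h1 : (√(omega Q.r (n + 1)) : ℂ) * √(omega Q.r (n + 1)) = omega Q.r (n + 1) := by
    rw [← Complex.ofReal_mul, Real.mul_self_sqrt (Q.omega_nonneg _)]
  have h2 : (√(omega Q.r n) : ℂ) * √(omega Q.r n) = omega Q.r n := by
    rw [← Complex.ofReal_mul, Real.mul_self_sqrt (Q.omega_nonneg _)]
  rw [kap_add, gain, idm, idm, if_pos rfl, if_pos rfl, mul_one, mul_one, mul_assoc, mul_assoc, h1,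
    h2]
  push_cast
  rfl

lemma gain_idm_off {n m : ℕ} (h : n ≠ m) : Q.gain idm n m = 0 := by
  rw [gain, idm, idm, if_neg (c := n + 1 = m + 1) (by omega), mul_zero, add_zero]
  rcases n with _ | n
  · simp [Q.omega_zero]
  rcases m with _ | m
  · simp [Q.omega_zero]
  rw [if_neg (by omega), mul_zero]

/-- The formal identity `G + G^* + ∑ L_i^* L_i = 0` says that gain and loss of the identity balance;
the integrand is then an exact derivative. In other words, the identity solves the Duhamel equation.
-/
lemma duh_idm (t : ℝ) (n m : ℕ) :
    Q.duh (fun _ => idm) t n m = idm n m - Q.free idm t n m := by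
  by_cases hnm : n = m
  · subst hnm
    rw [duh_eq, free, idm, if_pos rfl, mul_one, gain_idm_diag]
    have hd : ∀ s ∈ Set.uIcc 0 t, HasDerivAt (fun s : ℝ => Complex.exp ((s : ℂ) * Q.kap n n))
        (Complex.exp ((s : ℂ) * Q.kap n n) * Q.kap n n) s := by
      intro s _
      have h1 : HasDerivAt (fun s : ℝ => (s : ℂ) * Q.kap n n) (1 * Q.kap n n) s :=
        (Complex.ofRealCLM.hasDerivAt (x := s)).mul_const _
      simpa using h1.cexp
    rw [intervalIntegral.integral_eq_sub_of_hasDerivAt hd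
      (Continuous.intervalIntegrable (by fun_prop) _ _), mul_sub, ← Complex.exp_add]
    simp
  · rw [duh, Q.gain_idm_off hnm, free, idm, if_neg hnm]
    simp

/-- What remains of the identity after the contributions of fewer than `M` jumps. -/
def rem (M : ℕ) (t : ℝ) (n m : ℕ) : ℂ := idm n m - ∑ k ∈ Finset.range M, Q.jumps idm k t n m

lemma rem_continuous (M : ℕ) : EntryCont (Q.rem M) := fun n m =>
  continuous_const.sub (continuous_finsetSum _ fun k _ => Q.jumps_continuous idm k n m)

lemma sum_jumps_continuous (A : ℕ → ℕ → ℂ) (M : ℕ) :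
    EntryCont fun s n m => ∑ k ∈ Finset.range M, Q.jumps A k s n m := fun n m =>
  continuous_finsetSum _ fun k _ => Q.jumps_continuous A k n m

lemma duh_sum_jumps (A : ℕ → ℕ → ℂ) (M : ℕ) (t : ℝ) (n m : ℕ) :
    Q.duh (fun s n m => ∑ k ∈ Finset.range M, Q.jumps A k s n m) t n m
      = ∑ k ∈ Finset.range M, Q.jumps A (k + 1) t n m := by
  induction M with
  | zero => simp [duh, gain]
  | succ M ih =>
    simp_rw [Finset.sum_range_succ]
    rw [Q.duh_add (Q.sum_jumps_continuous A M) (Q.jumps_continuous A M), ih]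
    rfl

lemma sum_jumps_succ (A : ℕ → ℕ → ℂ) (M : ℕ) (t : ℝ) (n m : ℕ) :
    ∑ k ∈ Finset.range (M + 1), Q.jumps A k t n m = Q.free A t n m
      + Q.duh (fun s n m => ∑ k ∈ Finset.range M, Q.jumps A k s n m) t n m := by
  rw [duh_sum_jumps, Finset.sum_range_succ', add_comm]
  rfl

lemma rem_succ (M : ℕ) : Q.rem (M + 1) = Q.duh (Q.rem M) := by
  funext t n m
  have h := Q.duh_sub (F := fun _ => idm) (fun n m => continuous_const)
    (Q.sum_jumps_continuous idm M) t n m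
  rw [Q.duh_idm] at h
  rw [rem, sum_jumps_succ, ← sub_sub, ← h]
  rfl

/-- By `rem_succ` the remainder is the `M`-fold Duhamel iterate of the identity. Its positivity
bounds all partial sums of the jump series by the identity. -/
lemma formPos_rem (M : ℕ) (T : ℝ) : FormPos T (Q.rem M) := by
  induction M with
  | zero =>
    intro s _ N w
    have : Q.rem 0 s = idm := by funext n m; simp [rem]
    rw [this, form_idm, Complex.zero_le_real]
    positivity
  | succ M ih =>
    rw [rem_succ]
    exact Q.FormPos_duh (Q.rem_continuous M) ih

end Params

/-! ### Square roots and positive and negative parts of operators. -/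

section Operators

variable {H : Type*} [NormedAddCommGroup H] [InnerProductSpace ℂ H] [CompleteSpace H]

lemma exists_star_mul_self_of_nonneg {x : H →L[ℂ] H} (h : 0 ≤ x) : ∃ s, x = star s * s :=
  CStarAlgebra.nonneg_iff_eq_star_mul_self.1 h

lemma exists_sqrt {x : H →L[ℂ] H} (h : 0 ≤ x) : ∃ s : H →L[ℂ] H, IsSelfAdjoint s ∧ s * s = x :=
  ⟨CFC.sqrt x, (CFC.sqrt_nonneg x).isSelfAdjoint, CFC.sqrt_mul_sqrt_self x⟩

lemma exists_posPart_negPart {x : H →L[ℂ] H} (h : IsSelfAdjoint x) :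
    ∃ a b : H →L[ℂ] H, 0 ≤ a ∧ 0 ≤ b ∧ x = a - b ∧ b * a = 0 :=
  ⟨x⁺, x⁻, CFC.posPart_nonneg x, CFC.negPart_nonneg x, (CFC.posPart_sub_negPart x h).symm,
    CFC.negPart_mul_posPart x⟩

end Operators

/-! ### The minimal semigroup as a sum over the number of jumps -/

lemma form_pi_single {N n m : ℕ} (A : ℕ → ℕ → ℂ) (hn : n < N) (hm : m < N) :
    form N A (Pi.single n 1) (Pi.single m 1) = A n m := by
  rw [form, Finset.sum_eq_single_of_mem n (Finset.mem_range.2 hn),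
    Finset.sum_eq_single_of_mem m (Finset.mem_range.2 hm)]
  · simp
  · intro k _ hk; simp [hk]
  · intro k _ hk; simp [hk]

namespace Params

variable (Q : Params)

/-- The probability of exactly `k` jumps, as a quadratic form. -/
def jumpForm (k : ℕ) (t : ℝ) (N : ℕ) (u : ℕ → ℂ) : ℝ := (form N (Q.jumps idm k t) u u).re

/-- The probability of exactly `k` jumps up to time `t` when starting from `n`. -/
def jumpProb (k : ℕ) (t : ℝ) (n : ℕ) : ℝ := (Q.jumps idm k t n n).re

lemma jumpForm_single (k : ℕ) (t : ℝ) {N n : ℕ} (hn : n < N) :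
    Q.jumpForm k t N (Pi.single n 1) = Q.jumpProb k t n := by
  rw [jumpForm, form_pi_single _ hn hn, jumpProb]

lemma form_jumps_idm_nonneg (k : ℕ) {t : ℝ} (ht : 0 ≤ t) (N : ℕ) (u : ℕ → ℂ) :
    0 ≤ form N (Q.jumps idm k t) u u := by
  refine Q.FormPos_jumps t (fun N w => ?_) k t ⟨ht, le_rfl⟩ N u
  rw [form_idm, Complex.zero_le_real]
  positivity

lemma jumpForm_nonneg (k : ℕ) {t : ℝ} (ht : 0 ≤ t) (N : ℕ) (u : ℕ → ℂ) :
    0 ≤ Q.jumpForm k t N u :=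
  (Complex.nonneg_iff.1 (Q.form_jumps_idm_nonneg k ht N u)).1

lemma jumpProb_nonneg (k : ℕ) {t : ℝ} (ht : 0 ≤ t) (n : ℕ) : 0 ≤ Q.jumpProb k t n := by
  rw [← Q.jumpForm_single k t n.lt_succ_self]
  exact Q.jumpForm_nonneg k ht _ _

lemma jumps_idm_diag (k : ℕ) {t : ℝ} (ht : 0 ≤ t) (n : ℕ) :
    Q.jumps idm k t n n = (Q.jumpProb k t n : ℂ) := by
  have h := Q.form_jumps_idm_nonneg k ht (n + 1) (Pi.single n 1)
  rw [form_pi_single _ n.lt_succ_self n.lt_succ_self, Complex.nonneg_iff] at h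
  exact Complex.ext rfl (by simpa using h.2.symm)

lemma sum_jumpForm_le (M : ℕ) {t : ℝ} (ht : 0 ≤ t) (N : ℕ) (u : ℕ → ℂ) :
    ∑ k ∈ Finset.range M, Q.jumpForm k t N u ≤ ∑ n ∈ Finset.range N, ‖u n‖ ^ 2 := by
  have h := (Complex.nonneg_iff.1 (Q.formPos_rem M t t ⟨ht, le_rfl⟩ N u)).1
  have h2 : form N (Q.rem M t) u u = form N idm u u - ∑ k ∈ Finset.range M,
      form N (Q.jumps idm k t) u u := by
    rw [← form_sum, ← form_sub]; rfl
  rw [h2, form_idm, Complex.sub_re, Complex.ofReal_re, Complex.re_sum] at h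
  exact sub_nonneg.1 h

lemma summable_jumpForm {t : ℝ} (ht : 0 ≤ t) (N : ℕ) (u : ℕ → ℂ) :
    Summable fun k => Q.jumpForm k t N u :=
  summable_of_sum_range_le (fun k => Q.jumpForm_nonneg k ht N u)
    fun M => Q.sum_jumpForm_le M ht N u

lemma summable_jumpProb {t : ℝ} (ht : 0 ≤ t) (n : ℕ) : Summable fun k => Q.jumpProb k t n := by
  simpa only [Q.jumpForm_single _ t n.lt_succ_self] using
    Q.summable_jumpForm ht (n + 1) (Pi.single n 1)

lemma sum_jumpProb_le (M : ℕ) {t : ℝ} (ht : 0 ≤ t) (n : ℕ) :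
    ∑ k ∈ Finset.range M, Q.jumpProb k t n ≤ 1 := by
  have h := Q.sum_jumpForm_le M ht (n + 1) (Pi.single n 1)
  simp only [Q.jumpForm_single _ t n.lt_succ_self] at h
  refine h.trans (le_of_eq ?_)
  rw [Finset.sum_eq_single_of_mem n (by simp)]
  · simp
  · intro m _ hm; simp [hm]

lemma norm_form_jumps_le (a : Obs) (k : ℕ) {t : ℝ} (ht : 0 ≤ t) (N : ℕ) (v u : ℕ → ℂ) :
    ‖form N (Q.jumps (mat a) k t) v u‖
      ≤ ‖a‖ * (Q.jumpForm k t N v + Q.jumpForm k t N u) / 2 := by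
  have h := Q.FormDom_jumps a k t ht N v u
  have h2 : ∀ w, (form N (Q.jumps (fun n m => (‖a‖ : ℂ) * idm n m) k t) w w).re
      = ‖a‖ * Q.jumpForm k t N w := by
    intro w
    have : Q.jumps (fun n m => (‖a‖ : ℂ) * idm n m) k t
        = fun n m => (‖a‖ : ℂ) * Q.jumps idm k t n m := by
      funext n m; exact Q.jumps_smul _ _ _ _ _ _
    rw [this, form_smul, Complex.re_ofReal_mul, jumpForm]
  rw [h2, h2] at h
  linarith

lemma norm_jumps_le (a : Obs) (k : ℕ) {t : ℝ} (ht : 0 ≤ t) (n m : ℕ) :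
    ‖Q.jumps (mat a) k t n m‖ ≤ ‖a‖ * (Q.jumpProb k t n + Q.jumpProb k t m) / 2 := by
  have hn : n < n + m + 1 := by omega
  have hm : m < n + m + 1 := by omega
  have h := Q.norm_form_jumps_le a k ht (n + m + 1) (Pi.single n 1) (Pi.single m 1)
  rwa [form_pi_single _ hn hm, Q.jumpForm_single _ _ hn, Q.jumpForm_single _ _ hm] at h

lemma summable_jumps (a : Obs) {t : ℝ} (ht : 0 ≤ t) (n m : ℕ) :
    Summable fun k => Q.jumps (mat a) k t n m :=
  Summable.of_norm_bounded ((((Q.summable_jumpProb ht n).add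
    (Q.summable_jumpProb ht m)).mul_left ‖a‖).div_const 2) fun k => Q.norm_jumps_le a k ht n m

lemma norm_sum_jumps_le (a : Obs) (M : ℕ) {t : ℝ} (ht : 0 ≤ t) (n m : ℕ) :
    ‖∑ k ∈ Finset.range M, Q.jumps (mat a) k t n m‖ ≤ ‖a‖ := by
  refine (norm_sum_le_of_le _ fun k _ => Q.norm_jumps_le a k ht n m).trans ?_
  rw [← Finset.sum_div, ← Finset.mul_sum, Finset.sum_add_distrib]
  have h1 := Q.sum_jumpProb_le M ht n
  have h2 := Q.sum_jumpProb_le M ht m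
  nlinarith [norm_nonneg a]

lemma hasSum_form {A : ℕ → ℕ → ℕ → ℂ} {B : ℕ → ℕ → ℂ}
    (h : ∀ n m, HasSum (fun k => A k n m) (B n m)) (N : ℕ) (v u : ℕ → ℂ) :
    HasSum (fun k => form N (A k) v u) (form N B v u) :=
  hasSum_sum fun n _ => hasSum_sum fun m _ => ((h n m).mul_left _).mul_right _

/-- The entries converge by comparison with the jump probabilities. The sum is bounded by `‖a‖`
because the domination of each term adds up over `k` and the jump forms of a vector sum to at most
its squared norm. -/
lemma exists_evolution (t : ℝ≥0) (a : Obs) :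
    ∃ b : Obs, ‖b‖ ≤ ‖a‖ ∧ ∀ n m, HasSum (fun k => Q.jumps (mat a) k t n m) (mat b n m) := by
  have hs := fun n m => (Q.summable_jumps a t.2 n m).hasSum
  obtain ⟨b, hb, hmat⟩ := exists_op_of_form_bound (A := fun n m => ∑' k, Q.jumps (mat a) k t n m)
    (C := ‖a‖) (by
      intro N v u
      refine (le_of_tendsto' (hasSum_form hs N v u).tendsto_sum_nat.norm fun M => ?_)
      refine (norm_sum_le_of_le _ fun k _ => Q.norm_form_jumps_le a k t.2 N v u).trans ?_
      rw [← Finset.sum_div, ← Finset.mul_sum, Finset.sum_add_distrib]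
      have h1 := Q.sum_jumpForm_le M t.2 N v
      have h2 := Q.sum_jumpForm_le M t.2 N u
      gcongr)
  refine ⟨b, hb, fun n m => ?_⟩
  rw [hmat]
  exact hs n m

/-- The minimal quantum dynamical semigroup. -/
def evolution (t : ℝ≥0) : Obs →ₗ[ℂ] Obs where
  toFun a := (Q.exists_evolution t a).choose
  map_add' a b := by
    refine op_ext fun n m => ((Q.exists_evolution t (a + b)).choose_spec.2 n m).unique ?_
    rw [mat_add]
    convert ((Q.exists_evolution t a).choose_spec.2 n m).add
      ((Q.exists_evolution t b).choose_spec.2 n m) using 2 with k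
    rw [← jumps_add]
    congr 1; funext i j; exact mat_add a b i j
  map_smul' c a := by
    refine op_ext fun n m => ((Q.exists_evolution t (c • a)).choose_spec.2 n m).unique ?_
    rw [RingHom.id_apply, mat_smul]
    refine (((Q.exists_evolution t a).choose_spec.2 n m).mul_left c).congr_fun fun k => ?_
    rw [← jumps_smul]
    congr 1; funext i j; exact mat_smul c a i j

lemma norm_evolution_le (t : ℝ≥0) (a : Obs) : ‖Q.evolution t a‖ ≤ ‖a‖ :=
  (Q.exists_evolution t a).choose_spec.1

lemma hasSum_evolution (t : ℝ≥0) (a : Obs) (n m : ℕ) :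
    HasSum (fun k => Q.jumps (mat a) k t n m) (mat (Q.evolution t a) n m) :=
  (Q.exists_evolution t a).choose_spec.2 n m

/-- Two limits, over finite sections and over the number of jumps, reduce the claim to block
positivity of each jump term. -/
lemma evolution_completely_positive (t : ℝ≥0) (d : ℕ) (a b : Fin d → Obs) :
    0 ≤ ∑ i, ∑ j, star (b i) * Q.evolution t (star (a i) * a j) * b j := by
  rw [nonneg_iff]
  intro u
  have h1 : inner ℂ u ((∑ i, ∑ j, star (b i) * Q.evolution t (star (a i) * a j) * b j) u)
      = ∑ i, ∑ j, inner ℂ (b i u) (Q.evolution t (star (a i) * a j) (b j u)) := by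
    simp only [sum_apply, inner_sum, mul_apply_eq_comp, ContinuousLinearMap.star_eq_adjoint,
      ContinuousLinearMap.adjoint_inner_right]
  rw [h1]
  refine ge_of_tendsto' (tendsto_finsetSum _ fun i _ => tendsto_finsetSum _ fun j _ =>
    tendsto_form (Q.evolution t (star (a i) * a j)) (b i u) (b j u)) fun N => ?_
  refine ge_of_tendsto' ((hasSum_sum fun i _ => hasSum_sum fun j _ =>
    hasSum_form (Q.hasSum_evolution t (star (a i) * a j)) N (b i u) (b j u)).tendsto_sum_nat)
    fun M => Finset.sum_nonneg fun k _ => ?_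
  refine Q.BlockPos_jumps (t : ℝ) (A := fun i j => mat (star (a i) * a j)) (fun N w => ?_) k t
    ⟨t.2, le_rfl⟩ N fun i => b i u
  -- The initial block matrix is a Gram matrix: its form is the squared norm of `∑ i, a i (w i)`.
  have h2 : ∑ i, ∑ j, form N (mat (star (a i) * a j)) (w i) (w j)
      = inner ℂ (∑ i, a i (ofSeq N (w i))) (∑ i, a i (ofSeq N (w i))) := by
    rw [sum_inner]
    refine Finset.sum_congr rfl fun i _ => ?_
    rw [inner_sum]
    refine Finset.sum_congr rfl fun j _ => ?_
    rw [← inner_ofSeq, mul_apply_eq_comp, ContinuousLinearMap.star_eq_adjoint,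
      ContinuousLinearMap.adjoint_inner_right]
  rw [h2, inner_self_eq_norm_sq_to_K]
  exact pow_nonneg (Complex.zero_le_real.2 (norm_nonneg (∑ i, a i (ofSeq N (w i))))) 2

end Params

lemma nonneg_map_of_completely_positive {f : Obs →ₗ[ℂ] Obs}
    (h : ∀ (n : ℕ) (a b : Fin n → Obs), 0 ≤ ∑ i, ∑ j, star (b i) * f (star (a i) * a j) * b j)
    {x : Obs} (hx : 0 ≤ x) : 0 ≤ f x := by
  obtain ⟨s, rfl⟩ := exists_star_mul_self_of_nonneg hx
  simpa using h 1 (fun _ => s) (fun _ => 1)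

namespace Params

variable (Q : Params)

lemma evolution_nonneg (t : ℝ≥0) {x : Obs} (hx : 0 ≤ x) : 0 ≤ Q.evolution t x :=
  nonneg_map_of_completely_positive (Q.evolution_completely_positive t) hx

/-- The Lindblad equation for the evolution of a single operator, on matrix elements. -/
def IsMild (x : Obs) (F : ℝ≥0 → Obs) : Prop :=
  ∀ (t : ℝ≥0) (n m : ℕ),
    IntervalIntegrable (fun s : ℝ => Complex.exp (-((t : ℂ) - s) * Q.kap n m) *
      Q.gain (mat (F s.toNNReal)) n m) MeasureTheory.volume 0 t ∧
    mat (F t) n m = Q.free (mat x) t n m + Q.duh (fun s => mat (F s.toNNReal)) t n m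

variable {Q}

/-- No regularity of `F` is assumed: the equation writes each entry through a primitive of an
integrable function. The competitors in the minimality statement therefore need no continuity
hypothesis. -/
lemma IsMild.continuous_mat {x : Obs} {F : ℝ≥0 → Obs} (h : Q.IsMild x F) (n m : ℕ) :
    Continuous fun t : ℝ≥0 => mat (F t) n m := by
  set f : ℝ → ℂ := fun s => Complex.exp ((s : ℂ) * Q.kap n m) * Q.gain (mat (F s.toNNReal)) n m
    with hf
  have h0 : ∀ t : ℝ, IntervalIntegrable f MeasureTheory.volume 0 t := by
    intro t
    rcases le_total 0 t with ht | ht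
    · have h1 := ((h t.toNNReal n m).1).const_mul (Complex.exp ((t : ℂ) * Q.kap n m))
      rw [Real.coe_toNNReal t ht] at h1
      refine h1.congr fun s _ => ?_
      simp only [hf]
      rw [← mul_assoc, ← Complex.exp_add]
      congr 2
      ring
    -- At negative times `toNNReal` freezes `F` at its value at `0`.
    · have h1 : Continuous fun s : ℝ =>
          Complex.exp ((s : ℂ) * Q.kap n m) * Q.gain (mat (F 0)) n m := by fun_prop
      refine (h1.intervalIntegrable 0 t).congr fun s hs => ?_
      rw [Set.uIoc_of_ge ht] at hs
      simp only [hf]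
      rw [Real.toNNReal_of_nonpos hs.2]
  have h1 : Continuous fun t : ℝ≥0 => ∫ s in (0 : ℝ)..t, f s :=
    (intervalIntegral.continuous_primitive (fun a b => (h0 a).symm.trans (h0 b)) 0).comp
      NNReal.continuous_coe
  have h2 : (fun t : ℝ≥0 => mat (F t) n m) = fun t : ℝ≥0 => Q.free (mat x) t n m
      + Complex.exp (-((t : ℝ) : ℂ) * Q.kap n m) * ∫ s in (0 : ℝ)..t, f s := by
    funext t
    rw [(h t n m).2, duh_eq]
  rw [h2]
  exact ((Q.free_continuous (mat x) n m).comp NNReal.continuous_coe).add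
    (Continuous.mul (by fun_prop) h1)

lemma IsMild.entryCont {x : Obs} {F : ℝ≥0 → Obs} (h : Q.IsMild x F) :
    EntryCont fun s => mat (F s.toNNReal) := fun n m =>
  (h.continuous_mat n m).comp continuous_real_toNNReal

variable (Q)

lemma norm_gain_le {A : ℕ → ℕ → ℂ} {C : ℝ} (hA : ∀ i j, ‖A i j‖ ≤ C) (n m : ℕ) :
    ‖Q.gain A n m‖ ≤ (Q.mu ^ 2 * √(omega Q.r n) * √(omega Q.r m)
      + Q.lam ^ 2 * √(omega Q.r (n + 1)) * √(omega Q.r (m + 1))) * C := by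
  refine (norm_add_le _ _).trans ?_
  simp only [norm_mul, norm_pow, Complex.norm_real, Real.norm_of_nonneg (Real.sqrt_nonneg _),
    Real.norm_eq_abs, sq_abs, add_mul]
  gcongr <;> exact hA _ _

/-- The partial sums satisfy the recursion `sum_jumps_succ`, and their entries are bounded by `‖x‖`
uniformly in `M`, so dominated convergence gives the equation in the limit. -/
lemma evolution_isMild (x : Obs) : Q.IsMild x fun t => Q.evolution t x := by
  intro t n m
  set S : ℕ → ℝ → ℕ → ℕ → ℂ := fun M s n m => ∑ k ∈ Finset.range M, Q.jumps (mat x) k s n m with hS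
  have hSc : ∀ M, EntryCont (S M) := fun M => Q.sum_jumps_continuous (mat x) M
  set D := Q.mu ^ 2 * √(omega Q.r n) * √(omega Q.r m)
      + Q.lam ^ 2 * √(omega Q.r (n + 1)) * √(omega Q.r (m + 1)) with hD
  have hlim : ∀ s : ℝ, 0 ≤ s → ∀ n m,
      Tendsto (fun M => S M s n m) atTop (𝓝 (mat (Q.evolution s.toNNReal x) n m)) := by
    intro s hs n m
    have h := (Q.hasSum_evolution s.toNNReal x n m).tendsto_sum_nat
    rwa [Real.coe_toNNReal s hs] at h
  have hlim' : ∀ s : ℝ, 0 ≤ s → Tendsto (fun M => Complex.exp (-((t : ℂ) - s) * Q.kap n m) *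
      Q.gain (S M s) n m) atTop (𝓝 (Complex.exp (-((t : ℂ) - s) * Q.kap n m) *
      Q.gain (mat (Q.evolution s.toNNReal x)) n m)) := by
    intro s hs
    refine Tendsto.const_mul _ ?_
    exact ((hlim s hs _ _).const_mul _).add ((hlim s hs _ _).const_mul _)
  have hbd : ∀ M (s : ℝ), 0 ≤ s → ‖Complex.exp (-((t : ℂ) - s) * Q.kap n m) *
      Q.gain (S M s) n m‖ ≤ ‖Complex.exp (-((t : ℂ) - s) * Q.kap n m)‖ * (D * ‖x‖) := by
    intro M s hs
    rw [norm_mul]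
    exact mul_le_mul_of_nonneg_left
      (Q.norm_gain_le (fun i j => Q.norm_sum_jumps_le x M hs i j) n m) (norm_nonneg _)
  have hbc : Continuous fun s : ℝ =>
      ‖Complex.exp (-((t : ℂ) - s) * Q.kap n m)‖ * (D * ‖x‖) := by fun_prop
  have ht : (0 : ℝ) ≤ t := t.2
  have hmem : ∀ᵐ s ∂(MeasureTheory.volume.restrict (Set.uIoc (0 : ℝ) t)), 0 ≤ s := by
    rw [Set.uIoc_of_le ht]
    filter_upwards [MeasureTheory.ae_restrict_mem measurableSet_Ioc] with s hs using hs.1.le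
  have hmeas := fun M => (Q.duh_integrand_continuous (hSc M) t n m)
  constructor
  · refine (hbc.intervalIntegrable 0 t).mono_fun' ?_ ?_
    · refine aestronglyMeasurable_of_tendsto_ae atTop
        (fun M => (hmeas M).aestronglyMeasurable) ?_
      filter_upwards [hmem] with s hs using hlim' s hs
    · filter_upwards [hmem] with s hs using
        le_of_tendsto' (hlim' s hs).norm fun M => hbd M s hs
  · refine tendsto_nhds_unique (f := fun M => S (M + 1) t n m) (l := atTop) ?_ ?_
    · have h := hlim t t.2 n m
      rw [Real.toNNReal_coe] at h
      exact h.comp (tendsto_add_atTop_nat 1)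
    · simp only [hS, sum_jumps_succ]
      refine tendsto_const_nhds.add ?_
      refine intervalIntegral.tendsto_integral_filter_of_dominated_convergence _
        (Eventually.of_forall fun M => (hmeas M).aestronglyMeasurable)
        (Eventually.of_forall fun M => ?_) (hbc.intervalIntegrable 0 t) ?_
      · rw [← MeasureTheory.ae_restrict_iff' measurableSet_uIoc]
        filter_upwards [hmem] with s hs using hbd M s hs
      · rw [← MeasureTheory.ae_restrict_iff' measurableSet_uIoc]
        filter_upwards [hmem] with s hs using hlim' s hs

end Params

/-! ### Conservativity -/

namespace Params

variable (Q : Params)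

/-- The exit rate of the birth and death process on the diagonal. -/
def exitRate (n : ℕ) : ℝ := Q.mu ^ 2 * omega Q.r n + Q.lam ^ 2 * omega Q.r (n + 1)

/-- The Duhamel operator of the birth and death process on the diagonal. -/
def diagDuh (f : ℝ → ℕ → ℝ) (t : ℝ) (n : ℕ) : ℝ :=
  ∫ s in (0 : ℝ)..t, Real.exp (-(t - s) * Q.exitRate n) *
    (Q.mu ^ 2 * omega Q.r n * f s (n - 1) + Q.lam ^ 2 * omega Q.r (n + 1) * f s (n + 1))

lemma kap_diag (n : ℕ) : Q.kap n n = (Q.exitRate n : ℂ) := Q.kap_add n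

lemma gain_diag (A : ℕ → ℕ → ℂ) (n : ℕ) :
    Q.gain A n n = ((Q.mu ^ 2 * omega Q.r n : ℝ) : ℂ) * A (n - 1) (n - 1)
      + ((Q.lam ^ 2 * omega Q.r (n + 1) : ℝ) : ℂ) * A (n + 1) (n + 1) := by
  have h : ∀ k, (√(omega Q.r k) : ℂ) * √(omega Q.r k) = omega Q.r k := fun k => by
    rw [← Complex.ofReal_mul, Real.mul_self_sqrt (Q.omega_nonneg _)]
  rw [gain, mul_assoc ((Q.mu : ℂ) ^ 2), mul_assoc ((Q.lam : ℂ) ^ 2), h, h]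
  push_cast
  rfl

lemma re_duh_diag {F : ℝ → ℕ → ℕ → ℂ} (hF : EntryCont F) (t : ℝ) (n : ℕ) :
    (Q.duh F t n n).re = Q.diagDuh (fun s k => (F s k k).re) t n := by
  rw [duh, diagDuh]
  have hi := (Q.duh_integrand_continuous hF t n n).intervalIntegrable
    (μ := MeasureTheory.volume) 0 t
  refine (Complex.reCLM.intervalIntegral_comp_comm hi).symm.trans ?_
  refine intervalIntegral.integral_congr fun s _ => ?_
  have h1 : Complex.exp (-((t : ℂ) - s) * Q.kap n n)
      = (Real.exp (-(t - s) * Q.exitRate n) : ℂ) := by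
    rw [kap_diag]; push_cast; rfl
  simp only [Complex.reCLM_apply]
  rw [h1, Complex.re_ofReal_mul, gain_diag, Complex.add_re, Complex.re_ofReal_mul,
    Complex.re_ofReal_mul]

lemma diagDuh_integrand_continuous {f : ℝ → ℕ → ℝ} (hf : ∀ n, Continuous fun s => f s n) (t : ℝ)
    (n : ℕ) : Continuous fun s : ℝ => Real.exp (-(t - s) * Q.exitRate n) *
    (Q.mu ^ 2 * omega Q.r n * f s (n - 1) + Q.lam ^ 2 * omega Q.r (n + 1) * f s (n + 1)) := by
  have h1 := hf (n - 1)
  have h2 := hf (n + 1)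
  fun_prop

lemma diagDuh_mono {f h : ℝ → ℕ → ℝ} (hf : ∀ n, Continuous fun s => f s n)
    (hh : ∀ n, Continuous fun s => h s n) {t : ℝ} (ht : 0 ≤ t)
    (hle : ∀ s ∈ Set.Icc 0 t, ∀ n, f s n ≤ h s n) (n : ℕ) : Q.diagDuh f t n ≤ Q.diagDuh h t n := by
  refine intervalIntegral.integral_mono_on ht
    ((Q.diagDuh_integrand_continuous hf t n).intervalIntegrable _ _)
    ((Q.diagDuh_integrand_continuous hh t n).intervalIntegrable _ _) fun s hs => ?_
  have h1 := Q.omega_nonneg n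
  have h2 := Q.omega_nonneg (n + 1)
  have h3 := hle s hs (n - 1)
  have h4 := hle s hs (n + 1)
  gcongr

lemma diagDuh_combination {f h : ℝ → ℕ → ℝ} (hf : ∀ n, Continuous fun s => f s n)
    (hh : ∀ n, Continuous fun s => h s n) (a b t : ℝ) (n : ℕ) :
    Q.diagDuh (fun s k => a * f s k + b * h s k) t n
      = a * Q.diagDuh f t n + b * Q.diagDuh h t n := by
  simp only [diagDuh]
  rw [← intervalIntegral.integral_const_mul, ← intervalIntegral.integral_const_mul,
    ← intervalIntegral.integral_add
      (((Q.diagDuh_integrand_continuous hf t n).intervalIntegrable _ _).const_mul a)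
      (((Q.diagDuh_integrand_continuous hh t n).intervalIntegrable _ _).const_mul b)]
  congr 1
  funext s
  ring

/-- A Lyapunov function for the birth and death process. -/
def lyap (n : ℕ) : ℝ := ∑ j ∈ Finset.range n, 1 / ((j : ℝ) + Q.r)

lemma lyap_mono : Monotone Q.lyap := by
  refine monotone_nat_of_le_succ fun n => ?_
  rw [lyap, lyap, Finset.sum_range_succ]
  have := Q.r_pos
  have : 0 ≤ 1 / ((n : ℝ) + Q.r) := by positivity
  linarith

lemma lyap_nonneg (n : ℕ) : 0 ≤ Q.lyap n := by
  have := Q.r_pos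
  exact Finset.sum_nonneg fun j _ => by positivity

lemma tendsto_lyap : Tendsto Q.lyap atTop atTop := by
  have hr := Q.r_pos
  have h := Real.tendsto_sum_range_one_div_nat_succ_atTop.const_mul_atTop
    -- Comparison with the harmonic series: `j + r ≤ (1 + r) (j + 1)`.
    (show (0 : ℝ) < 1 / (1 + Q.r) by positivity)
  refine tendsto_atTop_mono (fun n => ?_) h
  rw [Finset.mul_sum, lyap]
  refine Finset.sum_le_sum fun j _ => ?_
  rw [div_mul_div_comm, one_mul]
  refine one_div_le_one_div_of_le (by positivity) ?_
  have : (0 : ℝ) ≤ j := Nat.cast_nonneg j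
  nlinarith

/-- The increments `1/(j+r)` are chosen to cancel one factor of `ω_{j+1} = (j+1)(j+r)`: births
contribute `λ² (n+1)` and deaths `-μ² n` to the drift, and the total is at most `μ²` when `λ ≤ μ`.
-/
lemma lyap_drift (hle : Q.lam ≤ Q.mu) (n : ℕ) :
    Q.mu ^ 2 * omega Q.r n * Q.lyap (n - 1) + Q.lam ^ 2 * omega Q.r (n + 1) * Q.lyap (n + 1)
      ≤ Q.exitRate n * Q.lyap n + Q.mu ^ 2 := by
  have hr := Q.r_pos
  have hl := Q.lam_pos
  have hsq : Q.lam ^ 2 ≤ Q.mu ^ 2 := by gcongr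
  have hup : omega Q.r (n + 1) * Q.lyap (n + 1) = omega Q.r (n + 1) * Q.lyap n + (n + 1) := by
    rw [lyap, Finset.sum_range_succ, ← lyap, mul_add, omega]
    push_cast
    have : (n : ℝ) + Q.r ≠ 0 := by positivity
    have h2 : (n : ℝ) + 1 + Q.r - 1 = n + Q.r := by ring
    rw [h2]
    field_simp
  have hdown : omega Q.r n * Q.lyap (n - 1) = omega Q.r n * Q.lyap n - n := by
    rcases n with _ | n
    · simp [omega]
    · rw [Nat.add_sub_cancel, lyap, lyap, Finset.sum_range_succ, ← lyap, mul_add, omega]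
      push_cast
      have : (n : ℝ) + Q.r ≠ 0 := by positivity
      have h2 : (n : ℝ) + 1 + Q.r - 1 = n + Q.r := by ring
      rw [h2]
      field_simp
      ring
  have hn : (0 : ℝ) ≤ n := Nat.cast_nonneg n
  rw [mul_assoc, mul_assoc, hup, hdown, exitRate]
  nlinarith

/-- The Lyapunov function, corrected to a supersolution of the evolution equation. -/
def superSol (t : ℝ) (n : ℕ) : ℝ := Q.lyap n + Q.mu ^ 2 * t

lemma superSol_continuous (n : ℕ) : Continuous fun t => Q.superSol t n := by
  unfold superSol; fun_prop

/-- By the drift bound the integrand is at most the derivative of `exp (-(t - s) q_n) * superSol s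
n` in `s`, where `q_n = exitRate n`; the boundary value at `s = 0` is nonnegative and can be
dropped. -/
lemma diagDuh_superSol_le (hle : Q.lam ≤ Q.mu) {t : ℝ} (ht : 0 ≤ t) (n : ℕ) :
    Q.diagDuh Q.superSol t n ≤ Q.superSol t n := by
  have hd : ∀ s ∈ Set.uIcc 0 t, HasDerivAt
      (fun s : ℝ => Real.exp (-(t - s) * Q.exitRate n) * Q.superSol s n)
      (Real.exp (-(t - s) * Q.exitRate n) * (Q.exitRate n * Q.superSol s n + Q.mu ^ 2)) s := by
    intro s _
    have h1 : HasDerivAt (fun s : ℝ => -(t - s) * Q.exitRate n) (Q.exitRate n) s := by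
      simpa using (((hasDerivAt_id s).const_sub t).neg.mul_const (Q.exitRate n))
    have h2 : HasDerivAt (fun s : ℝ => Q.superSol s n) (Q.mu ^ 2) s := by
      simpa [superSol] using ((hasDerivAt_id s).const_mul (Q.mu ^ 2)).const_add (Q.lyap n)
    refine (h1.exp.mul h2).congr_deriv ?_
    ring
  have hc := Q.superSol_continuous n
  have hcont : Continuous fun s : ℝ => Real.exp (-(t - s) * Q.exitRate n) *
      (Q.exitRate n * Q.superSol s n + Q.mu ^ 2) := by fun_prop
  have hint := intervalIntegral.integral_eq_sub_of_hasDerivAt hd (hcont.intervalIntegrable _ _)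
  have hle' : Q.diagDuh Q.superSol t n ≤ ∫ s in (0 : ℝ)..t,
      Real.exp (-(t - s) * Q.exitRate n) * (Q.exitRate n * Q.superSol s n + Q.mu ^ 2) := by
    refine intervalIntegral.integral_mono_on ht
      ((Q.diagDuh_integrand_continuous Q.superSol_continuous t n).intervalIntegrable _ _)
      (hcont.intervalIntegrable _ _) fun s hs => ?_
    refine mul_le_mul_of_nonneg_left ?_ (Real.exp_nonneg _)
    have h := Q.lyap_drift hle n
    simp only [superSol, exitRate] at h ⊢
    nlinarith
  rw [hint] at hle'
  have h0 : 0 ≤ Real.exp (-(t - 0) * Q.exitRate n) * Q.superSol 0 n := by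
    refine mul_nonneg (Real.exp_nonneg _) ?_
    simpa [superSol] using Q.lyap_nonneg n
  have h1 : Real.exp (-(t - t) * Q.exitRate n) * Q.superSol t n = Q.superSol t n := by simp
  linarith

lemma jumpProb_continuous (k n : ℕ) : Continuous fun s => Q.jumpProb k s n :=
  Complex.continuous_re.comp (Q.jumps_continuous idm k n n)

/-- For `N = 0` the constant `1` is bounded by the first term at states below `m` and by the second
at states above. Each application of `diagDuh` turns `N`-jump probabilities into `(N+1)`-jump
probabilities and does not increase the supersolution, so `C` is independent of `N`. -/
lemma rem_le (hle : Q.lam ≤ Q.mu) (T : ℝ) {m : ℕ} (hm : 0 < Q.lyap m) :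
    ∃ C : ℝ, ∀ N, ∀ t ∈ Set.Icc 0 T, ∀ n,
      (Q.rem N t n n).re ≤ C * Q.jumpProb N t n + (Q.lyap m)⁻¹ * Q.superSol t n := by
  have hq : ∀ n, 0 ≤ Q.exitRate n := fun n => by
    have h1 := Q.omega_nonneg n
    have h2 := Q.omega_nonneg (n + 1)
    unfold exitRate
    positivity
  -- Large enough to beat the probability `exp (-t q_i)` of no jump for every `i < m` and `t ≤ T`.
  refine ⟨∑ i ∈ Finset.range m, Real.exp (T * Q.exitRate i), fun N => ?_⟩
  induction N with
  | zero =>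
    intro t ht n
    have h1 : (Q.rem 0 t n n).re = 1 := by simp [rem, idm]
    have h2 : Q.jumpProb 0 t n = Real.exp (-t * Q.exitRate n) := by
      rw [jumpProb, jumps, free, idm, if_pos rfl, mul_one, kap_diag, ← Complex.ofReal_neg,
        ← Complex.ofReal_mul, ← Complex.ofReal_exp, Complex.ofReal_re]
    rw [h1, h2]
    have hW : 0 ≤ (Q.lyap m)⁻¹ * Q.superSol t n := by
      have h3 := Q.lyap_nonneg n
      have h4 := ht.1
      unfold superSol
      positivity
    rcases lt_or_ge n m with hn | hn
    · have h5 : Real.exp (T * Q.exitRate n) ≤ ∑ i ∈ Finset.range m, Real.exp (T * Q.exitRate i) :=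
        Finset.single_le_sum (f := fun i => Real.exp (T * Q.exitRate i))
          (fun i _ => Real.exp_nonneg _) (Finset.mem_range.2 hn)
      have h6 : 1 ≤ Real.exp (T * Q.exitRate n) * Real.exp (-t * Q.exitRate n) := by
        rw [← Real.exp_add]
        refine Real.one_le_exp ?_
        have := mul_nonneg (sub_nonneg.2 ht.2) (hq n)
        linarith
      have h7 := mul_le_mul_of_nonneg_right h5 (Real.exp_nonneg (-t * Q.exitRate n))
      linarith
    · have h5 : 1 ≤ (Q.lyap m)⁻¹ * Q.superSol t n := by
        rw [inv_mul_eq_div, one_le_div hm, superSol]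
        have := Q.lyap_mono hn
        have h4 := ht.1
        have : 0 ≤ Q.mu ^ 2 * t := by positivity
        linarith
      have h6 : 0 ≤ (∑ i ∈ Finset.range m, Real.exp (T * Q.exitRate i))
          * Real.exp (-t * Q.exitRate n) :=
        mul_nonneg (Finset.sum_nonneg fun i _ => Real.exp_nonneg _) (Real.exp_nonneg _)
      linarith
  | succ N ih =>
    intro t ht n
    rw [rem_succ, Q.re_duh_diag (Q.rem_continuous N)]
    have hjc := Q.jumpProb_continuous N
    refine (Q.diagDuh_mono (fun k => Complex.continuous_re.comp (Q.rem_continuous N k k))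
      (h := fun s k => (∑ i ∈ Finset.range m, Real.exp (T * Q.exitRate i)) * Q.jumpProb N s k
        + (Q.lyap m)⁻¹ * Q.superSol s k)
      (fun k => ((hjc k).const_mul _).add ((Q.superSol_continuous k).const_mul _)) ht.1
      (fun s hs k => ih s ⟨hs.1, hs.2.trans ht.2⟩ k) n).trans ?_
    rw [Q.diagDuh_combination hjc Q.superSol_continuous]
    have h1 : Q.diagDuh (Q.jumpProb N) t n = Q.jumpProb (N + 1) t n :=
      (Q.re_duh_diag (Q.jumps_continuous idm N) t n).symm
    rw [h1]
    have h2 := Q.diagDuh_superSol_le hle ht.1 n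
    have h3 := inv_nonneg.2 hm.le
    gcongr

/-- Non-explosion. In `rem_le`, `N → ∞` with `m` fixed removes the jump probability, a term of a
summable series; then `m → ∞` removes the rest. -/
lemma hasSum_jumpProb (hle : Q.lam ≤ Q.mu) {t : ℝ} (ht : 0 ≤ t) (n : ℕ) :
    HasSum (fun k => Q.jumpProb k t n) 1 := by
  have hs := Q.summable_jumpProb ht n
  have hrem : ∀ N, (Q.rem N t n n).re = 1 - ∑ k ∈ Finset.range N, Q.jumpProb k t n := by
    intro N
    simp [rem, idm, jumpProb]
  have h1 : ∑' k, Q.jumpProb k t n ≤ 1 := hs.tsum_le_of_sum_range_le fun M =>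
    Q.sum_jumpProb_le M ht n
  have h2 : ∀ᶠ m in atTop, 1 - ∑' k, Q.jumpProb k t n ≤ (Q.lyap m)⁻¹ * Q.superSol t n := by
    filter_upwards [Q.tendsto_lyap.eventually_gt_atTop 0] with m hm
    obtain ⟨C, hC⟩ := Q.rem_le hle t hm
    have h3 : Tendsto (fun N => C * Q.jumpProb N t n + (Q.lyap m)⁻¹ * Q.superSol t n) atTop
        (𝓝 (C * 0 + (Q.lyap m)⁻¹ * Q.superSol t n)) :=
      (hs.tendsto_atTop_zero.const_mul C).add_const _
    rw [mul_zero, zero_add] at h3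
    refine le_of_tendsto_of_tendsto' (hs.hasSum.tendsto_sum_nat.const_sub 1) h3 fun N => ?_
    rw [← hrem]
    exact hC N t ⟨ht, le_rfl⟩ n
  have h3 : Tendsto (fun m => (Q.lyap m)⁻¹ * Q.superSol t n) atTop (𝓝 (0 * Q.superSol t n)) :=
    Q.tendsto_lyap.inv_tendsto_atTop.mul_const _
  rw [zero_mul] at h3
  have h4 := ge_of_tendsto h3 h2
  have h5 : ∑' k, Q.jumpProb k t n = 1 := by linarith
  rw [← h5]
  exact hs.hasSum

lemma gain_off {A : ℕ → ℕ → ℂ} (hA : ∀ n m, n ≠ m → A n m = 0) {n m : ℕ} (h : n ≠ m) :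
    Q.gain A n m = 0 := by
  rw [gain, hA (n + 1) (m + 1) (by omega), mul_zero, add_zero]
  rcases n with _ | n
  · simp [Q.omega_zero]
  rcases m with _ | m
  · simp [Q.omega_zero]
  rw [Nat.add_sub_cancel, Nat.add_sub_cancel, hA n m (by omega), mul_zero]

lemma jumps_idm_off (k : ℕ) (t : ℝ) {n m : ℕ} (h : n ≠ m) : Q.jumps idm k t n m = 0 := by
  induction k generalizing t n m with
  | zero => rw [jumps, free, idm, if_neg h, mul_zero]
  | succ k ih =>
    rw [jumps, duh]
    simp [Q.gain_off (fun i j hij => ih _ hij) h]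

lemma evolution_one (hle : Q.lam ≤ Q.mu) (t : ℝ≥0) : Q.evolution t 1 = 1 := by
  refine op_ext fun n m => (Q.hasSum_evolution t 1 n m).unique ?_
  have h1 : mat 1 = idm := by funext i j; exact mat_one i j
  rw [h1]
  by_cases h : n = m
  · subst h
    rw [idm, if_pos rfl]
    have h2 := Complex.hasSum_ofReal (f := fun k => Q.jumpProb k t n) (x := 1) |>.2
      (Q.hasSum_jumpProb hle t.2 n)
    refine h2.congr_fun fun k => Q.jumps_idm_diag k t.2 n
  · simp only [idm, if_neg h, Q.jumps_idm_off _ _ h]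
    exact hasSum_zero

end Params

/-! ### The Lindblad equation and its matrix elements -/

lemma e_mem_domN (n k : ℕ) : e n ∈ domN k := by
  rw [mem_domN_iff, memlp_iff]
  refine summable_of_ne_finset_zero (s := {n}) fun m hm => ?_
  rw [e_apply, if_neg (by simpa using hm)]
  simp

namespace Params

variable (Q : Params)

/-- `e_n` as an element of the domain of `G`. -/
def eG (n : ℕ) : Q.G.domain := ⟨e n, e_mem_domN n 2⟩

lemma P_apply (t : ℝ≥0) (u : Hilb) (n : ℕ) : Q.P t u n = Q.semi t u n := rfl

lemma LP_apply (i : Fin 2) (t : ℝ≥0) (u : Q.G.domain) (n : ℕ) :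
    Q.LP i t u n = Q.noise i (Q.semi t (u : Hilb)) n := by
  fin_cases i <;> rfl

lemma semi_e (t : ℝ) (n : ℕ) : Q.semi t (e n : Hilb)
    = fun m => if m = n then Complex.exp (-(t : ℂ) * Q.g n) else 0 := by
  funext m
  rw [semi, e_apply]
  split_ifs with h
  · rw [h, mul_one]
  · rw [mul_zero]

lemma P_e (t : ℝ≥0) (n : ℕ) : Q.P t (e n) = Complex.exp (-(t : ℂ) * Q.g n) • e n := by
  apply lp.ext
  funext m
  rw [P_apply, semi_e]
  simp [e_apply]

lemma LP_zero_e (t : ℝ≥0) (n : ℕ) : Q.LP 0 t (Q.eG n)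
    = ((Q.mu : ℂ) * (√(omega Q.r n) : ℂ) * Complex.exp (-(t : ℂ) * Q.g n)) • e (n - 1) := by
  apply lp.ext
  funext m
  rw [LP_apply]
  simp only [eG, semi_e, noise, annihSeq, lp.coeFn_smul, Pi.smul_apply, smul_eq_mul, e_apply]
  rcases n with _ | n
  · simp [Q.omega_zero]
  · simp only [Nat.add_sub_cancel, add_left_inj]
    split_ifs with h
    · rw [h]; simp [mul_assoc]
    · simp

lemma LP_one_e (t : ℝ≥0) (n : ℕ) : Q.LP 1 t (Q.eG n)
    = ((Q.lam : ℂ) * (√(omega Q.r (n + 1)) : ℂ) * Complex.exp (-(t : ℂ) * Q.g n)) • e (n + 1) := by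
  apply lp.ext
  funext m
  rw [LP_apply]
  simp only [eG, semi_e, noise, lp.coeFn_smul, Pi.smul_apply, smul_eq_mul, e_apply]
  rcases m with _ | m
  · simp [creaSeq]
  · simp only [creaSeq, add_left_inj]
    split_ifs with h
    · rw [h]; simp [mul_assoc]
    · simp

lemma sum_inner_LP_e (t : ℝ≥0) (a : Obs) (n m : ℕ) :
    ∑ i : Fin 2, inner ℂ (Q.LP i t (Q.eG n)) (a (Q.LP i t (Q.eG m)))
      = Complex.exp (-(t : ℂ) * Q.kap n m) * Q.gain (mat a) n m := by
  rw [Fin.sum_univ_two, LP_zero_e, LP_zero_e, LP_one_e, LP_one_e]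
  simp only [map_smul, inner_smul_left, inner_smul_right, gain, mat, kap, mul_add, Complex.exp_add,
    map_mul, Complex.conj_ofReal, ← Complex.exp_conj, map_neg]
  ring

lemma _root_.QuadraticOscillator.coe_sub_toNNReal {t : ℝ≥0} {s : ℝ} (hs : s ∈ Set.Icc (0 : ℝ) t) :
    ((t - s.toNNReal : ℝ≥0) : ℝ) = t - s := by
  rw [NNReal.coe_sub (Real.toNNReal_le_iff_le_coe.2 hs.2), Real.coe_toNNReal s hs.1]

lemma isMild_of_solvesLindblad {T : ℝ≥0 → (Obs →ₗ[ℂ] Obs)} (h : SolvesLindblad Q T) (x : Obs) :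
    Q.IsMild x fun t => T t x := by
  intro t n m
  obtain ⟨hi, heq⟩ := h x t (Q.eG m) (Q.eG n)
  have ht : (0 : ℝ) ≤ t := t.2
  have hcongr : ∀ s ∈ Set.Icc (0 : ℝ) t,
      ∑ i : Fin 2, inner ℂ (Q.LP i (t - s.toNNReal) (Q.eG n))
        (T s.toNNReal x (Q.LP i (t - s.toNNReal) (Q.eG m)))
      = Complex.exp (-((t : ℂ) - s) * Q.kap n m) * Q.gain (mat (T s.toNNReal x)) n m := by
    intro s hs
    rw [sum_inner_LP_e]
    congr 3
    have := coe_sub_toNNReal hs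
    rw [← Complex.ofReal_inj, Complex.ofReal_sub] at this
    rw [← this]
  have hsum := IntervalIntegrable.sum Finset.univ fun i _ => hi i
  constructor
  · refine hsum.congr fun s hs => ?_
    rw [Set.uIoc_of_le ht] at hs
    rw [Finset.sum_apply]
    exact hcongr s ⟨hs.1.le, hs.2⟩
  · change inner ℂ (e n) (T t x (e m)) = _
    refine heq.trans ?_
    congr 1
    · change inner ℂ (Q.P t (e n)) (x (Q.P t (e m))) = _
      rw [P_e, P_e, map_smul, inner_smul_left, inner_smul_right, free, kap, mul_add,
        Complex.exp_add, mat, ← Complex.exp_conj, map_mul, map_neg]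
      have h : conj (t : ℂ) = (t : ℂ) := Complex.conj_ofReal _
      rw [h]
      ring_nf
    · rw [← intervalIntegral.integral_finsetSum fun i _ => hi i, duh]
      refine intervalIntegral.integral_congr fun s hs => ?_
      rw [Set.uIcc_of_le ht] at hs
      exact hcongr s hs

lemma norm_semi_le {t : ℝ} (ht : 0 ≤ t) (v : ℕ → ℂ) (n : ℕ) : ‖Q.semi t v n‖ ≤ ‖v n‖ :=
  Q.norm_exp_g_mul_le ⟨t, ht⟩ n (v n)

/-- `P_t` shrinks every coordinate and `L_i` only weights and shifts coordinates. The bound, uniform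
in time, supplies the dominating constant for the Lindblad integrals. -/
lemma norm_LP_le (i : Fin 2) (t : ℝ≥0) (u : Q.G.domain) : ‖Q.LP i t u‖ ≤ ‖Q.LP i 0 u‖ := by
  refine lp.norm_mono (by norm_num) fun n => ?_
  rw [LP_apply, LP_apply]
  have h : ∀ k, ‖Q.semi t (u : Hilb) k‖ ≤ ‖Q.semi (0 : ℝ≥0) (u : Hilb) k‖ := by
    intro k
    refine (Q.norm_semi_le t.2 _ k).trans (le_of_eq ?_)
    simp [semi]
  fin_cases i
  · simp only [noise, annihSeq, norm_mul]
    gcongr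
    exact h _
  · rcases n with _ | n
    · simp [noise, creaSeq]
    · simp only [noise, creaSeq, norm_mul]
      gcongr
      exact h _

lemma norm_form_LP_le {a : Obs} {C : ℝ} (ha : ‖a‖ ≤ C) (N : ℕ) (i : Fin 2) (t : ℝ≥0)
    (u v : Q.G.domain) : ‖form N (mat a) (Q.LP i t v) (Q.LP i t u)‖
      ≤ ‖Q.LP i 0 v‖ * (C * ‖Q.LP i 0 u‖) := by
  rw [← inner_trunc]
  refine (norm_inner_le_norm _ _).trans ?_
  gcongr
  · exact (norm_trunc_le _ _).trans (Q.norm_LP_le i t v)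
  · refine (a.le_of_opNorm_le ha _).trans ?_
    have hC : 0 ≤ C := (norm_nonneg _).trans ha
    gcongr
    exact (norm_trunc_le _ _).trans (Q.norm_LP_le i t u)

/-- Summing the entry equations gives the Lindblad equation on finite sections; the sections exhaust
the vectors and the integrals converge by domination. -/
lemma lindblad_of_isMild {x : Obs} {F : ℝ≥0 → Obs} (h : Q.IsMild x F) {C : ℝ}
    (hC : ∀ t, ‖F t‖ ≤ C) (t : ℝ≥0) (u v : Q.G.domain) :
    (∀ i : Fin 2, IntervalIntegrable
      (fun s : ℝ => inner ℂ (Q.LP i (t - s.toNNReal) v)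
        (F s.toNNReal (Q.LP i (t - s.toNNReal) u))) MeasureTheory.volume 0 t) ∧
    inner ℂ (v : Hilb) (F t (u : Hilb)) =
      inner ℂ (Q.P t v) (x (Q.P t u)) +
        ∑ i : Fin 2, ∫ s in (0 : ℝ)..t,
          inner ℂ (Q.LP i (t - s.toNNReal) v) (F s.toNNReal (Q.LP i (t - s.toNNReal) u)) := by
  have ht : (0 : ℝ) ≤ t := t.2
  have hFc := h.entryCont
  let φ : Fin 2 → ℕ → ℝ → ℂ := fun i N s => form N (mat (F s.toNNReal))
    (Q.noise i (Q.semi (t - s) (v : Hilb))) (Q.noise i (Q.semi (t - s) (u : Hilb)))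
  have hφc : ∀ i N, Continuous (φ i N) := fun i N => form_continuous N hFc
    (Q.noise_continuous (Q.semi_continuous t (v : Hilb)) i)
    (Q.noise_continuous (Q.semi_continuous t (u : Hilb)) i)
  have hφ : ∀ i N, ∀ s ∈ Set.Icc (0 : ℝ) t, φ i N s = form N (mat (F s.toNNReal))
      (Q.LP i (t - s.toNNReal) v) (Q.LP i (t - s.toNNReal) u) := by
    intro i N s hs
    refine form_congr (fun _ _ _ _ => rfl) ?_ ?_ <;>
    · intro n _
      rw [LP_apply, coe_sub_toNNReal hs]
  have hφlim : ∀ i, ∀ s ∈ Set.Icc (0 : ℝ) t, Tendsto (fun N => φ i N s) atTop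
      (𝓝 (inner ℂ (Q.LP i (t - s.toNNReal) v) (F s.toNNReal (Q.LP i (t - s.toNNReal) u)))) := by
    intro i s hs
    simp_rw [fun N => hφ i N s hs]
    exact tendsto_form _ _ _
  have hφbd : ∀ i N, ∀ s ∈ Set.Icc (0 : ℝ) t, ‖φ i N s‖ ≤ ‖Q.LP i 0 v‖ * (C * ‖Q.LP i 0 u‖) := by
    intro i N s hs
    rw [hφ i N s hs]
    exact Q.norm_form_LP_le (hC _) N i _ u v
  have hmem : ∀ᵐ s ∂(MeasureTheory.volume.restrict (Set.uIoc (0 : ℝ) t)),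
      s ∈ Set.Icc (0 : ℝ) t := by
    rw [Set.uIoc_of_le ht]
    filter_upwards [MeasureTheory.ae_restrict_mem measurableSet_Ioc] with s hs
      using Set.Ioc_subset_Icc_self hs
  have hint : ∀ i : Fin 2, IntervalIntegrable
      (fun s : ℝ => inner ℂ (Q.LP i (t - s.toNNReal) v)
        (F s.toNNReal (Q.LP i (t - s.toNNReal) u))) MeasureTheory.volume 0 t := by
    intro i
    refine (intervalIntegrable_const (c := ‖Q.LP i 0 v‖ * (C * ‖Q.LP i 0 u‖))).mono_fun' ?_ ?_
    · refine aestronglyMeasurable_of_tendsto_ae atTop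
        (fun N => (hφc i N).aestronglyMeasurable) ?_
      filter_upwards [hmem] with s hs using hφlim i s hs
    · filter_upwards [hmem] with s hs using
        le_of_tendsto' (hφlim i s hs).norm fun N => hφbd i N s hs
  have hintlim : ∀ i : Fin 2, Tendsto (fun N => ∫ s in (0 : ℝ)..t, φ i N s) atTop
      (𝓝 (∫ s in (0 : ℝ)..t, inner ℂ (Q.LP i (t - s.toNNReal) v)
        (F s.toNNReal (Q.LP i (t - s.toNNReal) u)))) := by
    intro i
    refine intervalIntegral.tendsto_integral_filter_of_dominated_convergence
      (fun _ => ‖Q.LP i 0 v‖ * (C * ‖Q.LP i 0 u‖))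
      (Eventually.of_forall fun N => (hφc i N).aestronglyMeasurable)
      (Eventually.of_forall fun N => ?_) intervalIntegrable_const ?_
    · rw [← MeasureTheory.ae_restrict_iff' measurableSet_uIoc]
      filter_upwards [hmem] with s hs using hφbd i N s hs
    · rw [← MeasureTheory.ae_restrict_iff' measurableSet_uIoc]
      filter_upwards [hmem] with s hs using hφlim i s hs
  refine ⟨hint, ?_⟩
  have heq : ∀ N, form (N + 1) (mat (F t)) (v : Hilb) (u : Hilb)
      = form (N + 1) (mat x) (Q.P t v) (Q.P t u)
        + ((∫ s in (0 : ℝ)..t, φ 0 N s) + ∫ s in (0 : ℝ)..t, φ 1 (N + 2) s) := by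
    intro N
    rw [← intervalIntegral.integral_add ((hφc 0 N).intervalIntegrable _ _)
      ((hφc 1 (N + 2)).intervalIntegrable _ _)]
    have h1 : ∫ s in (0 : ℝ)..t, (φ 0 N s + φ 1 (N + 2) s)
        = form (N + 1) (Q.duh (fun s => mat (F s.toNNReal)) t) (v : Hilb) (u : Hilb) :=
      (Q.form_duh N hFc t _ _).symm
    have h2 : form (N + 1) (mat x) (Q.P t v) (Q.P t u)
        = form (N + 1) (Q.free (mat x) t) (v : Hilb) (u : Hilb) := (Q.form_free _ _ _ _ _).symm
    rw [h1, h2]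
    simp only [form, ← Finset.sum_add_distrib]
    refine Finset.sum_congr rfl fun n _ => Finset.sum_congr rfl fun m _ => ?_
    rw [(h t n m).2]
    ring
  rw [Fin.sum_univ_two]
  refine tendsto_nhds_unique ((tendsto_form (F t) v u).comp (tendsto_add_atTop_nat 1)) ?_
  refine Tendsto.congr (fun N => (heq N).symm) ?_
  exact ((tendsto_form x _ _).comp (tendsto_add_atTop_nat 1)).add
    ((hintlim 0).add ((hintlim 1).comp (tendsto_add_atTop_nat 2)))

lemma evolution_solvesLindblad : SolvesLindblad Q Q.evolution := fun x t u v =>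
  Q.lindblad_of_isMild (Q.evolution_isMild x) (fun t => Q.norm_evolution_le t x) t u v

end Params

/-! ### Minimality, the semigroup property and normality -/

lemma le_norm_smul_one {H : Type*} [NormedAddCommGroup H] [InnerProductSpace ℂ H] [CompleteSpace H]
    {x : H →L[ℂ] H} (h : 0 ≤ x) : x ≤ (‖x‖ : ℂ) • (1 : H →L[ℂ] H) := by
  have h1 := IsSelfAdjoint.le_algebraMap_norm_self (a := x) (IsSelfAdjoint.of_nonneg h)
  rwa [Algebra.algebraMap_eq_smul_one, ← Complex.coe_smul] at h1

/-- The hypothesis at the positive operator `‖x‖ • 1 - x` is the reverse inequality at `x`. -/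
lemma eq_of_le_of_map_one {f g : Obs →ₗ[ℂ] Obs} (hle : ∀ x, 0 ≤ x → f x ≤ g x)
    (h1 : f 1 = g 1) : f = g := by
  refine map_ext_nonneg fun x hx => le_antisymm (hle x hx) ?_
  have h := hle ((‖x‖ : ℂ) • 1 - x) (sub_nonneg.2 (le_norm_smul_one hx))
  rw [map_sub, map_sub, map_smul, map_smul, h1] at h
  exact (sub_le_sub_iff_left _).1 h

namespace Params

variable (Q : Params)

/-- Subtracting the recursion for the partial sums `S M` from the equation for `F` cancels the free
terms: `F - S (M+1)` is the Duhamel integral of `F - S M`. It stays positive by induction from `F ≥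
0`. -/
lemma evolution_le_of_isMild {x : Obs} {F : ℝ≥0 → Obs} (hF : ∀ t, 0 ≤ F t) (h : Q.IsMild x F)
    (t : ℝ≥0) : Q.evolution t x ≤ F t := by
  have hFc := h.entryCont
  set S : ℕ → ℝ → ℕ → ℕ → ℂ := fun M s n m => ∑ k ∈ Finset.range M, Q.jumps (mat x) k s n m with hS
  have hSc : ∀ M, EntryCont (S M) := fun M => Q.sum_jumps_continuous (mat x) M
  have key : ∀ M, FormPos t fun s n m => mat (F s.toNNReal) n m - S M s n m := by
    intro M
    induction M with
    | zero =>
      intro s _ N w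
      simpa [hS] using! form_nonneg (hF s.toNNReal) N w
    | succ M ih =>
      have hstep := Q.FormPos_duh (F := fun s n m => mat (F s.toNNReal) n m - S M s n m) (fun n m => (hFc n m).sub (hSc M n m)) ih
      intro s hs N w
      refine (hstep s hs N w).trans_eq (form_congr (fun n m _ _ => ?_) (fun _ _ => rfl)
        fun _ _ => rfl)
      rw [Q.duh_sub hFc (hSc M)]
      beta_reduce
      rw [(h s.toNNReal n m).2, Real.coe_toNNReal s hs.1]
      simp only [hS, sum_jumps_succ]
      ring
  rw [← sub_nonneg]
  refine nonneg_of_form fun N w => ?_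
  have h1 : form N (mat (F t - Q.evolution t x)) w w
      = form N (mat (F t)) w w - form N (mat (Q.evolution t x)) w w := by
    rw [← form_sub]
    exact form_congr (fun n m _ _ => mat_sub _ _ _ _) (fun _ _ => rfl) fun _ _ => rfl
  rw [h1]
  refine ge_of_tendsto' ((hasSum_form (Q.hasSum_evolution t x) N w w).tendsto_sum_nat.const_sub
    (form N (mat (F t)) w w)) fun M => ?_
  have h2 := key M t ⟨t.2, le_rfl⟩ N w
  rwa [form_sub, form_sum, Real.toNNReal_coe] at h2

lemma evolution_zero : Q.evolution 0 = LinearMap.id := by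
  refine LinearMap.ext fun x => op_ext fun n m => ?_
  rw [(Q.evolution_isMild x 0 n m).2, free, duh]
  simp

/-- Follow the evolution of `x` up to time `t₀` and restart from its value there. -/
def restart (t₀ : ℝ≥0) (x : Obs) (t : ℝ≥0) : Obs :=
  if t ≤ t₀ then Q.evolution t x else Q.evolution (t - t₀) (Q.evolution t₀ x)

/-- For `t ≥ t₀` the integral splits at `t₀`: the free term together with the first piece is the
free evolution of `y` over time `t - t₀`, and a translation turns the second piece into the Duhamel
term of `y`. -/
lemma restart_isMild (t₀ : ℝ≥0) (x : Obs) : Q.IsMild x (Q.restart t₀ x) := by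
  intro t n m
  set y := Q.evolution t₀ x with hy
  have hA := (Q.evolution_isMild x).entryCont
  have hB := (Q.evolution_isMild y).entryCont
  have ht : (0 : ℝ) ≤ t := t.2
  have ht₀ : (0 : ℝ) ≤ t₀ := t₀.2
  set f₁ : ℝ → ℂ := fun s => Complex.exp (-((t : ℂ) - s) * Q.kap n m) *
      Q.gain (mat (Q.evolution s.toNNReal x)) n m with hf₁
  set f₂ : ℝ → ℂ := fun s => Complex.exp (-((t : ℂ) - s) * Q.kap n m) *
      Q.gain (mat (Q.evolution (s - t₀).toNNReal y)) n m with hf₂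
  have hf₁c : Continuous f₁ := Q.duh_integrand_continuous hA t n m
  have hf₂c : Continuous f₂ := Q.duh_integrand_continuous
    (F := fun s => mat (Q.evolution (s - t₀).toNNReal y))
    (fun i j => (hB i j).comp (continuous_id.sub continuous_const)) t n m
  have h₁ : ∀ s : ℝ, s ≤ t₀ → Q.restart t₀ x s.toNNReal = Q.evolution s.toNNReal x := by
    intro s hs
    rw [restart, if_pos (Real.toNNReal_le_iff_le_coe.2 hs)]
  have h₂ : ∀ s : ℝ, (t₀ : ℝ) ≤ s →
      Q.restart t₀ x s.toNNReal = Q.evolution (s - t₀).toNNReal y := by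
    intro s hs
    rcases hs.eq_or_lt with rfl | hs
    · simp [restart, evolution_zero, hy]
    · rw [restart, if_neg (by rw [Real.toNNReal_le_iff_le_coe]; exact not_le.2 hs),
        NNReal.sub_def, Real.coe_toNNReal s (ht₀.trans hs.le)]
  have e₁ : ∀ s : ℝ, s ≤ t₀ → f₁ s = Complex.exp (-((t : ℂ) - s) * Q.kap n m) *
      Q.gain (mat (Q.restart t₀ x s.toNNReal)) n m := fun s hs => by rw [h₁ s hs]
  have e₂ : ∀ s : ℝ, (t₀ : ℝ) ≤ s → f₂ s = Complex.exp (-((t : ℂ) - s) * Q.kap n m) *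
      Q.gain (mat (Q.restart t₀ x s.toNNReal)) n m := fun s hs => by rw [h₂ s hs]
  rcases le_total t t₀ with h | h
  · have h' : (t : ℝ) ≤ t₀ := h
    constructor
    · refine (hf₁c.intervalIntegrable 0 t).congr fun s hs => ?_
      rw [Set.uIoc_of_le ht] at hs
      exact e₁ s (hs.2.trans h')
    · rw [restart, if_pos h, (Q.evolution_isMild x t n m).2]
      congr 1
      refine intervalIntegral.integral_congr fun s hs => ?_
      rw [Set.uIcc_of_le ht] at hs
      exact e₁ s (hs.2.trans h')
  · have h' : (t₀ : ℝ) ≤ t := h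
    have i₁ : IntervalIntegrable (fun s : ℝ => Complex.exp (-((t : ℂ) - s) * Q.kap n m) *
        Q.gain (mat (Q.restart t₀ x s.toNNReal)) n m) MeasureTheory.volume 0 t₀ := by
      refine (hf₁c.intervalIntegrable 0 t₀).congr fun s hs => ?_
      rw [Set.uIoc_of_le ht₀] at hs
      exact e₁ s hs.2
    have i₂ : IntervalIntegrable (fun s : ℝ => Complex.exp (-((t : ℂ) - s) * Q.kap n m) *
        Q.gain (mat (Q.restart t₀ x s.toNNReal)) n m) MeasureTheory.volume t₀ t := by
      refine (hf₂c.intervalIntegrable t₀ t).congr fun s hs => ?_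
      rw [Set.uIoc_of_le h'] at hs
      exact e₂ s hs.1.le
    refine ⟨i₁.trans i₂, ?_⟩
    have hval : Q.restart t₀ x t = Q.evolution (t - t₀) y := by
      have := h₂ t h'
      rwa [Real.toNNReal_coe, ← NNReal.sub_def] at this
    rw [hval, (Q.evolution_isMild y (t - t₀) n m).2, duh, duh,
      ← intervalIntegral.integral_add_adjacent_intervals i₁ i₂, ← add_assoc, NNReal.coe_sub h]
    congr 1
    · rw [free, (Q.evolution_isMild x t₀ n m).2, mul_add, free, free, duh, ← mul_assoc,
        ← Complex.exp_add, ← intervalIntegral.integral_const_mul]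
      congr 1
      · congr 2
        push_cast
        ring
      · refine intervalIntegral.integral_congr fun s hs => ?_
        rw [Set.uIcc_of_le ht₀] at hs
        simp only
        rw [h₁ s hs.2, ← mul_assoc, ← Complex.exp_add]
        congr 2
        push_cast
        ring
    · have hsub := intervalIntegral.integral_comp_sub_right (a := (t₀ : ℝ)) (b := t)
        (fun s : ℝ => Complex.exp (-(((t - t₀ : ℝ) : ℂ) - s) * Q.kap n m) *
          Q.gain (mat (Q.evolution s.toNNReal y)) n m) (t₀ : ℝ)
      rw [sub_self] at hsub
      rw [← hsub]
      refine intervalIntegral.integral_congr fun s hs => ?_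
      rw [Set.uIcc_of_le h'] at hs
      rw [h₂ s hs.1]
      congr 2
      push_cast
      ring

/-- Minimality against the restarted solution gives one inequality; conservativity, through
`eq_of_le_of_map_one`, upgrades it to equality. -/
lemma evolution_add (hle : Q.lam ≤ Q.mu) (s t : ℝ≥0) :
    Q.evolution (s + t) = Q.evolution s ∘ₗ Q.evolution t := by
  refine eq_of_le_of_map_one (fun x hx => ?_) ?_
  · have h := Q.evolution_le_of_isMild (F := Q.restart t x) (fun τ => ?_)
      (Q.restart_isMild t x) (s + t)
    · refine h.trans_eq ?_
      rw [restart, LinearMap.comp_apply]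
      split_ifs with h1
      · have hs : s = 0 := by simpa using h1
        rw [hs, zero_add, evolution_zero]; rfl
      · rw [add_tsub_cancel_right]
    · rw [restart]
      split_ifs
      · exact Q.evolution_nonneg _ hx
      · exact Q.evolution_nonneg _ (Q.evolution_nonneg _ hx)
  · rw [LinearMap.comp_apply, Q.evolution_one hle, Q.evolution_one hle, Q.evolution_one hle]

lemma evolution_continuous (x : Obs) (u v : Hilb) :
    Continuous fun t => inner ℂ v (Q.evolution t x u) := by
  refine continuous_iff_continuousAt.2 fun t => ?_
  exact tendsto_inner_of_mat (fun t => Q.norm_evolution_le t x)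
    (fun n m => ((Q.evolution_isMild x).continuous_mat n m).tendsto t) u v

lemma kap_re_nonneg (n m : ℕ) : 0 ≤ (Q.kap n m).re := by
  rw [kap, Complex.add_re, Complex.conj_re]
  exact add_nonneg (Q.g_re_nonneg n) (Q.g_re_nonneg m)

lemma norm_exp_kap_le {t : ℝ} (ht : 0 ≤ t) (n m : ℕ) : ‖Complex.exp (-(t : ℂ) * Q.kap n m)‖ ≤ 1 := by
  rw [Complex.norm_exp, Real.exp_le_one_iff, ← Complex.ofReal_neg, Complex.re_ofReal_mul]
  have := mul_nonneg ht (Q.kap_re_nonneg n m)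
  linarith

/-- A matrix element of a `k`-jump contribution depends on finitely many matrix elements. -/
lemma exists_jumps_bound (T : ℝ) (k n m : ℕ) : ∃ (C : ℝ) (R : ℕ), 0 ≤ C ∧
    ∀ (A : ℕ → ℕ → ℂ), ∀ s ∈ Set.Icc 0 T, ‖Q.jumps A k s n m‖
      ≤ C * ∑ i ∈ Finset.range R, ∑ j ∈ Finset.range R, ‖A i j‖ := by
  induction k generalizing n m with
  | zero =>
    refine ⟨1, n + m + 1, zero_le_one, fun A s hs => ?_⟩
    rw [jumps, free, norm_mul]
    refine mul_le_mul (Q.norm_exp_kap_le hs.1 n m) ?_ (norm_nonneg _) zero_le_one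
    refine (Finset.single_le_sum (f := fun j => ‖A n j‖) (fun j _ => norm_nonneg _)
      (Finset.mem_range.2 (show m < n + m + 1 by omega))).trans ?_
    exact Finset.single_le_sum (f := fun i => ∑ j ∈ Finset.range (n + m + 1), ‖A i j‖)
      (fun i _ => Finset.sum_nonneg fun j _ => norm_nonneg _)
      (Finset.mem_range.2 (show n < n + m + 1 by omega))
  | succ k ih =>
    obtain ⟨C₁, R₁, hC₁, h₁⟩ := ih (n - 1) (m - 1)
    obtain ⟨C₂, R₂, hC₂, h₂⟩ := ih (n + 1) (m + 1)
    set a := Q.mu ^ 2 * √(omega Q.r n) * √(omega Q.r m) with ha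
    set b := Q.lam ^ 2 * √(omega Q.r (n + 1)) * √(omega Q.r (m + 1)) with hb
    have ha0 : 0 ≤ a := by positivity
    have hb0 : 0 ≤ b := by positivity
    have hmono : ∀ (A : ℕ → ℕ → ℂ) {R R' : ℕ}, R ≤ R' →
        ∑ i ∈ Finset.range R, ∑ j ∈ Finset.range R, ‖A i j‖
          ≤ ∑ i ∈ Finset.range R', ∑ j ∈ Finset.range R', ‖A i j‖ := by
      intro A R R' hR
      refine (Finset.sum_le_sum fun i _ => Finset.sum_le_sum_of_subset_of_nonneg
        (Finset.range_mono hR) fun j _ _ => norm_nonneg _).trans ?_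
      exact Finset.sum_le_sum_of_subset_of_nonneg (Finset.range_mono hR)
        fun i _ _ => Finset.sum_nonneg fun j _ => norm_nonneg _
    refine ⟨(a * C₁ + b * C₂) * |T|, max R₁ R₂, by positivity, fun A s hs => ?_⟩
    set Z := ∑ i ∈ Finset.range (max R₁ R₂), ∑ j ∈ Finset.range (max R₁ R₂), ‖A i j‖ with hZ
    have hZ0 : 0 ≤ Z := Finset.sum_nonneg fun i _ => Finset.sum_nonneg fun j _ => norm_nonneg _
    have hbd : ∀ τ ∈ Set.uIoc 0 s, ‖Complex.exp (-((s : ℂ) - τ) * Q.kap n m) *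
        Q.gain (Q.jumps A k τ) n m‖ ≤ (a * C₁ + b * C₂) * Z := by
      intro τ hτ
      rw [Set.uIoc_of_le hs.1] at hτ
      have hτ' : τ ∈ Set.Icc 0 T := ⟨hτ.1.le, hτ.2.trans hs.2⟩
      rw [norm_mul]
      have he := Q.norm_exp_kap_le (sub_nonneg.2 hτ.2) n m
      rw [Complex.ofReal_sub] at he
      refine (mul_le_of_le_one_left (norm_nonneg _) he).trans ((norm_add_le _ _).trans ?_)
      simp only [norm_mul, norm_pow, Complex.norm_real, Real.norm_of_nonneg (Real.sqrt_nonneg _),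
        Real.norm_eq_abs, sq_abs, ← ha, ← hb, add_mul, mul_assoc a, mul_assoc b]
      gcongr
      · exact (h₁ A τ hτ').trans (by gcongr; exact hmono A (le_max_left _ _))
      · exact (h₂ A τ hτ').trans (by gcongr; exact hmono A (le_max_right _ _))
    rw [jumps, duh]
    refine (intervalIntegral.norm_integral_le_of_norm_le_const hbd).trans ?_
    rw [sub_zero, mul_right_comm]
    gcongr
    · exact hs.1
    · exact hs.2

lemma tendsto_jumps {ι : Type*} {l : Filter ι} {A : ι → ℕ → ℕ → ℂ} {B : ℕ → ℕ → ℂ}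
    (h : ∀ n m, Tendsto (fun i => A i n m) l (𝓝 (B n m))) (k : ℕ) {t : ℝ} (ht : 0 ≤ t) (n m : ℕ) :
    Tendsto (fun i => Q.jumps (A i) k t n m) l (𝓝 (Q.jumps B k t n m)) := by
  obtain ⟨C, R, -, hC⟩ := Q.exists_jumps_bound t k n m
  rw [tendsto_iff_norm_sub_tendsto_zero]
  have h0 : Tendsto (fun i => C * ∑ p ∈ Finset.range R, ∑ q ∈ Finset.range R, ‖A i p q - B p q‖)
      l (𝓝 (C * ∑ p ∈ Finset.range R, ∑ q ∈ Finset.range R, 0)) :=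
    (tendsto_finsetSum _ fun p _ => tendsto_finsetSum _ fun q _ =>
      tendsto_iff_norm_sub_tendsto_zero.1 (h p q)).const_mul C
  simp only [Finset.sum_const_zero, mul_zero] at h0
  refine squeeze_zero (fun _ => norm_nonneg _) (fun i => ?_) h0
  have h1 : Q.jumps (A i) k t n m - Q.jumps B k t n m
      = Q.jumps (fun p q => A i p q - B p q) k t n m := by
    have h2 := Q.jumps_add (fun p q => A i p q - B p q) B k t n m
    simp only [sub_add_cancel] at h2
    rw [h2, add_sub_cancel_right]
  rw [h1]
  exact hC _ t ⟨ht, le_rfl⟩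

lemma evolution_mono (t : ℝ≥0) {x y : Obs} (h : x ≤ y) : Q.evolution t x ≤ Q.evolution t y := by
  rw [← sub_nonneg, ← map_sub]
  exact Q.evolution_nonneg t (sub_nonneg.2 h)

/-- An ultrafilter on `S` converges weakly to the supremum. Each jump term depends on finitely many
entries, and the series is dominated by `‖x‖` times jump probabilities, so the evolved operators
converge weakly to the evolution of `x`, which any upper bound of the image must dominate. -/
lemma evolution_normal (t : ℝ≥0) (S : Set Obs) (x : Obs) (hne : S.Nonempty)
    (hpos : ∀ y ∈ S, 0 ≤ y) (hdir : DirectedOn (· ≤ ·) S) (hx : IsLUB S x) :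
    IsLUB (Q.evolution t '' S) (Q.evolution t x) := by
  obtain ⟨U, hU⟩ := exists_ultrafilter_of_isLUB hne hpos hdir hx
  have hnorm : ∀ y : S, ‖(y : Obs)‖ ≤ ‖x‖ := fun y =>
    CStarAlgebra.norm_le_norm_of_nonneg_of_le (hpos y y.2) (hx.1 y.2)
  have hmat : ∀ n m, Tendsto (fun y : S => mat (Q.evolution t y) n m) U
      (𝓝 (mat (Q.evolution t x) n m)) := by
    intro n m
    simp_rw [fun y : S => (Q.hasSum_evolution t y n m).tsum_eq.symm,
      (Q.hasSum_evolution t x n m).tsum_eq.symm]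
    refine tendsto_tsum_of_dominated_convergence
      ((((Q.summable_jumpProb t.2 n).add (Q.summable_jumpProb t.2 m)).mul_left ‖x‖).div_const 2)
      (fun k => Q.tendsto_jumps (fun i j => hU (e j) (e i)) k t.2 n m)
      (Eventually.of_forall fun y k => (Q.norm_jumps_le y k t.2 n m).trans ?_)
    have h1 := Q.jumpProb_nonneg k t.2 n
    have h2 := Q.jumpProb_nonneg k t.2 m
    gcongr
    exact hnorm y
  constructor
  · rintro _ ⟨y, hy, rfl⟩
    exact Q.evolution_mono t (hx.1 hy)
  · intro b hb
    rw [le_iff]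
    intro u
    refine le_of_tendsto' (tendsto_inner_of_mat
      (fun y : S => (Q.norm_evolution_le t y).trans (hnorm y)) hmat u u) fun y => ?_
    exact (le_iff _ _).1 (hb ⟨y, y.2, rfl⟩) u

lemma evolution_isQDS (hle : Q.lam ≤ Q.mu) : IsQDS Q.evolution where
  map_zero := Q.evolution_zero
  map_comp := Q.evolution_add hle
  completely_positive := Q.evolution_completely_positive
  contractive t := (Q.evolution_one hle t).le
  normal := Q.evolution_normal
  continuous := Q.evolution_continuous

lemma evolution_isMinimalQDS (hle : Q.lam ≤ Q.mu) : IsMinimalQDS Q Q.evolution where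
  isQDS := Q.evolution_isQDS hle
  solves := Q.evolution_solvesLindblad
  minimal T' hpos hT' t x hx := Q.evolution_le_of_isMild (F := fun t => T' t x)
    (fun t => hpos t x hx) (Q.isMild_of_solvesLindblad hT' x) t

lemma eq_evolution_of_isMinimalQDS (hle : Q.lam ≤ Q.mu) {T : ℝ≥0 → (Obs →ₗ[ℂ] Obs)}
    (hT : IsMinimalQDS Q T) : T = Q.evolution := by
  funext t
  refine map_ext_nonneg fun x hx => le_antisymm ?_ ?_
  · exact hT.minimal _ (fun t x hx => Q.evolution_nonneg t hx) Q.evolution_solvesLindblad t x hx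
  · exact (Q.evolution_isMinimalQDS hle).minimal T (fun t x hx =>
      nonneg_map_of_completely_positive (hT.isQDS.completely_positive t) hx) hT.solves t x hx

end Params

/-! ### Irreducibility -/

lemma inner_proj {q : Obs} (hq : IsStarProjection q) (u : Hilb) :
    inner ℂ u (q u) = ((‖q u‖ ^ 2 : ℝ) : ℂ) := by
  have h1 : q (q u) = q u := congr($(hq.isIdempotentElem.eq) u)
  have h2 : inner ℂ u (q (q u)) = inner ℂ (q u) (q u) := by
    rw [← ContinuousLinearMap.adjoint_inner_left, ← ContinuousLinearMap.star_eq_adjoint,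
      hq.isSelfAdjoint.star_eq]
  rw [h1] at h2
  rw [h2, inner_self_eq_norm_sq_to_K]
  norm_cast

lemma proj_apply_eq_zero {q : Obs} (hq : IsStarProjection q) {u : Hilb}
    (h : inner ℂ u (q u) ≤ 0) : q u = 0 := by
  rw [inner_proj hq, ← Complex.ofReal_zero, Complex.real_le_real] at h
  have := sq_nonneg ‖q u‖
  have h2 : ‖q u‖ ^ 2 = 0 := le_antisymm h this
  simpa using h2

namespace Params

variable (Q : Params)

lemma form_jumps_nonneg {x : Obs} (hx : 0 ≤ x) (k : ℕ) (t : ℝ≥0) (N : ℕ) (w : ℕ → ℂ) :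
    0 ≤ form N (Q.jumps (mat x) k t) w w :=
  Q.FormPos_jumps t (fun N w => form_nonneg hx N w) k t ⟨t.2, le_rfl⟩ N w

lemma form_jumps_le_form_evolution {x : Obs} (hx : 0 ≤ x) (k : ℕ) (t : ℝ≥0) (N : ℕ) (w : ℕ → ℂ) :
    form N (Q.jumps (mat x) k t) w w ≤ form N (mat (Q.evolution t x)) w w :=
  le_hasSum (hasSum_form (Q.hasSum_evolution t x) N w w) k
    fun j _ => Q.form_jumps_nonneg hx j t N w

/-- The left side is the zero-jump term of a series of nonnegative terms. -/
lemma inner_P_le {x : Obs} (hx : 0 ≤ x) (t : ℝ≥0) (u : Hilb) :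
    inner ℂ (Q.P t u) (x (Q.P t u)) ≤ inner ℂ u (Q.evolution t x u) := by
  refine le_of_tendsto_of_tendsto' (tendsto_form x _ _) (tendsto_form (Q.evolution t x) _ _)
    fun N => ?_
  refine le_trans (le_of_eq ?_) (Q.form_jumps_le_form_evolution hx 0 t N u)
  exact (Q.form_free N (mat x) t u u).symm

lemma diag_jumps_le {x : Obs} (hx : 0 ≤ x) (k : ℕ) (t : ℝ≥0) (n : ℕ) :
    Q.jumps (mat x) k t n n ≤ mat (Q.evolution t x) n n := by
  have h := Q.form_jumps_le_form_evolution hx k t (n + 1) (Pi.single n 1)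
  rwa [form_pi_single _ n.lt_succ_self n.lt_succ_self,
    form_pi_single _ n.lt_succ_self n.lt_succ_self] at h

/-- The increment is `2n + r`, positive because `r > 0`. -/
lemma omega_strictMono : StrictMono (omega Q.r) := by
  refine strictMono_nat_of_lt_succ fun n => ?_
  have := Q.r_pos
  simp only [omega]
  push_cast
  have : (0 : ℝ) ≤ n := Nat.cast_nonneg n
  nlinarith

lemma omega_pos {n : ℕ} (hn : n ≠ 0) : 0 < omega Q.r n := by
  have := Q.omega_strictMono (Nat.pos_of_ne_zero hn)
  rwa [omega_zero] at this

lemma exitRate_strictMono : StrictMono Q.exitRate := by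
  intro n m h
  have h1 := Q.omega_strictMono h
  have h2 := Q.omega_strictMono (Nat.succ_lt_succ h)
  have := Q.lam_pos
  have := Q.mu_pos
  unfold exitRate
  gcongr

lemma g_re (n : ℕ) : (Q.g n).re = Q.exitRate n / 2 := by
  have h := Q.kap_diag n
  rw [kap, add_comm, Complex.add_conj, Complex.ofReal_inj] at h
  linarith

/-- A positive operator whose evolution vanishes at `e_n` vanishes at the neighbours of `e_n`. -/
lemma diag_eq_zero_of_evolution {x : Obs} (hx : 0 ≤ x) {n : ℕ}
    (h : ∀ t, mat (Q.evolution t x) n n = 0) :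
    mat x (n + 1) (n + 1) = 0 ∧ (n ≠ 0 → mat x (n - 1) (n - 1) = 0) := by
  have hd : ∀ k, 0 ≤ mat x k k := fun k => (nonneg_iff x).1 hx (e k)
  have hf : ∀ s k, (Q.free (mat x) s k k).re = Real.exp (-s * Q.exitRate k) * (mat x k k).re := by
    intro s k
    rw [free, kap_diag, ← Complex.re_ofReal_mul]
    push_cast
    rfl
  -- If a neighbouring diagonal entry were positive, the one-jump term at time `1` would integrate a
  -- strictly positive function, yet it is bounded by the vanishing entry of the evolution.
  by_contra hcon
  have hpos : ∀ s, 0 < Real.exp (-(1 - s) * Q.exitRate n) *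
      (Q.mu ^ 2 * omega Q.r n * (Q.free (mat x) s (n - 1) (n - 1)).re
        + Q.lam ^ 2 * omega Q.r (n + 1) * (Q.free (mat x) s (n + 1) (n + 1)).re) := by
    intro s
    have h1 := Q.omega_nonneg n
    have h2 := Q.omega_pos (n.succ_ne_zero)
    have h3 := (Complex.nonneg_iff.1 (hd (n - 1))).1
    have h4 := (Complex.nonneg_iff.1 (hd (n + 1))).1
    have h5 := Q.lam_pos
    have h6 := Q.mu_pos
    refine mul_pos (Real.exp_pos _) ?_
    rw [hf, hf]
    have hne : ∀ k, mat x k k ≠ 0 → 0 < (mat x k k).re := by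
      intro k hk
      have hk' := Complex.nonneg_iff.1 (hd k)
      refine lt_of_le_of_ne hk'.1 fun h0 => hk (Complex.ext h0.symm hk'.2.symm)
    by_cases h7 : mat x (n + 1) (n + 1) = 0
    · have h8 : n ≠ 0 ∧ mat x (n - 1) (n - 1) ≠ 0 := by
        by_contra h9
        refine hcon ⟨h7, fun hn => ?_⟩
        by_contra h10
        exact h9 ⟨hn, h10⟩
      have h9 := hne _ h8.2
      have h10 := Q.omega_pos h8.1
      positivity
    · have h8 := hne _ h7
      positivity
  have h1 : 0 < (Q.jumps (mat x) 1 ((1 : ℝ≥0) : ℝ) n n).re := by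
    rw [jumps, Q.re_duh_diag (Q.jumps_continuous _ 0), diagDuh, NNReal.coe_one]
    refine intervalIntegral.intervalIntegral_pos_of_pos_on ?_ (fun s _ => hpos s) one_pos
    exact (Q.diagDuh_integrand_continuous
      (fun k => Complex.continuous_re.comp (Q.free_continuous (mat x) k k)) 1 n).intervalIntegrable
      _ _
  have h2 := (Complex.le_def.1 (Q.diag_jumps_le hx 1 1 n)).1
  rw [h] at h2
  exact absurd h1 (not_lt.2 h2)

/-- A closed subspace invariant under the diagonal semigroup contains a basis vector. -/
lemma exists_e_mem_ker {q : Obs} {u : Hilb} (hu : u ≠ 0) (h : ∀ t, q (Q.P t u) = 0) :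
    ∃ n, q (e n) = 0 := by
  classical
  have hex : ∃ n, u n ≠ 0 := by
    by_contra hcon
    push Not at hcon
    exact hu (lp.ext (funext hcon))
  set n := Nat.find hex with hn
  have hun : u n ≠ 0 := Nat.find_spec hex
  have hlt : ∀ m < n, u m = 0 := fun m hm => not_not.1 (Nat.find_min hex hm)
  refine ⟨n, ?_⟩
  set δ := (Q.g (n + 1)).re - (Q.g n).re with hδ
  have hδ0 : 0 < δ := by
    have := Q.exitRate_strictMono n.lt_succ_self
    rw [hδ, g_re, g_re]
    linarith
  -- With `n` the first nonzero coordinate of `u`, the factor `exp (t g_n)` freezes that coordinate,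
  -- while all later ones still decay at rate at least the gap `δ`.
  have hbound : ∀ t : ℝ≥0, ‖Complex.exp ((t : ℂ) * Q.g n) • Q.P t u - u n • e n‖
      ≤ Real.exp (-t * δ) * ‖u‖ := by
    intro t
    have h1 : ‖Complex.exp ((t : ℂ) * Q.g n) • Q.P t u - u n • e n‖
        ≤ ‖((Real.exp (-t * δ) : ℝ) : ℂ) • u‖ := by
      refine lp.norm_mono (by norm_num) fun m => ?_
      simp only [lp.coeFn_sub, lp.coeFn_smul, Pi.sub_apply, Pi.smul_apply, smul_eq_mul, P_apply,
        semi, e_apply]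
      rcases lt_trichotomy m n with hm | hm | hm
      · rw [hlt m hm]
        simp [hm.ne]
      · subst hm
        rw [if_pos rfl, mul_one, ← mul_assoc, ← Complex.exp_add]
        have h0 : ((t : ℝ) : ℂ) * Q.g n + -((t : ℝ) : ℂ) * Q.g n = 0 := by ring
        rw [h0, Complex.exp_zero, one_mul, sub_self, norm_zero]
        positivity
      · rw [if_neg hm.ne', mul_zero, sub_zero, ← mul_assoc, ← Complex.exp_add, norm_mul, norm_mul,
          Complex.norm_exp, Complex.norm_real, Real.norm_of_nonneg (Real.exp_nonneg _)]
        gcongr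
        have h2 : ((t : ℂ) * Q.g n + -((t : ℝ) : ℂ) * Q.g m).re
            = t * ((Q.g n).re - (Q.g m).re) := by
          rw [Complex.add_re, ← Complex.ofReal_neg, Complex.re_ofReal_mul, Complex.re_ofReal_mul]
          ring
        rw [h2]
        have h3 : (Q.g (n + 1)).re ≤ (Q.g m).re := by
          have := Q.exitRate_strictMono.monotone (Nat.succ_le_of_lt hm)
          rw [g_re, g_re]
          linarith
        have h4 := mul_le_mul_of_nonneg_left h3 t.2
        have h5 : (NNReal.toReal t) = t.1 := rfl
        rw [hδ]
        nlinarith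
    refine h1.trans_eq ?_
    rw [norm_smul, Complex.norm_real, Real.norm_of_nonneg (Real.exp_nonneg _)]
  have hq : ∀ t : ℝ≥0, ‖u n‖ * ‖q (e n)‖ ≤ ‖q‖ * (Real.exp (-t * δ) * ‖u‖) := by
    intro t
    have h1 : q (Complex.exp ((t : ℂ) * Q.g n) • Q.P t u - u n • e n) = -(u n • q (e n)) := by
      rw [map_sub, map_smul, map_smul, h t, smul_zero, zero_sub]
    have h2 := q.le_opNorm (Complex.exp ((t : ℂ) * Q.g n) • Q.P t u - u n • e n)
    rw [h1, norm_neg, norm_smul] at h2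
    exact h2.trans (by gcongr; exact hbound t)
  have hlim : Tendsto (fun t : ℝ≥0 => ‖q‖ * (Real.exp (-t * δ) * ‖u‖)) atTop
      (𝓝 (‖q‖ * (0 * ‖u‖))) := by
    refine Tendsto.const_mul _ (Tendsto.mul_const _ ?_)
    refine Real.tendsto_exp_atBot.comp ?_
    have h1 : Tendsto (fun t : ℝ≥0 => (t : ℝ) * δ) atTop atTop :=
      (NNReal.tendsto_coe_atTop.2 tendsto_id).atTop_mul_const hδ0
    simpa only [neg_mul, Function.comp_def] using! tendsto_neg_atTop_atBot.comp h1
  rw [zero_mul, mul_zero] at hlim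
  have h3 := ge_of_tendsto' hlim hq
  have h4 : ‖q (e n)‖ ≤ 0 := by
    by_contra h5
    push Not at h5
    exact absurd h3 (not_le.2 (mul_pos (norm_pos_iff.2 hun) h5))
  simpa using h4

lemma evolution_isIrreducible (hle : Q.lam ≤ Q.mu) : IsIrreducible Q.evolution := by
  intro p
  constructor
  · rintro ⟨hp, hsub⟩
    by_cases hp0 : p = 0
    · exact Or.inl hp0
    right
    have hq : IsStarProjection (1 - p) := hp.one_sub
    have hq0 : 0 ≤ 1 - p := (nonneg_iff _).2 fun u => by
      rw [inner_proj hq, Complex.zero_le_real]; positivity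
    have hker : ∀ u, (1 - p) u = 0 → ∀ t, inner ℂ u (Q.evolution t (1 - p) u) = 0 := by
      intro u hu t
      refine le_antisymm ?_ ((nonneg_iff _).1 (Q.evolution_nonneg t hq0) u)
      have h1 : Q.evolution t (1 - p) ≤ 1 - p := by
        rw [map_sub, Q.evolution_one hle]
        exact sub_le_sub_left (hsub t) 1
      have h2 := (le_iff _ _).1 h1 u
      rwa [hu, inner_zero_right] at h2
    obtain ⟨v, hv⟩ : ∃ v, p v ≠ 0 := by
      by_contra hcon
      push Not at hcon
      exact hp0 (ContinuousLinearMap.ext hcon)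
    have hpv : (1 - p) (p v) = 0 := congr($(hp.one_sub_mul_self) v)
    obtain ⟨n, hn⟩ := Q.exists_e_mem_ker (q := 1 - p) hv fun t =>
      proj_apply_eq_zero hq ((Q.inner_P_le hq0 t _).trans (hker _ hpv t).le)
    have hstep : ∀ m, (1 - p) (e m) = 0 →
        (1 - p) (e (m + 1)) = 0 ∧ (m ≠ 0 → (1 - p) (e (m - 1)) = 0) := by
      intro m hm
      obtain ⟨h1, h2⟩ := Q.diag_eq_zero_of_evolution hq0 fun t => hker _ hm t
      exact ⟨proj_apply_eq_zero hq h1.le, fun h0 => proj_apply_eq_zero hq (h2 h0).le⟩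
    -- Deaths lead from the vector found down to `e 0`; births then reach every `e m`.
    have hzero : ∀ m, (1 - p) (e m) = 0 → (1 - p) (e 0) = 0 := by
      intro m
      induction m with
      | zero => exact id
      | succ m ih => exact fun h => ih ((hstep _ h).2 m.succ_ne_zero)
    have hall : ∀ m, (1 - p) (e m) = 0 := by
      intro m
      induction m with
      | zero => exact hzero n hn
      | succ m ih => exact (hstep m ih).1
    have : (1 : Obs) - p = 0 := op_ext fun i j => by rw [mat_zero, mat, hall, inner_zero_right]
    exact (sub_eq_zero.1 this).symm
  · rintro (rfl | rfl)
    · exact ⟨.zero _, fun t => by rw [map_zero]⟩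
    · exact ⟨.one _, fun t => (Q.evolution_one hle t).ge⟩

end Params

/-! ### The geometric state -/

lemma geometricState_apply {ν : ℝ} (h0 : 0 ≤ ν) (h1 : ν < 1) (u : Hilb) (n : ℕ) :
    geometricState ν u n = ((1 - ν ^ 2) * ν ^ (2 * n) : ℝ) * u n := by
  have hν : ν ^ 2 < 1 := by nlinarith
  have hs : Summable fun n : ℕ =>
      (ν : ℂ) ^ (2 * n) • InnerProductSpace.rankOne ℂ (e n) (e n) := by
    refine Summable.of_norm_bounded (summable_geometric_of_lt_one (sq_nonneg ν) hν) fun n => ?_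
    rw [norm_smul, InnerProductSpace.norm_rankOne, norm_e, mul_one, mul_one, norm_pow,
      Complex.norm_real, Real.norm_of_nonneg h0, pow_mul]
  have h2 := hs.hasSum.mapL ((innerSL ℂ (e n)).comp (ContinuousLinearMap.apply ℂ Hilb u))
  have h3 : ∀ b, ((innerSL ℂ (e n)).comp (ContinuousLinearMap.apply ℂ Hilb u))
      ((ν : ℂ) ^ (2 * b) • InnerProductSpace.rankOne ℂ (e b) (e b))
      = if b = n then (ν : ℂ) ^ (2 * n) * u n else 0 := by
    intro b
    by_cases hb : b = n
    · subst hb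
      simp [inner_e_left, norm_e]
    · simp [inner_e_left, e_apply, hb, Ne.symm hb]
  simp_rw [h3] at h2
  have h4 : inner ℂ (e n) ((∑' n : ℕ, (ν : ℂ) ^ (2 * n) •
      InnerProductSpace.rankOne ℂ (e n) (e n)) u) = (ν : ℂ) ^ (2 * n) * u n :=
    h2.unique (hasSum_ite_eq n _)
  rw [← inner_e_left, geometricState, smul_apply, inner_smul_right, h4]
  push_cast
  ring

lemma hasSum_geometric_weights {ν : ℝ} (h0 : 0 ≤ ν) (h1 : ν < 1) :
    HasSum (fun n : ℕ => (1 - ν ^ 2) * ν ^ (2 * n)) 1 := by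
  have hν : ν ^ 2 < 1 := by nlinarith
  have h := (hasSum_geometric_of_lt_one (sq_nonneg ν) hν).mul_left (1 - ν ^ 2)
  rw [mul_inv_cancel₀ (by linarith)] at h
  simpa only [pow_mul] using h

lemma geometricState_isDensity {ν : ℝ} (h0 : 0 ≤ ν) (h1 : ν < 1) :
    IsDensity (geometricState ν) := by
  have hν : ν ^ 2 < 1 := by nlinarith
  constructor
  · rw [nonneg_iff]
    intro u
    refine (lp.hasSum_inner u (geometricState ν u)).nonneg fun n => ?_
    rw [geometricState_apply h0 h1]
    have h2 : inner ℂ (u n) ((((1 - ν ^ 2) * ν ^ (2 * n) : ℝ) : ℂ) * u n)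
        = (((1 - ν ^ 2) * ν ^ (2 * n) * ‖u n‖ ^ 2 : ℝ) : ℂ) := by
      rw [RCLike.inner_apply, mul_assoc, Complex.mul_conj, Complex.normSq_eq_norm_sq]
      push_cast
      ring
    rw [h2, Complex.zero_le_real]
    have : 0 ≤ 1 - ν ^ 2 := by linarith
    positivity
  · have h2 : ∀ n, inner ℂ (e n) (geometricState ν (e n))
        = (((1 - ν ^ 2) * ν ^ (2 * n) : ℝ) : ℂ) := by
      intro n
      rw [inner_e_left, geometricState_apply h0 h1, e_apply, if_pos rfl, mul_one]
    simp_rw [h2]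
    exact Complex.hasSum_ofReal.2 (hasSum_geometric_weights h0 h1)

lemma hasSum_tr_geometricState {ν : ℝ} (h0 : 0 ≤ ν) (h1 : ν < 1) (a : Obs) :
    HasSum (fun n => (((1 - ν ^ 2) * ν ^ (2 * n) : ℝ) : ℂ) * mat a n n)
      (tr (geometricState ν * a)) := by
  have hν : ν ^ 2 < 1 := by nlinarith
  have hs : Summable fun n => (((1 - ν ^ 2) * ν ^ (2 * n) : ℝ) : ℂ) * mat a n n := by
    refine Summable.of_norm_bounded
      (((hasSum_geometric_weights h0 h1).summable).mul_right ‖a‖) fun n => ?_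
    rw [norm_mul, Complex.norm_real, Real.norm_of_nonneg
      (mul_nonneg (by linarith) (pow_nonneg h0 _))]
    have : 0 ≤ 1 - ν ^ 2 := by linarith
    gcongr
    exact norm_mat_le a n n
  have h2 : tr (geometricState ν * a)
      = ∑' n, (((1 - ν ^ 2) * ν ^ (2 * n) : ℝ) : ℂ) * mat a n n := by
    rw [tr]
    refine tsum_congr fun n => ?_
    rw [inner_e_left, mul_apply_eq_comp, geometricState_apply h0 h1, mat_eq]
  rw [h2]
  exact hs.hasSum

namespace Params

variable (Q : Params)

/-- The mild equation in differential form: the primitive has a continuous integrand, so each entry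
is differentiable with derivative gain minus loss. -/
lemma evolution_sub_eq_integral (x : Obs) (t : ℝ≥0) (n m : ℕ) :
    mat (Q.evolution t x) n m - mat x n m = ∫ s in (0 : ℝ)..t,
      (Q.gain (mat (Q.evolution s.toNNReal x)) n m
        - Q.kap n m * mat (Q.evolution s.toNNReal x) n m) := by
  have hF := (Q.evolution_isMild x).entryCont
  have hG := Q.gain_continuous hF n m
  set G : ℝ → ℂ := fun s => Q.gain (mat (Q.evolution s.toNNReal x)) n m with hGdef
  have hI : Continuous fun s : ℝ => Complex.exp ((s : ℂ) * Q.kap n m) * G s := by fun_prop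
  -- The variation of constants formula extends the entry to all real times, so that it has a
  -- two-sided derivative at `0` too.
  set f : ℝ → ℂ := fun t => Complex.exp (-(t : ℂ) * Q.kap n m) *
    (mat x n m + ∫ s in (0 : ℝ)..t, Complex.exp ((s : ℂ) * Q.kap n m) * G s) with hf
  have hfeq : ∀ s : ℝ, 0 ≤ s → f s = mat (Q.evolution s.toNNReal x) n m := by
    intro s hs
    rw [(Q.evolution_isMild x s.toNNReal n m).2, duh_eq, free, Real.coe_toNNReal s hs, hf]
    simp only
    rw [mul_add]
  have hexp : ∀ s : ℝ, HasDerivAt (fun s : ℝ => Complex.exp (-(s : ℂ) * Q.kap n m))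
      (Complex.exp (-(s : ℂ) * Q.kap n m) * -Q.kap n m) s := by
    intro s
    have h1 : HasDerivAt (fun s : ℝ => -(s : ℂ) * Q.kap n m) (-1 * Q.kap n m) s :=
      (Complex.ofRealCLM.hasDerivAt (x := s)).neg.mul_const _
    simpa using h1.cexp
  have hd : ∀ s ∈ Set.uIcc (0 : ℝ) t, HasDerivAt f (G s - Q.kap n m * f s) s := by
    intro s _
    have h2 := ((intervalIntegral.integral_hasDerivAt_right (hI.intervalIntegrable 0 s)
      hI.stronglyMeasurable.stronglyMeasurableAtFilter hI.continuousAt).const_add (mat x n m))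
    refine ((hexp s).mul h2).congr_deriv ?_
    have h3 : Complex.exp (-(s : ℂ) * Q.kap n m) * (Complex.exp ((s : ℂ) * Q.kap n m) * G s)
        = G s := by
      rw [← mul_assoc, ← Complex.exp_add]
      have : -(s : ℂ) * Q.kap n m + (s : ℂ) * Q.kap n m = 0 := by ring
      rw [this, Complex.exp_zero, one_mul]
    rw [h3]
    simp only [hf]
    ring
  have hfc : Continuous f := by
    refine Continuous.mul (by fun_prop) (continuous_const.add ?_)
    exact intervalIntegral.continuous_primitive (fun a b => hI.intervalIntegrable a b) 0
  have hint := intervalIntegral.integral_eq_sub_of_hasDerivAt hd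
    (Continuous.intervalIntegrable (by fun_prop) _ _)
  have h0 : f 0 = mat x n m := by simp [hf]
  rw [h0, hfeq t t.2, Real.toNNReal_coe] at hint
  rw [← hint]
  refine intervalIntegral.integral_congr fun s hs => ?_
  rw [Set.uIcc_of_le (show (0 : ℝ) ≤ t from t.2)] at hs
  rw [hfeq s hs.1]

lemma ratio_nonneg : 0 ≤ Q.lam / Q.mu := (div_pos Q.lam_pos Q.mu_pos).le

lemma ratio_lt_one (h : Q.lam < Q.mu) : Q.lam / Q.mu < 1 := (div_lt_one Q.mu_pos).2 h

/-- Detailed balance turns the weighted sum of the generator into a boundary term. -/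
lemma sum_weighted_generator (A : ℕ → ℕ → ℂ) (M : ℕ) :
    ∑ n ∈ Finset.range M, (((Q.lam / Q.mu) ^ (2 * n) : ℝ) : ℂ) *
        (Q.gain A n n - Q.kap n n * A n n)
      = (((Q.lam / Q.mu) ^ (2 * M) * Q.mu ^ 2 * omega Q.r M : ℝ) : ℂ)
        * (A M M - A (M - 1) (M - 1)) := by
  induction M with
  | zero => simp [Q.omega_zero]
  | succ M ih =>
    rw [Finset.sum_range_succ, ih, gain_diag, kap_diag, exitRate, Nat.add_sub_cancel]
    -- Detailed balance: the flow from `M + 1` down to `M` equals the flow from `M` up to `M + 1`,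
    -- both up to the factor `ω_{M+1}`.
    have h : (Q.lam / Q.mu) ^ (2 * (M + 1)) * Q.mu ^ 2 = (Q.lam / Q.mu) ^ (2 * M) * Q.lam ^ 2 := by
      have h' : (Q.lam / Q.mu) ^ 2 * Q.mu ^ 2 = Q.lam ^ 2 := by
        rw [div_pow, div_mul_cancel₀ _ (pow_ne_zero 2 Q.mu_pos.ne')]
      rw [mul_add, pow_add, mul_one, mul_assoc, h']
    rw [h]
    push_cast
    ring

lemma tendsto_boundary (h : Q.lam < Q.mu) :
    Tendsto (fun M : ℕ => (Q.lam / Q.mu) ^ (2 * M) * Q.mu ^ 2 * omega Q.r M) atTop (𝓝 0) := by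
  have h0 := Q.ratio_nonneg
  have h1 := Q.ratio_lt_one h
  have hν : |(Q.lam / Q.mu) ^ 2| < 1 := by
    rw [abs_of_nonneg (sq_nonneg _)]
    nlinarith
  have h2 := (tendsto_pow_const_mul_const_pow_of_abs_lt_one 2 hν).add
    ((tendsto_pow_const_mul_const_pow_of_abs_lt_one 1 hν).mul_const (Q.r - 1))
  have h3 := h2.const_mul (Q.mu ^ 2)
  rw [zero_mul, add_zero, mul_zero] at h3
  refine h3.congr fun M => ?_
  rw [omega, pow_mul]
  ring

/-- The first `M` terms of the difference of traces form a time integral of the boundary term of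
`sum_weighted_generator`, which is at most `2 ‖x‖ c M`. Working with finite `M` avoids interchanging
the trace with the unbounded generator. -/
lemma geometricState_isInvariant (h : Q.lam < Q.mu) :
    IsInvariantState Q.evolution (geometricState (Q.lam / Q.mu)) := by
  have h0 := Q.ratio_nonneg
  have h1 := Q.ratio_lt_one h
  refine ⟨geometricState_isDensity h0 h1, fun t x => ?_⟩
  set ν := Q.lam / Q.mu with hν
  have hlim := ((hasSum_tr_geometricState h0 h1 (Q.evolution t x)).sub
    (hasSum_tr_geometricState h0 h1 x)).tendsto_sum_nat
  rw [← sub_eq_zero]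
  refine tendsto_nhds_unique hlim ?_
  set c : ℕ → ℝ := fun M => ν ^ (2 * M) * Q.mu ^ 2 * omega Q.r M with hc
  have hc0 : ∀ M, 0 ≤ c M := fun M => by
    have := Q.omega_nonneg M
    positivity
  have hF := (Q.evolution_isMild x).entryCont
  have hcont : ∀ n, Continuous fun s : ℝ => Q.gain (mat (Q.evolution s.toNNReal x)) n n
        - Q.kap n n * mat (Q.evolution s.toNNReal x) n n := fun n =>
    (Q.gain_continuous hF n n).sub (continuous_const.mul (hF n n))
  have hsum : ∀ M, ∑ n ∈ Finset.range M, ((((1 - ν ^ 2) * ν ^ (2 * n) : ℝ) : ℂ) *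
        mat (Q.evolution t x) n n - (((1 - ν ^ 2) * ν ^ (2 * n) : ℝ) : ℂ) * mat x n n)
      = ((1 - ν ^ 2 : ℝ) : ℂ) * ∫ s in (0 : ℝ)..t, (c M : ℂ) *
        (mat (Q.evolution s.toNNReal x) M M - mat (Q.evolution s.toNNReal x) (M - 1) (M - 1)) := by
    intro M
    have hgen : ∀ s : ℝ, (c M : ℂ) * (mat (Q.evolution s.toNNReal x) M M
          - mat (Q.evolution s.toNNReal x) (M - 1) (M - 1))
        = ∑ n ∈ Finset.range M, ((ν ^ (2 * n) : ℝ) : ℂ) *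
          (Q.gain (mat (Q.evolution s.toNNReal x)) n n
            - Q.kap n n * mat (Q.evolution s.toNNReal x) n n) := fun s =>
      (Q.sum_weighted_generator _ M).symm
    simp_rw [hgen]
    rw [intervalIntegral.integral_finsetSum
      fun n _ => ((hcont n).intervalIntegrable _ _).const_mul _, Finset.mul_sum]
    refine Finset.sum_congr rfl fun n _ => ?_
    rw [← mul_sub, evolution_sub_eq_integral, intervalIntegral.integral_const_mul, ← mul_assoc]
    push_cast
    rfl
  simp_rw [hsum]
  have hz : Tendsto (fun M => ((1 - ν ^ 2 : ℝ) : ℂ) * ∫ s in (0 : ℝ)..t, (c M : ℂ) *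
      (mat (Q.evolution s.toNNReal x) M M - mat (Q.evolution s.toNNReal x) (M - 1) (M - 1)))
      atTop (𝓝 (((1 - ν ^ 2 : ℝ) : ℂ) * 0)) := by
    refine Tendsto.const_mul _ ?_
    have hb : Tendsto (fun M => c M * (2 * ‖x‖) * |(t : ℝ) - 0|) atTop
        (𝓝 (0 * (2 * ‖x‖) * |(t : ℝ) - 0|)) :=
      ((Q.tendsto_boundary h).mul_const _).mul_const _
    rw [zero_mul, zero_mul] at hb
    refine squeeze_zero_norm (fun M => ?_) hb
    refine intervalIntegral.norm_integral_le_of_norm_le_const fun s _ => ?_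
    rw [norm_mul, Complex.norm_real, Real.norm_of_nonneg (hc0 M)]
    refine mul_le_mul_of_nonneg_left ?_ (hc0 M)
    have hm : ∀ k, ‖mat (Q.evolution s.toNNReal x) k k‖ ≤ ‖x‖ := fun k =>
      (norm_mat_le _ _ _).trans (Q.norm_evolution_le _ _)
    exact (norm_sub_le _ _).trans (by linarith [hm M, hm (M - 1)])
  rwa [mul_zero] at hz

end Params

/-! ### The trace and uniqueness of the invariant state -/

lemma inner_star_left (a : Obs) (u v : Hilb) : inner ℂ (star a u) v = inner ℂ u (a v) := by
  rw [ContinuousLinearMap.star_eq_adjoint, ContinuousLinearMap.adjoint_inner_left]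

lemma inner_selfAdjoint {a : Obs} (ha : IsSelfAdjoint a) (u v : Hilb) :
    inner ℂ (a u) v = inner ℂ u (a v) := by
  conv_lhs => rw [← ha.star_eq]
  exact inner_star_left a u v

lemma mat_star (a : Obs) (n m : ℕ) : mat (star a) n m = conj (mat a m n) := by
  rw [mat, mat, inner_conj_symm, ← inner_star_left, star_star]

lemma mul_eq_zero_comm {a b : Obs} (ha : IsSelfAdjoint a) (hb : IsSelfAdjoint b) (h : a * b = 0) :
    b * a = 0 := by
  have := congr(star $h)
  rwa [star_mul, ha.star_eq, hb.star_eq, star_zero] at this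

lemma hasSum_mat_sq (a : Obs) (n : ℕ) : HasSum (fun m => ‖mat a m n‖ ^ 2) (‖a (e n)‖ ^ 2) := by
  simpa only [mat_eq] using norm_sq_eq_tsum (a (e n))

/-- A Hilbert–Schmidt operator has square summable matrix elements. -/
lemma summable_mat_sq {a : Obs} (ha : Summable fun n => ‖a (e n)‖ ^ 2) :
    Summable fun p : ℕ × ℕ => ‖mat a p.2 p.1‖ ^ 2 := by
  refine (summable_prod_of_nonneg fun p => sq_nonneg _).2 ⟨fun n => (hasSum_mat_sq a n).summable, ?_⟩
  simpa only [(hasSum_mat_sq a _).tsum_eq] using ha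

/-- The Hilbert–Schmidt double sum over the matrix entries is unchanged by transposition. -/
lemma summable_norm_sq_star {a : Obs} (ha : Summable fun n => ‖a (e n)‖ ^ 2) :
    Summable fun n => ‖star a (e n)‖ ^ 2 := by
  have h1 := ((summable_prod_of_nonneg fun p => sq_nonneg _).1 (summable_mat_sq ha).prod_symm).2
  refine h1.congr fun n => ?_
  rw [← (hasSum_mat_sq (star a) n).tsum_eq]
  refine tsum_congr fun m => ?_
  simp [mat_star]

/-- Cyclicity of the trace for a Hilbert–Schmidt square root. -/
lemma hasSum_trace_cyclic {b : Obs} (hb : IsSelfAdjoint b) (hs : Summable fun n => ‖b (e n)‖ ^ 2)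
    (y : Obs) : ∃ c, HasSum (fun n => inner ℂ (e n) ((b * b * y) (e n))) c ∧
      HasSum (fun n => inner ℂ (b (e n)) (y (b (e n)))) c := by
  have hby : Summable fun n => ‖(b * y) (e n)‖ ^ 2 := by
    have h1 : Summable fun n => ‖(star y * b) (e n)‖ ^ 2 := by
      refine Summable.of_nonneg_of_le (fun n => sq_nonneg _) (fun n => ?_) (hs.mul_left (‖star y‖ ^ 2))
      rw [← mul_pow]
      gcongr
      exact (star y).le_opNorm _
    simpa [hb.star_eq] using summable_norm_sq_star h1
  -- A product of two square summable families; its row sums and its column sums are the terms of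
  -- the two series to be compared.
  have hFs : Summable fun p : ℕ × ℕ => mat b p.1 p.2 * mat (b * y) p.2 p.1 := by
    refine Summable.of_norm_bounded
      (((summable_mat_sq hs).prod_symm.add (summable_mat_sq hby)).div_const 2) fun p => ?_
    rw [norm_mul]
    have := two_mul_le_add_sq ‖mat b p.1 p.2‖ ‖mat (b * y) p.2 p.1‖
    simp only [Prod.fst_swap, Prod.snd_swap]
    linarith
  have hrow : ∀ n, HasSum (fun m => mat b n m * mat (b * y) m n)
      (inner ℂ (e n) ((b * b * y) (e n))) := fun n => by
    have h1 : inner ℂ (e n) ((b * b * y) (e n)) = inner ℂ (b (e n)) ((b * y) (e n)) :=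
      (inner_selfAdjoint hb _ _).symm
    rw [h1]
    refine (lp.hasSum_inner (b (e n)) ((b * y) (e n))).congr_fun fun m => ?_
    rw [RCLike.inner_apply, ← mat_eq, ← mat_eq, mul_comm]
    congr 1
    rw [← mat_star, hb.star_eq]
  have hcol : ∀ m, HasSum (fun n => mat b n m * mat (b * y) m n)
      (inner ℂ (b (e m)) (y (b (e m)))) := fun m => by
    have h1 : inner ℂ (b (e m)) (y (b (e m))) = inner ℂ ((star y * b) (e m)) (b (e m)) :=
      (inner_star_left y _ _).symm
    rw [h1]
    refine (lp.hasSum_inner ((star y * b) (e m)) (b (e m))).congr_fun fun n => ?_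
    rw [RCLike.inner_apply, ← mat_eq, ← mat_eq]
    congr 1
    rw [← mat_star, star_mul, star_star, hb.star_eq]
  obtain ⟨c, hc⟩ := hFs
  have hc' : HasSum (fun p : ℕ × ℕ => mat b p.2 p.1 * mat (b * y) p.1 p.2) c :=
    (Equiv.prodComm ℕ ℕ).hasSum_iff.1 hc
  exact ⟨c, hc.prod_fiberwise hrow, hc'.prod_fiberwise hcol⟩

/-- The positive trace class operators. -/
def IsPosTrace (a : Obs) : Prop := 0 ≤ a ∧ Summable fun n => (mat a n n).re

lemma norm_sqrt_apply {a b : Obs} (hb : IsSelfAdjoint b) (hab : b * b = a) (u : Hilb) :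
    ‖b u‖ ^ 2 = (inner ℂ u (a u)).re := by
  rw [← hab, mul_apply_eq_comp, ← inner_selfAdjoint hb, inner_self_eq_norm_sq_to_K]
  norm_cast

lemma IsPosTrace.exists_sqrt {a : Obs} (ha : IsPosTrace a) :
    ∃ b : Obs, IsSelfAdjoint b ∧ b * b = a ∧ Summable fun n => ‖b (e n)‖ ^ 2 := by
  obtain ⟨b, hb, hab⟩ := QuadraticOscillator.exists_sqrt ha.1
  refine ⟨b, hb, hab, ha.2.congr fun n => ?_⟩
  rw [norm_sqrt_apply hb hab, mat]

/-- The product `a * y` need not be positive, but the second series, with `b` the square root of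
`a`, is termwise nonnegative when `y ≥ 0`. -/
lemma IsPosTrace.exists_hasSum {a : Obs} (ha : IsPosTrace a) :
    ∃ b : Obs, IsSelfAdjoint b ∧ b * b = a ∧ ∀ y,
      HasSum (fun n => inner ℂ (e n) ((a * y) (e n))) (tr (a * y)) ∧
      HasSum (fun n => inner ℂ (b (e n)) (y (b (e n)))) (tr (a * y)) := by
  obtain ⟨b, hb, hab, hs⟩ := ha.exists_sqrt
  refine ⟨b, hb, hab, fun y => ?_⟩
  obtain ⟨c, h1, h2⟩ := hasSum_trace_cyclic hb hs y
  rw [hab] at h1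
  rw [tr, h1.tsum_eq]
  exact ⟨h1, h2⟩

lemma IsPosTrace.hasSum_tr {a : Obs} (ha : IsPosTrace a) (y : Obs) :
    HasSum (fun n => inner ℂ (e n) ((a * y) (e n))) (tr (a * y)) := by
  obtain ⟨b, -, -, h⟩ := ha.exists_hasSum
  exact (h y).1

lemma IsPosTrace.tr_nonneg {a y : Obs} (ha : IsPosTrace a) (hy : 0 ≤ y) : 0 ≤ tr (a * y) := by
  obtain ⟨b, -, -, h⟩ := ha.exists_hasSum
  exact (h y).2.nonneg fun n => (nonneg_iff y).1 hy _

lemma apply_eq_zero_of_inner {y : Obs} (hy : 0 ≤ y) {u : Hilb} (h : inner ℂ u (y u) = 0) :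
    y u = 0 := by
  obtain ⟨s, hs, rfl⟩ := QuadraticOscillator.exists_sqrt hy
  have h1 := norm_sqrt_apply hs rfl u
  rw [h, Complex.zero_re] at h1
  have h2 : s u = 0 := by simpa using h1
  rw [mul_apply_eq_comp, h2, map_zero]

/-- A sum of nonnegative terms `⟨b e_n, y b e_n⟩` vanishes, so `y` kills every `b e_n`, hence `y b =
0`. -/
lemma IsPosTrace.mul_eq_zero {a y : Obs} (ha : IsPosTrace a) (hy : 0 ≤ y) (h0 : tr (a * y) = 0) :
    y * a = 0 := by
  obtain ⟨b, -, hab, h⟩ := ha.exists_hasSum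
  have h1 := (h y).2
  rw [h0] at h1
  have h2 := (hasSum_zero_iff_of_nonneg fun n => (nonneg_iff y).1 hy _).1 h1
  have h3 : y * b = 0 := op_ext fun n m => by
    rw [mat_zero, mat, mul_apply_eq_comp, apply_eq_zero_of_inner hy (congr_fun h2 m),
      inner_zero_right]
  rw [← hab, ← mul_assoc, h3, zero_mul]

lemma IsDensity.isPosTrace {ρ : Obs} (h : IsDensity ρ) : IsPosTrace ρ :=
  ⟨h.1, (Complex.hasSum_re h.2).summable⟩

lemma IsDensity.tr_eq {ρ : Obs} (h : IsDensity ρ) : tr (ρ * 1) = 1 := by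
  rw [mul_one]; exact h.2.tsum_eq

lemma IsPosTrace.of_sub_eq {a c σ ρ : Obs} (ha : IsPosTrace a) (hσ : IsPosTrace σ)
    (hρ : IsPosTrace ρ) (hc : 0 ≤ c) (h : σ - ρ = a - c) : IsPosTrace c := by
  refine ⟨hc, ((ha.2.sub hσ.2).add hρ.2).congr fun n => ?_⟩
  have h1 : c = a - σ + ρ := by
    rw [sub_eq_sub_iff_add_eq_add] at h
    rw [sub_add_eq_add_sub, ← h, add_sub_cancel_left]
  rw [h1, mat_add, mat_sub]
  simp

/-- The part of a difference of trace class operators under a commuting projection is trace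
class. -/
lemma isPosTrace_of_compression {a σ ρ p : Obs} (hσ : IsPosTrace σ) (hρ : 0 ≤ ρ) (ha : 0 ≤ a)
    (hp : IsStarProjection p) (h : a = p * (σ - ρ) * p) : IsPosTrace a := by
  refine ⟨ha, ?_⟩
  obtain ⟨b, hb, hbσ, hs⟩ := hσ.exists_sqrt
  have h1 : Summable fun n => ‖(b * p) (e n)‖ ^ 2 := by
    have h2 : Summable fun n => ‖(p * b) (e n)‖ ^ 2 := by
      refine Summable.of_nonneg_of_le (fun n => sq_nonneg _) (fun n => ?_) (hs.mul_left (‖p‖ ^ 2))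
      rw [← mul_pow]
      gcongr
      exact p.le_opNorm _
    simpa [hb.star_eq, hp.isSelfAdjoint.star_eq] using summable_norm_sq_star h2
  refine Summable.of_nonneg_of_le (fun n => ?_) (fun n => ?_) h1
  · exact (Complex.nonneg_iff.1 ((nonneg_iff a).1 ha (e n))).1
  · have h2 : mat a n n = inner ℂ (p (e n)) (σ (p (e n))) - inner ℂ (p (e n)) (ρ (p (e n))) := by
      rw [mat, h]
      simp only [mul_apply_eq_comp, sub_apply]
      rw [← inner_selfAdjoint hp.isSelfAdjoint, inner_sub_right]
    have h3 := (Complex.nonneg_iff.1 ((nonneg_iff ρ).1 hρ (p (e n)))).1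
    rw [h2, Complex.sub_re, mul_apply_eq_comp, norm_sqrt_apply hb hbσ]
    linarith

lemma tr_sub_eq {a c σ ρ : Obs} (ha : IsPosTrace a) (hc : IsPosTrace c) (hσ : IsPosTrace σ)
    (hρ : IsPosTrace ρ) (h : σ - ρ = a - c) (y : Obs) :
    tr (σ * y) - tr (ρ * y) = tr (a * y) - tr (c * y) := by
  refine ((hσ.hasSum_tr y).sub (hρ.hasSum_tr y)).unique ?_
  refine ((ha.hasSum_tr y).sub (hc.hasSum_tr y)).congr_fun fun n => ?_
  rw [← inner_sub_right, ← inner_sub_right, ← sub_apply, ← sub_apply, ← sub_mul, ← sub_mul, h]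

/-- An irreducible quantum Markov semigroup has at most one invariant normal state. -/
lemma IsInvariantState.unique {T : ℝ≥0 → (Obs →ₗ[ℂ] Obs)}
    (hpos : ∀ t x, 0 ≤ x → 0 ≤ T t x) (hone : ∀ t, T t 1 = 1) (hirr : IsIrreducible T) {σ ρ : Obs}
    (hσ : IsInvariantState T σ) (hρ : IsInvariantState T ρ) : σ = ρ := by
  have tσ := hσ.1.isPosTrace
  have tρ := hρ.1.isPosTrace
  obtain ⟨a, c, ha, hc, hac, hca⟩ := exists_posPart_negPart
    ((IsSelfAdjoint.of_nonneg tσ.1).sub (IsSelfAdjoint.of_nonneg tρ.1))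
  have sa := IsSelfAdjoint.of_nonneg ha
  have sc := IsSelfAdjoint.of_nonneg hc
  -- Thus `1 - q` is the support projection of the positive part `a`, and it is orthogonal to the
  -- negative part `c`.
  set q : Obs := (LinearMap.ker (a : Hilb →ₗ[ℂ] Hilb)).starProjection with hq
  have hqp : IsStarProjection q := isStarProjection_starProjection
  have hp : IsStarProjection (1 - q) := hqp.one_sub
  have haq : a * q = 0 := by
    ext1 u
    exact LinearMap.mem_ker.1
      (Submodule.starProjection_apply_mem (LinearMap.ker (a : Hilb →ₗ[ℂ] Hilb)) u)
  have hqz : ∀ z : Obs, a * z = 0 → (1 - q) * z = 0 := by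
    intro z hz
    rw [sub_mul, one_mul, sub_eq_zero]
    ext1 u
    have hm : z u ∈ LinearMap.ker (a : Hilb →ₗ[ℂ] Hilb) := LinearMap.mem_ker.2 congr($hz u)
    exact (Submodule.starProjection_eq_self_iff.2 hm).symm
  have hqa : q * a = 0 := mul_eq_zero_comm sa hqp.isSelfAdjoint haq
  have hap : a * (1 - q) = a := by rw [mul_sub, mul_one, haq, sub_zero]
  have hpa : (1 - q) * a = a := by rw [sub_mul, one_mul, hqa, sub_zero]
  have hpc : (1 - q) * c = 0 := hqz c (mul_eq_zero_comm sc sa hca)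
  have hcp : c * (1 - q) = 0 := mul_eq_zero_comm hp.isSelfAdjoint sc hpc
  have ta : IsPosTrace a := isPosTrace_of_compression tσ tρ.1 ha hp (by
    rw [hac, mul_sub (1 - q) a c, hpa, hpc, sub_zero, hap])
  have tc : IsPosTrace c := ta.of_sub_eq tσ tρ hc hac
  have htr := tr_sub_eq ta tc tσ tρ hac
  have hone' : tr (a * 1) = tr (c * 1) := by
    have h := htr 1
    rw [hσ.1.tr_eq, hρ.1.tr_eq, sub_self] at h
    exact (sub_eq_zero.1 h.symm)
  have hp0 : ∀ {r : Obs}, IsStarProjection r → 0 ≤ r := fun {r} hr => (nonneg_iff r).2 fun u => by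
    rw [inner_proj hr, Complex.zero_le_real]; positivity
  have hsub : IsSubharmonic T (1 - q) := by
    refine ⟨hp, fun t => ?_⟩
    set y := T t (1 - q) with hy
    have hy0 : 0 ≤ y := hpos t _ (hp0 hp)
    have hy1 : 0 ≤ 1 - y := by
      rw [hy, ← hone t, ← map_sub, hone t, sub_sub_cancel]
      exact hpos t _ (hp0 hqp)
    have h1 := htr y
    rw [hy, hσ.2, hρ.2, htr, hap, hcp, ← hy] at h1
    have h0 : tr (0 : Obs) = 0 := by simp [tr]
    have h2 : tr (a * (1 - y)) = tr (a * 1) - tr (a * y) := by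
      refine (ta.hasSum_tr _).unique
        (((ta.hasSum_tr 1).sub (ta.hasSum_tr y)).congr_fun fun n => ?_)
      rw [← inner_sub_right, ← sub_apply, ← mul_sub]
    -- Invariance of both states gives `tr (a y) - tr (c y) = tr a`, so this trace equals `-tr (c y)
    -- ≤ 0`, while it is nonnegative because `y ≤ 1`.
    have h3 : tr (a * (1 - y)) = 0 := by
      refine le_antisymm ?_ (ta.tr_nonneg hy1)
      rw [h0, sub_zero] at h1
      rw [h2, mul_one, h1, sub_sub_cancel_left, neg_nonpos]
      exact tc.tr_nonneg hy0
    have h4 : (1 - y) * a = 0 := ta.mul_eq_zero hy1 h3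
    have sy : IsSelfAdjoint (1 - y) := IsSelfAdjoint.of_nonneg hy1
    have h5 : (1 - q) * (1 - y) = 0 := hqz _ (mul_eq_zero_comm sy sa h4)
    have h6 : (1 - y) * (1 - q) = 0 := mul_eq_zero_comm hp.isSelfAdjoint sy h5
    -- On the support of `a` the operator `y` acts as the identity, so its off-diagonal blocks
    -- vanish and only the positive block under `q` remains.
    have h7 : y - (1 - q) = q * y * star q := by
      have h8 : (1 - q) * y = 1 - q := by
        rw [mul_sub, mul_one, sub_eq_zero] at h5
        exact h5.symm
      have h9 : y * (1 - q) = 1 - q := by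
        rw [sub_mul, one_mul, sub_eq_zero] at h6
        exact h6.symm
      rw [hqp.isSelfAdjoint.star_eq]
      have h10 : q * y = y - (1 - q) := by
        rw [sub_mul, one_mul] at h8
        rw [← h8]; abel
      rw [h10, sub_mul, hqp.one_sub_mul_self, sub_zero]
      rw [mul_sub, mul_one] at h9
      rw [← h9]; abel
    rw [← sub_nonneg, h7]
    exact star_right_conjugate_nonneg hy0 q
  rw [← sub_eq_zero, hac]
  -- A support equal to `0` gives `a = 0`, a support equal to `1` gives `c = 0`; since `tr a = tr
  -- c`, the other part has trace zero and vanishes too.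
  rcases (hirr _).1 hsub with h | h
  · have ha0 : a = 0 := by rw [← hpa, h, zero_mul]
    have h1 : tr (c * 1) = 0 := by rw [← hone', ha0, zero_mul]; simp [tr]
    have h2 := tc.mul_eq_zero (hp0 (.one _)) h1
    rw [one_mul] at h2
    rw [ha0, h2, sub_zero]
  · have hc0 : c = 0 := by rw [← one_mul c, ← h, hpc]
    have h1 : tr (a * 1) = 0 := by rw [hone', hc0, zero_mul]; simp [tr]
    have h2 := ta.mul_eq_zero (hp0 (.one _)) h1
    rw [one_mul] at h2
    rw [hc0, h2, sub_zero]

end QuadraticOscillator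

end

theorem proposition3 (Q : QuadraticOscillator.Params) (hle : Q.lam ≤ Q.mu) :
    (∃! T : ℝ≥0 → (QuadraticOscillator.Obs →ₗ[ℂ] QuadraticOscillator.Obs),
      QuadraticOscillator.IsMinimalQDS Q T) ∧
    ∀ T : ℝ≥0 → (QuadraticOscillator.Obs →ₗ[ℂ] QuadraticOscillator.Obs),
      QuadraticOscillator.IsMinimalQDS Q T →
        QuadraticOscillator.IsQMS T ∧
        QuadraticOscillator.IsIrreducible T ∧
        (Q.lam < Q.mu → ∀ ρ : QuadraticOscillator.Obs,
          QuadraticOscillator.IsInvariantState T ρ ↔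
            ρ = QuadraticOscillator.geometricState (Q.lam / Q.mu)) := by
  refine ⟨⟨Q.evolution, Q.evolution_isMinimalQDS hle, fun T hT =>
    Q.eq_evolution_of_isMinimalQDS hle hT⟩, fun T hT => ?_⟩
  obtain rfl := Q.eq_evolution_of_isMinimalQDS hle hT
  refine ⟨⟨hT.isQDS, Q.evolution_one hle⟩, Q.evolution_isIrreducible hle, fun hlt ρ => ?_⟩
  have hgeo := Q.geometricState_isInvariant hlt
  refine ⟨fun hρ => ?_, fun hρ => hρ ▸ hgeo⟩
  exact hρ.unique (fun t x hx => Q.evolution_nonneg t hx) (Q.evolution_one hle)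
    (Q.evolution_isIrreducible hle) hgeo
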